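/- **Conventions.** A 3-SAT instance is a 3-CNF formula $\phi$; its size $n$ is its number of variables plus its number of clauses. A *projection game* consists of a bipartite graph $G=(A,B,E)$, alphabets $\Sigma_A,\Sigma_B$, and a map $\pi_e:\Sigma_A\to\Sigma_B$ for every $e\in E$. A labeling $\sigma_A:A\to\Sigma_A$, $\sigma_B:B\to\Sigma_B$ covers the edge $e=(a,b)$ if $\pi_e(\sigma_A(a))=\sigma_B(b)$. The size of the game is $|A|+|B|+|E|$. The graph is bi-regular if all vertices of $A$ have the same degree and all vertices of $B$ have the same degree. **Projection Games Conjecture (bounded-degree variant).** For every $k\in\mathbb N$ there is a polynomial-time algorithm that maps every 3-SAT instance $\phi$ of size $n$ to a projection game such that - the graph is bi-regular and has at least one edge; - the game has size at most $n^{1+o(1)}$, and all degrees and both alphabets have size at most $(\log n)^{O(1)}$ as $n\to\infty$ (the exponent may depend on $k$); - if $\phi$ is satisfiable, then some labeling covers all edges; - if $\phi$ is not satisfiable, then every labeling covers at most a fraction $1/(\log n)^k$ of the edges. **Theorem.** Assume the conjecture above. Fix constants $\gamma>0$ and $\epsilon>0$. There is a polynomial-time algorithm that, given a 3-SAT instance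 $\phi$ of size $n$ and an integer $u$ (in unary), produces an unweighted Set Cover instance $I$ and a natural number $x$ such that, whenever $1\le u\le n^{\gamma}$, - the universe of $I$ has size at most $n^{1+o(1)}\cdot u$, where the $o(1)$ tends to $0$ as $n\to\infty$, uniformly in $\phi$ and $u$; - if $\phi$ is satisfiable, then $I$ has a set cover of size $x$; - if $\phi$ is not satisfiable, then $I$ has no set cover of size at most $x\,(1-\epsilon)\ln u$. -/

import Mathlib

namespace SetCoverHardness

/-! ### The model of computation

Data are finite binary trees.  Programs form the usual WHILE language over binary trees, written
without variables: every program maps a tree to a tree.  A step that touches a tree is charged the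
size of that tree, so that a run of cost `t` handles data of total size `O(t)`; a multi-tape Turing
machine simulates it in time polynomial in `t`, and conversely a tree program simulates Turing
machines with polynomial overhead. -/

/-- Finite binary trees. -/
inductive BinTree : Type
  | leaf : BinTree
  | node : BinTree → BinTree → BinTree

namespace BinTree

/-- The number of nodes of a tree, leaves included. -/
def size : BinTree → ℕ
  | leaf => 1
  | node l r => l.size + r.size + 1

/-- The left subtree (of a leaf: a leaf). -/
def left : BinTree → BinTree
  | leaf => leaf
  | node l _ => l

/-- The right subtree (of a leaf: a leaf). -/
def right : BinTree → BinTree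
  | leaf => leaf
  | node _ r => r

end BinTree

/-- Programs on binary trees. The meaning of the constructors is given by `Prog.Runs`. -/
inductive Prog : Type
  | id : Prog
  | leaf : Prog
  | left : Prog
  | right : Prog
  | pair : Prog → Prog → Prog
  | seq : Prog → Prog → Prog
  | cond : Prog → Prog → Prog → Prog
  | loop : Prog → Prog → Prog

/-- `Prog.Runs p x y t`: on input `x` the program `p` halts with output `y` after `t` steps. -/
inductive Prog.Runs : Prog → BinTree → BinTree → ℕ → Prop
  /-- copy the input -/
  | id (x : BinTree) : Runs .id x x x.size
  /-- erase the input and return a leaf -/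
  | leaf (x : BinTree) : Runs .leaf x .leaf x.size
  /-- return the left subtree -/
  | left (x : BinTree) : Runs .left x x.left x.size
  /-- return the right subtree -/
  | right (x : BinTree) : Runs .right x x.right x.size
  /-- run `p` and `q` on (copies of) the input and join the two results -/
  | pair {p q : Prog} {x y z : BinTree} {s t : ℕ} :
      Runs p x y s → Runs q x z t → Runs (.pair p q) x (.node y z) (x.size + s + t)
  /-- run `p`, then `q` on the result -/
  | seq {p q : Prog} {x y z : BinTree} {s t : ℕ} :
      Runs p x y s → Runs q y z t → Runs (.seq p q) x z (s + t)
  /-- `if c x ≠ leaf then p x else q x`, in the case of a positive answer -/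
  | cond_node {c p q : Prog} {x l r y : BinTree} {s t : ℕ} :
      Runs c x (.node l r) s → Runs p x y t → Runs (.cond c p q) x y (x.size + s + t)
  /-- `if c x ≠ leaf then p x else q x`, in the case of a negative answer -/
  | cond_leaf {c p q : Prog} {x y : BinTree} {s t : ℕ} :
      Runs c x .leaf s → Runs q x y t → Runs (.cond c p q) x y (x.size + s + t)
  /-- `while c x ≠ leaf do x := p x`: one round of the loop, and then the rest -/
  | loop_node {c p : Prog} {x l r y z : BinTree} {s t t' : ℕ} :
      Runs c x (.node l r) s → Runs p x y t → Runs (.loop c p) y z t' →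
      Runs (.loop c p) x z (x.size + s + t + t')
  /-- `while c x ≠ leaf do x := p x`: exit from the loop -/
  | loop_leaf {c p : Prog} {x : BinTree} {s : ℕ} :
      Runs c x .leaf s → Runs (.loop c p) x x (x.size + s)

/-- A type whose elements are represented, injectively, by binary trees. -/
class TreeEncodable (α : Type) where
  enc : α → BinTree
  enc_injective : Function.Injective enc

/-- `f` is computable in polynomial time: some program computes `f` and runs on every input for at
most `P (size of the input)` steps, for a fixed polynomial `P`. -/
def PolyTime {α β : Type} [TreeEncodable α] [TreeEncodable β] (f : α → β) : Prop :=
  ∃ (p : Prog) (P : Polynomial ℕ), ∀ a : α, ∃ t ≤ P.eval (TreeEncodable.enc a).size,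
    p.Runs (TreeEncodable.enc a) (TreeEncodable.enc (f a)) t

/-! ### Representation of the basic types

Natural numbers are written in unary.  All numbers that occur below are counts of objects, or
indices of objects, in the same instance, or (for the parameter `u`) polynomially bounded, so
binary notation would lead to the same notion of polynomial time. -/

/-- Unary notation. -/
def encNat : ℕ → BinTree
  | 0 => .leaf
  | n + 1 => .node .leaf (encNat n)

theorem encNat_injective : Function.Injective encNat := by
  intro a
  induction a with
  | zero => intro b h; cases b <;> simp_all [encNat]
  | succ a ih =>
    intro b h
    cases b with
    | zero => simp [encNat] at h
    | succ b => simp only [encNat, BinTree.node.injEq, true_and] at h; rw [ih h]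

instance : TreeEncodable ℕ := ⟨encNat, encNat_injective⟩

instance : TreeEncodable Bool where
  enc b := if b then .node .leaf .leaf else .leaf
  enc_injective := by intro a b; cases a <;> cases b <;> simp

instance (n : ℕ) : TreeEncodable (Fin n) where
  enc i := encNat i
  enc_injective _ _ h := Fin.ext (encNat_injective h)

instance {α β : Type} [TreeEncodable α] [TreeEncodable β] : TreeEncodable (α × β) where
  enc x := .node (TreeEncodable.enc x.1) (TreeEncodable.enc x.2)
  enc_injective := by
    rintro ⟨a, b⟩ ⟨c, d⟩ h
    simp only [BinTree.node.injEq] at h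
    exact Prod.ext (TreeEncodable.enc_injective h.1) (TreeEncodable.enc_injective h.2)

/-- An optional object: a leaf if it is absent. -/
def encOption {α : Type} [TreeEncodable α] : Option α → BinTree
  | none => .leaf
  | some a => .node .leaf (TreeEncodable.enc a)

instance {α : Type} [TreeEncodable α] : TreeEncodable (Option α) where
  enc := encOption
  enc_injective := by
    intro a b h
    cases a <;> cases b <;> simp only [encOption, BinTree.node.injEq, true_and, reduceCtorEq] at h
    · rfl
    · rw [TreeEncodable.enc_injective h]

/-- A list, as a right comb. -/
def encList {α : Type} [TreeEncodable α] : List α → BinTree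
  | [] => .leaf
  | a :: l => .node (TreeEncodable.enc a) (encList l)

theorem encList_injective {α : Type} [TreeEncodable α] :
    Function.Injective (encList : List α → BinTree) := by
  intro a
  induction a with
  | nil => intro b h; cases b <;> simp_all [encList]
  | cons a l ih =>
    intro b h
    cases b with
    | nil => simp [encList] at h
    | cons b m =>
      simp only [encList, BinTree.node.injEq] at h
      rw [TreeEncodable.enc_injective h.1, ih h.2]

instance {α : Type} [TreeEncodable α] : TreeEncodable (List α) := ⟨encList, encList_injective⟩

/-- A finite sequence, as the list of its values. -/
instance {α : Type} [TreeEncodable α] (n : ℕ) : TreeEncodable (Fin n → α) where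
  enc f := encList (List.ofFn f)
  enc_injective _ _ h := List.ofFn_injective (encList_injective h)

/-! ### 3-SAT -/

/-- A 3-CNF formula in the variables `0, …, vars - 1`.  A literal is a variable together with a sign
(`true` for the variable, `false` for its negation); a clause consists of three literals, which may
coincide. -/
structure CNF3 where
  vars : ℕ
  clauses : List (Fin 3 → Fin vars × Bool)

namespace CNF3

instance : TreeEncodable CNF3 where
  enc φ := .node (TreeEncodable.enc φ.vars) (TreeEncodable.enc φ.clauses)
  enc_injective := by
    rintro ⟨v, c⟩ ⟨v', c'⟩ h
    simp only [BinTree.node.injEq] at h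
    obtain ⟨h1, h2⟩ := h
    obtain rfl := TreeEncodable.enc_injective h1
    obtain rfl := TreeEncodable.enc_injective h2
    rfl

/-- The size of a formula: the number of variables plus the number of clauses. -/
def size (φ : CNF3) : ℕ := φ.vars + φ.clauses.length

/-- Some truth assignment makes a literal of every clause true. -/
def Satisfiable (φ : CNF3) : Prop :=
  ∃ τ : Fin φ.vars → Bool, ∀ c ∈ φ.clauses, ∃ j : Fin 3, τ (c j).1 = (c j).2

end CNF3

/-! ### Projection games (label cover with the projection property) -/

/-- A projection game: vertex sets `A = Fin nA`, `B = Fin nB`, alphabets `Σ_A = Fin sA`,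
`Σ_B = Fin sB`; the pair `(a, b)` is an edge of the bipartite graph iff `proj a b` is not `none`,
and `proj a b = some π` says that the edge carries the projection `π : Σ_A → Σ_B`. -/
structure ProjectionGame where
  nA : ℕ
  nB : ℕ
  sA : ℕ
  sB : ℕ
  proj : Fin nA → Fin nB → Option (Fin sA → Fin sB)

namespace ProjectionGame

instance : TreeEncodable ProjectionGame where
  enc G := .node (TreeEncodable.enc ((G.nA, G.nB), (G.sA, G.sB))) (TreeEncodable.enc G.proj)
  enc_injective := by
    rintro ⟨a, b, c, d, p⟩ ⟨a', b', c', d', p'⟩ h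
    simp only [BinTree.node.injEq] at h
    obtain ⟨h1, h2⟩ := h
    have h1 := TreeEncodable.enc_injective h1
    simp only [Prod.mk.injEq] at h1
    obtain ⟨⟨rfl, rfl⟩, rfl, rfl⟩ := h1
    obtain rfl := TreeEncodable.enc_injective h2
    rfl

/-- The edges of the underlying bipartite graph. -/
def edges (G : ProjectionGame) : Finset (Fin G.nA × Fin G.nB) :=
  Finset.univ.filter fun e => (G.proj e.1 e.2).isSome

/-- The size of the game: the number of vertices plus the number of edges. -/
def size (G : ProjectionGame) : ℕ := G.nA + G.nB + G.edges.card

/-- Every vertex of `A` has degree `dA`, and every vertex of `B` has degree `dB`. -/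
def BiRegular (G : ProjectionGame) (dA dB : ℕ) : Prop :=
  (∀ a, (G.edges.filter fun e => e.1 = a).card = dA) ∧
    (∀ b, (G.edges.filter fun e => e.2 = b).card = dB)

/-- The edges `(a, b)` covered by a labeling, that is, those with `π (σA a) = σB b`. -/
def covered (G : ProjectionGame) (σA : Fin G.nA → Fin G.sA) (σB : Fin G.nB → Fin G.sB) :
    Finset (Fin G.nA × Fin G.nB) :=
  G.edges.filter fun e => (G.proj e.1 e.2).map (fun π => π (σA e.1)) = some (σB e.2)

end ProjectionGame

open Filter in
/-- The Projection Games Conjecture, in the variant with bounded degrees: for every `k`, with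
soundness error `1 / (log n) ^ k`, there is a polynomial-time reduction from 3-SAT on inputs of
size `n` to projection games with perfect completeness, of size `n ^ (1 + o(1))`, on bi-regular
graphs with at least one edge, with alphabets and degrees of size `polylog n`. -/
def ProjectionGamesConjecture : Prop :=
  ∀ k : ℕ, ∃ f : CNF3 → ProjectionGame, PolyTime f ∧
    -- the graph
    (∀ φ, (f φ).edges.Nonempty ∧ ∃ dA dB, (f φ).BiRegular dA dB) ∧
    -- completeness
    (∀ φ, φ.Satisfiable → ∃ σA σB, (f φ).covered σA σB = (f φ).edges) ∧
    -- soundness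
    (∀ φ, ¬ φ.Satisfiable → ∀ σA σB,
      (((f φ).covered σA σB).card : ℝ) * Real.log φ.size ^ k ≤ (f φ).edges.card) ∧
    -- size
    (∀ δ : ℝ, 0 < δ → ∀ᶠ n : ℕ in atTop, ∀ φ : CNF3, φ.size = n →
      ((f φ).size : ℝ) ≤ (n : ℝ) ^ (1 + δ)) ∧
    -- degrees and alphabets
    (∃ c : ℕ, ∀ᶠ n : ℕ in atTop, ∀ φ : CNF3, φ.size = n →
      (∀ dA dB, (f φ).BiRegular dA dB →
        (dA : ℝ) ≤ Real.log n ^ c ∧ (dB : ℝ) ≤ Real.log n ^ c) ∧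
      ((f φ).sA : ℝ) ≤ Real.log n ^ c ∧ ((f φ).sB : ℝ) ≤ Real.log n ^ c)

/-! ### Set Cover -/

/-- An (unweighted) Set Cover instance: the universe `Fin N` and the `m` subsets
`{e | mem i e = true}`, `i : Fin m`. -/
structure SetCover where
  N : ℕ
  m : ℕ
  mem : Fin m → Fin N → Bool

namespace SetCover

instance : TreeEncodable SetCover where
  enc I := .node (TreeEncodable.enc (I.N, I.m)) (TreeEncodable.enc I.mem)
  enc_injective := by
    rintro ⟨a, b, p⟩ ⟨a', b', p'⟩ h
    simp only [BinTree.node.injEq] at h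
    obtain ⟨h1, h2⟩ := h
    have h1 := TreeEncodable.enc_injective h1
    simp only [Prod.mk.injEq] at h1
    obtain ⟨rfl, rfl⟩ := h1
    obtain rfl := TreeEncodable.enc_injective h2
    rfl

/-- The subcollection `S` covers the universe. Its size is `S.card`. -/
def IsCover (I : SetCover) (S : Finset (Fin I.m)) : Prop :=
  ∀ e : Fin I.N, ∃ i ∈ S, I.mem i e = true

end SetCover

end SetCoverHardness

/-!
Let `G` be the projection game that the conjecture provides for `φ`, with soundness error
`1 / (log n) ^ 3`, and fix a constant `D ≥ 2 / ε`. An element of the universe is a triple `(b, t, e)`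
of a vertex `b ∈ B`, a `D`-tuple `t` of neighbors of `b` and a word `e : Σ_B → {0, …, D - 1}` from a
family `L`. There is a set for every vertex `a ∈ A` and every label `σ` of `a`; it contains
`(b, t, e)` if `a` is the entry of `t` at the position `e (π_(a,b) σ)`. A labeling that covers all
edges yields a set cover of size `x = |A|` (`ProjectionGame.exists_isCover`).

**Soundness.** The family `L` is chosen such that for every partial function `c` from `Σ_B` to
`{0, …, D - 1}` with at most `T` values, where `T ≥ (D - 1) * log u`, some `e ∈ L` differs from `c`
wherever `c` is defined. A set cover assigns a list of labels to every `a ∈ A`. Fix `(b, t)`. If the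
lists of the entries of `t` have total size at most `T` and no two entries suggest the same label of
`b`, then the suggested labels form such a partial function `c`, and some `(b, t, e)` is not
covered (`lt_sum_card_of_covered`). Two random neighbors of `b` with lists of size at most `T`
suggest a common label with probability at most `T ^ 2 / (log n) ^ 3`, because every pair of
positions in the lists gives rise to a labeling of the game (`sum_card_agree_mul_le`). Hence for
almost all `(b, t)` the lists have total size more than `T`, and by regularity a list has average
size about `T / D ≥ (1 - 1 / D) * log u` (`card_cover_lower_bound`).

**The words.** A random family of `u * polylog n` words would do, as a random word
avoids a given `c` with probability `(1 - 1 / D) ^ T ≈ 1 / u`. An explicit family is obtained as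
follows. For conditions with `t` values, all of which are listed, words are chosen greedily, each by
the method of conditional expectations (`isHitting_greedyFamily`, `length_greedyFamily_le`). The
list has `(polylog n) ^ t` entries, which is polynomial for `t = T / log (log n)`. Words for `T`
values arise from `log (log n)` words of this kind by cutting `Σ_B` into intervals in all possible
ways (`IsHitting.splice`). This costs a factor `(polylog n) ^ O(log (log n)) = n ^ o(1)`
(`Regime.length_wordFamily_le`, `eventually_ratio_pow_le`), and so do the `D`-tuples of neighbors.

**Running time.** Polynomial time is shown to be closed under composition, pairing, case distinction
and recursion along lists with values of polynomially bounded size (`PolyTime.foldl`). The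
reduction is composed from these operations. Bounds that only hold for large `n` and `u ≤ n ^ γ`
are used on the subtype of such inputs; the finitely many small formulas are looked up in a
table.
-/

namespace SetCoverHardness

open TreeEncodable

/-! ### Polynomial bounds -/

theorem BinTree.one_le_size (x : BinTree) : 1 ≤ x.size := by
  cases x <;> simp [BinTree.size]

theorem BinTree.left_size_le (x : BinTree) : x.left.size ≤ x.size := by
  cases x <;> simp only [BinTree.size, BinTree.left] <;> omega

theorem BinTree.right_size_le (x : BinTree) : x.right.size ≤ x.size := by
  cases x <;> simp only [BinTree.size, BinTree.right] <;> omega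

/-- A program cannot write more than it is charged for. -/
theorem Prog.Runs.size_le {p : Prog} {x y : BinTree} {t : ℕ} (h : p.Runs x y t) : y.size ≤ t := by
  induction h with
  | id x => exact le_rfl
  | leaf x => exact x.one_le_size
  | left x => exact x.left_size_le
  | right x => exact x.right_size_le
  | @pair p q x y z s t _ _ h1 h2 =>
    have := x.one_le_size
    simp only [BinTree.size]; omega
  | seq => omega
  | cond_node => omega
  | cond_leaf => omega
  | loop_node => omega
  | loop_leaf => omega

theorem eval_le_eval (P : Polynomial ℕ) {a b : ℕ} (h : a ≤ b) : P.eval a ≤ P.eval b := by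
  rw [Polynomial.eval_eq_sum_range, Polynomial.eval_eq_sum_range]
  gcongr

/-- The size of the representation of `a`. -/
def encSize {α : Type} [TreeEncodable α] (a : α) : ℕ := (enc a).size

/-- `f` is bounded by a polynomial in the size of the input. -/
def PolyBounded {α : Type} [TreeEncodable α] (f : α → ℕ) : Prop :=
  ∃ P : Polynomial ℕ, ∀ a, f a ≤ P.eval (encSize a)

section

variable {α β γ : Type} [TreeEncodable α] [TreeEncodable β] [TreeEncodable γ]

theorem one_le_encSize (a : α) : 1 ≤ encSize a := BinTree.one_le_size _

theorem PolyBounded.mono {f g : α → ℕ} (hg : PolyBounded g) (h : ∀ a, f a ≤ g a) :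
    PolyBounded f :=
  let ⟨P, hP⟩ := hg
  ⟨P, fun a => (h a).trans (hP a)⟩

theorem PolyBounded.const (n : ℕ) : PolyBounded (fun _ : α => n) :=
  ⟨Polynomial.C n, fun a => by simp⟩

theorem PolyBounded.encSize : PolyBounded (encSize : α → ℕ) :=
  ⟨Polynomial.X, fun a => by simp⟩

theorem PolyBounded.add {f g : α → ℕ} (hf : PolyBounded f) (hg : PolyBounded g) :
    PolyBounded (fun a => f a + g a) :=
  let ⟨P, hP⟩ := hf
  let ⟨Q, hQ⟩ := hg
  ⟨P + Q, fun a => by rw [Polynomial.eval_add]; exact add_le_add (hP a) (hQ a)⟩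

theorem PolyBounded.mul {f g : α → ℕ} (hf : PolyBounded f) (hg : PolyBounded g) :
    PolyBounded (fun a => f a * g a) :=
  let ⟨P, hP⟩ := hf
  let ⟨Q, hQ⟩ := hg
  ⟨P * Q, fun a => by rw [Polynomial.eval_mul]; exact Nat.mul_le_mul (hP a) (hQ a)⟩

theorem PolyBounded.pow {f : α → ℕ} (hf : PolyBounded f) (k : ℕ) :
    PolyBounded (fun a => f a ^ k) :=
  let ⟨P, hP⟩ := hf
  ⟨P ^ k, fun a => by rw [Polynomial.eval_pow]; exact Nat.pow_le_pow_left (hP a) k⟩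

theorem PolyBounded.eval {f : α → ℕ} (hf : PolyBounded f) (Q : Polynomial ℕ) :
    PolyBounded (fun a => Q.eval (f a)) :=
  let ⟨P, hP⟩ := hf
  ⟨Q.comp P, fun a => by rw [Polynomial.eval_comp]; exact eval_le_eval Q (hP a)⟩

theorem PolyBounded.of_size_le {g : β → ℕ} (hg : PolyBounded g) {f : α → β}
    (hf : PolyBounded (fun a => SetCoverHardness.encSize (f a))) :
    PolyBounded (fun a => g (f a)) :=
  let ⟨Q, hQ⟩ := hg
  (hf.eval Q).mono fun a => hQ (f a)

theorem PolyTime.of_bounded {f : α → β} (p : Prog) (T : α → ℕ) (hT : PolyBounded T)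
    (h : ∀ a, ∃ t ≤ T a, p.Runs (enc a) (enc (f a)) t) : PolyTime f :=
  let ⟨P, hP⟩ := hT
  ⟨p, P, fun a => let ⟨t, ht, hr⟩ := h a; ⟨t, ht.trans (hP a), hr⟩⟩

theorem PolyTime.exists_bound {f : α → β} (h : PolyTime f) :
    ∃ (p : Prog) (T : α → ℕ), PolyBounded T ∧ ∀ a, ∃ t ≤ T a, p.Runs (enc a) (enc (f a)) t :=
  let ⟨p, P, hP⟩ := h
  ⟨p, fun a => P.eval (encSize a), ⟨P, fun _ => le_rfl⟩, hP⟩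

theorem PolyTime.size_bound {f : α → β} (h : PolyTime f) : PolyBounded (fun a => encSize (f a)) :=
  let ⟨_, P, hP⟩ := h
  ⟨P, fun a => let ⟨_, ht, hr⟩ := hP a; hr.size_le.trans ht⟩

theorem PolyBounded.comp {g : β → ℕ} (hg : PolyBounded g) {f : α → β} (hf : PolyTime f) :
    PolyBounded (fun a => g (f a)) :=
  hg.of_size_le hf.size_bound

/-! ### Basic closure properties of polynomial time -/

/-- A change of type that leaves the representation alone is free. -/
theorem PolyTime.of_enc_eq {f : α → β} (h : ∀ a, enc (f a) = enc a) : PolyTime f :=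
  .of_bounded .id encSize .encSize fun a => ⟨_, le_rfl, by rw [h]; exact .id _⟩

attribute [fun_prop] PolyTime

@[fun_prop]
theorem PolyTime.id' : PolyTime (fun a : α => a) := .of_enc_eq fun _ => rfl

theorem Prog.exists_const (c : BinTree) : ∃ p : Prog, ∃ k : ℕ, ∀ x, ∃ t ≤ k * x.size,
    p.Runs x c t := by
  induction c with
  | leaf => exact ⟨.leaf, 1, fun x => ⟨_, by simp, .leaf x⟩⟩
  | node l r hl hr =>
    obtain ⟨p, k, hp⟩ := hl
    obtain ⟨q, m, hq⟩ := hr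
    refine ⟨.pair p q, 1 + k + m, fun x => ?_⟩
    obtain ⟨s, hs, hs'⟩ := hp x
    obtain ⟨t, ht, ht'⟩ := hq x
    exact ⟨_, by linarith, .pair hs' ht'⟩

@[fun_prop]
theorem PolyTime.const (b : β) : PolyTime (fun _ : α => b) := by
  obtain ⟨p, k, hp⟩ := Prog.exists_const (enc b)
  exact .of_bounded p (fun a => k * encSize a) (.mul (.const k) .encSize) fun a => hp _

@[fun_prop]
theorem PolyTime.comp {g : β → γ} {f : α → β} (hg : PolyTime g) (hf : PolyTime f) :
    PolyTime (fun a => g (f a)) := by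
  obtain ⟨p, S, hS, hp⟩ := hf.exists_bound
  obtain ⟨q, T, hT, hq⟩ := hg.exists_bound
  refine .of_bounded (.seq p q) _ (hS.add (hT.comp hf)) fun a => ?_
  obtain ⟨s, hs, hs'⟩ := hp a
  obtain ⟨t, ht, ht'⟩ := hq (f a)
  exact ⟨_, by gcongr, .seq hs' ht'⟩

@[fun_prop]
theorem PolyTime.prodMk {f : α → β} {g : α → γ} (hf : PolyTime f) (hg : PolyTime g) :
    PolyTime (fun a => (f a, g a)) := by
  obtain ⟨p, S, hS, hp⟩ := hf.exists_bound
  obtain ⟨q, T, hT, hq⟩ := hg.exists_bound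
  refine .of_bounded (.pair p q) _ ((PolyBounded.encSize.add hS).add hT) fun a => ?_
  obtain ⟨s, hs, hs'⟩ := hp a
  obtain ⟨t, ht, ht'⟩ := hq a
  exact ⟨encSize a + s + t, by gcongr, .pair hs' ht'⟩

@[fun_prop]
theorem PolyTime.fst' : PolyTime (fun x : α × β => x.1) :=
  .of_bounded .left encSize .encSize fun _ => ⟨_, le_rfl, .left _⟩

@[fun_prop]
theorem PolyTime.snd' : PolyTime (fun x : α × β => x.2) :=
  .of_bounded .right encSize .encSize fun _ => ⟨_, le_rfl, .right _⟩

@[fun_prop]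
theorem PolyTime.fst {f : α → β × γ} (hf : PolyTime f) : PolyTime (fun a => (f a).1) :=
  PolyTime.fst'.comp hf

@[fun_prop]
theorem PolyTime.snd {f : α → β × γ} (hf : PolyTime f) : PolyTime (fun a => (f a).2) :=
  PolyTime.snd'.comp hf

@[fun_prop]
theorem PolyTime.cond {c : α → Bool} {f g : α → β} (hc : PolyTime c) (hf : PolyTime f)
    (hg : PolyTime g) : PolyTime (fun a => bif c a then f a else g a) := by
  obtain ⟨r, R, hR, hr⟩ := hc.exists_bound
  obtain ⟨p, S, hS, hp⟩ := hf.exists_bound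
  obtain ⟨q, T, hT, hq⟩ := hg.exists_bound
  refine .of_bounded (.cond r p q) _ (((PolyBounded.encSize.add hR).add hS).add hT) fun a => ?_
  obtain ⟨t, ht, ht'⟩ := hr a
  cases h : c a
  · obtain ⟨s, hs, hs'⟩ := hq a
    rw [h] at ht'
    exact ⟨encSize a + t + s, by omega, .cond_leaf ht' hs'⟩
  · obtain ⟨s, hs, hs'⟩ := hp a
    rw [h] at ht'
    exact ⟨encSize a + t + s, by omega, .cond_node ht' hs'⟩

/-- A subtype inherits the representation. This is how promises on the input are expressed. -/
instance {p : α → Prop} : TreeEncodable {a // p a} where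
  enc a := enc a.1
  enc_injective _ _ h := Subtype.ext (enc_injective h)

@[fun_prop]
theorem PolyTime.subtypeVal {p : β → Prop} {f : α → {b // p b}} (hf : PolyTime f) :
    PolyTime (fun a => (f a).1) :=
  PolyTime.comp (g := fun b : {b // p b} => b.1) (.of_enc_eq fun _ => rfl) hf

/-- Case distinction, where each branch is only required to run in polynomial time on its own
inputs. -/
theorem PolyTime.dite {c : α → Bool} (hc : PolyTime c) {f : α → β} {g h : α → β}
    (hf : PolyTime (fun a : {a // c a = true} => f a.1))
    (hg : PolyTime (fun a : {a // c a = false} => g a.1))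
    (h1 : ∀ a, c a = true → h a = f a) (h2 : ∀ a, c a = false → h a = g a) : PolyTime h := by
  obtain ⟨r, R, hr⟩ := hc
  obtain ⟨p, S, hp⟩ := hf
  obtain ⟨q, T, hq⟩ := hg
  refine ⟨.cond r p q, Polynomial.X + R + S + T, fun a => ?_⟩
  simp only [Polynomial.eval_add, Polynomial.eval_X]
  obtain ⟨t, ht, ht'⟩ := hr a
  cases hca : c a
  · obtain ⟨s, hs, hs'⟩ := hq ⟨a, hca⟩
    rw [hca] at ht'
    rw [h2 a hca]
    exact ⟨_, add_le_add (le_trans (add_le_add le_rfl ht) (Nat.le_add_right _ _)) hs,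
      .cond_leaf ht' hs'⟩
  · obtain ⟨s, hs, hs'⟩ := hp ⟨a, hca⟩
    rw [hca] at ht'
    rw [h1 a hca]
    exact ⟨_, le_trans (add_le_add (add_le_add le_rfl ht) hs) (Nat.le_add_right _ _),
      .cond_node ht' hs'⟩

/-! ### Recursion along a list -/

theorem enc_nil : enc ([] : List α) = .leaf := rfl

theorem enc_cons (a : α) (l : List α) : enc (a :: l) = .node (enc a) (enc l) := rfl

theorem encSize_prod (a : α) (b : β) : encSize (a, b) = encSize a + encSize b + 1 := rfl

theorem encSize_nil : encSize ([] : List α) = 1 := rfl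

theorem encSize_cons (a : α) (l : List α) : encSize (a :: l) = encSize a + encSize l + 1 := rfl

theorem encSize_append (l m : List α) : encSize (l ++ m) + 1 = encSize l + encSize m := by
  induction l with
  | nil => simp [encSize_nil]; omega
  | cons a l ih => simp only [List.cons_append, encSize_cons]; omega

theorem encSize_le_of_mem {a : α} {l : List α} (h : a ∈ l) : encSize a ≤ encSize l := by
  induction l with
  | nil => simp at h
  | cons b l ih =>
    simp only [encSize_cons]
    rcases List.mem_cons.1 h with rfl | h
    · omega
    · have := ih h; omega

theorem length_lt_encSize (l : List α) : l.length < encSize l := by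
  induction l with
  | nil => simp [encSize_nil]
  | cons b l ih => simp only [encSize_cons, List.length_cons]; omega

theorem PolyBounded.length : PolyBounded (fun l : List α => l.length) :=
  PolyBounded.encSize.mono fun l => (length_lt_encSize l).le

@[fun_prop]
theorem PolyTime.tail {f : α → List β} (hf : PolyTime f) : PolyTime (fun a => (f a).tail) :=
  PolyTime.comp (g := fun l : List β => l.tail)
    (.of_bounded .right encSize .encSize fun l => ⟨_, le_rfl, by cases l <;> exact .right _⟩) hf

theorem PolyTime.head : PolyTime (fun l : {l : List α // l ≠ []} => l.1.head l.2) :=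
  .of_bounded .left encSize .encSize fun l => ⟨_, le_rfl, by
    obtain ⟨_ | ⟨a, l⟩, h⟩ := l
    · exact absurd rfl h
    · exact .left _⟩

@[fun_prop]
theorem PolyTime.cons {f : α → β} {g : α → List β} (hf : PolyTime f) (hg : PolyTime g) :
    PolyTime (fun a => f a :: g a) :=
  PolyTime.comp (g := fun x : β × List β => x.1 :: x.2) (.of_enc_eq fun _ => rfl) (hf.prodMk hg)

/-- The loop behind `PolyTime.foldl`: the state consists of the input, the rest of the list and the
accumulated value, and `p` processes the first element of the list. -/
theorem Prog.loop_foldl {σ : Type} [TreeEncodable σ] {p : Prog} {a : α} {step : σ → β → σ}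
    {K : ℕ} (l : List β) (s : σ)
    (hp : ∀ pre b suf, l = pre ++ b :: suf → ∃ t ≤ K,
      p.Runs (enc (a, b :: suf, pre.foldl step s)) (enc (a, suf, step (pre.foldl step s) b)) t)
    (hK : ∀ pre suf, l = pre ++ suf → encSize (a, suf, pre.foldl step s) ≤ K) :
    ∃ t ≤ (l.length + 1) * (4 * K),
      (Prog.loop (.seq .right .left) p).Runs (enc (a, l, s))
        (enc (a, ([] : List β), l.foldl step s)) t := by
  have hc : ∀ (l : List β) (s : σ), encSize (a, l, s) ≤ K → ∃ t ≤ 2 * K,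
      (Prog.seq .right .left).Runs (enc (a, l, s)) (enc l) t := by
    intro l s h
    refine ⟨_, ?_, .seq (.right _) (.left _)⟩
    have := (enc (a, l, s)).right_size_le
    simp only [encSize] at h
    omega
  induction l generalizing s with
  | nil =>
    have h0 := hK [] [] rfl
    obtain ⟨t, ht, hr⟩ := hc [] s h0
    refine ⟨_, ?_, .loop_leaf hr⟩
    simp only [encSize, List.foldl_nil, List.length_nil] at h0 ⊢
    omega
  | cons b l ih =>
    have h0 := hK [] (b :: l) rfl
    obtain ⟨t1, ht1, hr1⟩ := hc (b :: l) s h0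
    obtain ⟨t2, ht2, hr2⟩ := hp [] b l rfl
    obtain ⟨t3, ht3, hr3⟩ := ih (step s b)
      (fun pre b' suf h => hp (b :: pre) b' suf (by rw [h]; rfl))
      (fun pre suf h => hK (b :: pre) suf (by rw [h]; rfl))
    refine ⟨_, ?_, .loop_node hr1 hr2 hr3⟩
    simp only [encSize, List.foldl_nil, List.length_cons] at h0 ⊢
    have : (l.length + 1 + 1) * (4 * K) = (l.length + 1) * (4 * K) + 4 * K := by ring
    omega

/-- Recursion along a list runs in polynomial time as long as the size of the accumulated value
stays polynomially bounded. -/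
theorem PolyTime.foldl {σ : Type} [TreeEncodable σ] {l : α → List β} {init : α → σ}
    {step : α → σ → β → σ} {B : α → ℕ} (hl : PolyTime l) (hi : PolyTime init)
    (hs : PolyTime (fun y : α × σ × β => step y.1 y.2.1 y.2.2)) (hB : PolyBounded B)
    (hb : ∀ a pre suf, l a = pre ++ suf → encSize (pre.foldl (step a) (init a)) ≤ B a) :
    PolyTime (fun a => (l a).foldl (step a) (init a)) := by
  have hbody : PolyTime (fun y : {y : α × List β × σ // y.2.1 ≠ []} =>
      (y.1.1, y.1.2.1.tail, step y.1.1 y.1.2.2 (y.1.2.1.head y.2))) := by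
    refine .prodMk (by fun_prop) (.prodMk (by fun_prop) ?_)
    refine hs.comp (f := fun y : {y : α × List β × σ // y.2.1 ≠ []} =>
      (y.1.1, y.1.2.2, y.1.2.1.head y.2)) (.prodMk (by fun_prop) (.prodMk (by fun_prop) ?_))
    refine PolyTime.head.comp (f := fun y : {y : α × List β × σ // y.2.1 ≠ []} =>
      (⟨y.1.2.1, y.2⟩ : {l : List β // l ≠ []})) ?_
    obtain ⟨p, P, hp⟩ := (show PolyTime (fun y : {y : α × List β × σ // y.2.1 ≠ []} => y.1.2.1) by
      fun_prop)
    exact ⟨p, P, hp⟩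
  obtain ⟨p, P, hp⟩ := hbody
  have hsz : PolyBounded (fun a => encSize a + (encSize (l a) + B a + 1) + 1) :=
    (PolyBounded.encSize.add ((hl.size_bound.add hB).add (.const 1))).add (.const 1)
  generalize hS : (fun a => encSize a + (encSize (l a) + B a + 1) + 1) = S at hsz
  have hK : PolyBounded (fun a => P.eval (S a) + S a) := (hsz.eval P).add hsz
  have hstate : ∀ a pre suf, l a = pre ++ suf →
      encSize (a, suf, pre.foldl (step a) (init a)) ≤ S a := by
    intro a pre suf h
    have h1 := hb a pre suf h
    have h2 := encSize_append pre suf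
    have h3 := one_le_encSize pre
    rw [← h] at h2
    simp only [encSize_prod, ← hS]
    omega
  obtain ⟨q, T, hT, hq⟩ := (show PolyTime (fun a => (a, l a, init a)) by fun_prop).exists_bound
  refine .of_bounded (.seq q (.seq (.loop (.seq .right .left) p) (.seq .right .right)))
    (fun a => T a + (((l a).length + 1) * (4 * (P.eval (S a) + S a)) + (S a + S a)))
    (hT.add ((((PolyBounded.length.comp hl).add (.const 1)).mul ((PolyBounded.const 4).mul hK)).add
      (hsz.add hsz))) fun a => ?_
  obtain ⟨t1, ht1, hr1⟩ := hq a
  obtain ⟨t2, ht2, hr2⟩ := Prog.loop_foldl (a := a) (p := p) (step := step a)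
    (K := P.eval (S a) + S a) (l a) (init a) (fun pre b suf h => by
      obtain ⟨t, ht, hr⟩ := hp ⟨(a, b :: suf, pre.foldl (step a) (init a)), by simp⟩
      exact ⟨t, ht.trans ((eval_le_eval P (hstate a pre (b :: suf) h)).trans
        (Nat.le_add_right _ _)), hr⟩)
    (fun pre suf h => (hstate a pre suf h).trans (Nat.le_add_left _ _))
  refine ⟨_, ?_, .seq hr1 (.seq hr2 (.seq (.right _) (.right _)))⟩
  have h0 := hstate a (l a) [] (by simp)
  have h1 := (enc (a, ([] : List β), (l a).foldl (step a) (init a))).right_size_le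
  simp only [encSize] at h0
  omega

theorem encSize_flatMap_le {ι : Type} (l : List ι) (g : ι → List γ) {K : ℕ}
    (h : ∀ b ∈ l, encSize (g b) ≤ K) : encSize (l.flatMap g) ≤ l.length * K + 1 := by
  induction l with
  | nil => simp [encSize_nil]
  | cons b l ih =>
    have h1 := ih fun b' hb' => h b' (List.mem_cons_of_mem _ hb')
    have h2 := h b List.mem_cons_self
    have h3 := encSize_append (g b) (l.flatMap g)
    simp only [List.flatMap_cons, List.length_cons]
    have : (l.length + 1) * K = l.length * K + K := by ring
    omega

theorem PolyTime.reverse' : PolyTime (fun l : List α => l.reverse) := by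
  have : PolyTime (fun l : List α => l.foldl (fun s b => b :: s) []) := by
    refine .foldl (B := encSize) (by fun_prop) (by fun_prop) (by fun_prop) .encSize ?_
    intro l pre suf h
    have h1 : encSize (pre.foldl (fun s b => b :: s) []) = encSize pre := by
      have : ∀ s : List α, encSize (pre.foldl (fun s b => b :: s) s) + 1 =
          encSize pre + encSize s := by
        clear h
        induction pre with
        | nil => intro s; simp [encSize_nil]; omega
        | cons a pre ih => intro s; simp only [List.foldl_cons, ih, encSize_cons]; omega
      have := this []
      simp only [encSize_nil] at this
      omega
    have h2 := encSize_append pre suf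
    have := one_le_encSize suf
    rw [h1, h]
    omega
  simpa using this

@[fun_prop]
theorem PolyTime.reverse {f : α → List β} (hf : PolyTime f) : PolyTime (fun a => (f a).reverse) :=
  PolyTime.reverse'.comp hf

@[fun_prop]
theorem PolyTime.append {f g : α → List β} (hf : PolyTime f) (hg : PolyTime g) :
    PolyTime (fun a => f a ++ g a) := by
  have : PolyTime (fun a => (f a).reverse.foldl (fun s b => b :: s) (g a)) := by
    refine .foldl (B := fun a => encSize (f a).reverse + encSize (g a)) (by fun_prop) hg
      (by fun_prop) ((hf.reverse.size_bound).add hg.size_bound) ?_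
    intro a pre suf h
    have h1 : pre.foldl (fun s b => b :: s) (g a) = pre.reverse ++ g a := by simp
    have h2 := encSize_append pre suf
    have h3 := encSize_append pre.reverse (g a)
    have h4 : ∀ l : List β, encSize l.reverse = encSize l := by
      intro l
      induction l with
      | nil => rfl
      | cons b l ih =>
        have := encSize_append l.reverse [b]
        simp only [List.reverse_cons, encSize_cons, encSize_nil] at this ⊢
        omega
    have := one_le_encSize suf
    rw [h1, h]
    rw [h4] at h3
    omega
  simpa using this

/-- The list comprehension `[c | b ∈ l a, c ∈ g a b]`. -/
theorem PolyTime.flatMap {l : α → List β} {g : α → β → List γ} (hl : PolyTime l)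
    (hg : PolyTime (fun y : α × β => g y.1 y.2)) : PolyTime (fun a => (l a).flatMap (g a)) := by
  obtain ⟨P, hP⟩ := hg.size_bound
  have hfold : ∀ (f : β → List γ) (l : List β) (s : List γ),
      l.foldl (fun s b => s ++ f b) s = s ++ l.flatMap f := by
    intro f l
    induction l with
    | nil => simp
    | cons b l ih => intro s; simp [ih, List.append_assoc]
  have : PolyTime (fun a => (l a).foldl (fun s b => s ++ g a b) []) := by
    refine .foldl (B := fun a => (l a).length * P.eval (encSize a + encSize (l a) + 1) + 1) hl
      (by fun_prop) (step := fun a s b => s ++ g a b) ?_ ?_ ?_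
    · exact .append (by fun_prop) (hg.comp (f := fun y : α × List γ × β => (y.1, y.2.2))
        (by fun_prop))
    · exact ((PolyBounded.length.comp hl).mul (((PolyBounded.encSize.add hl.size_bound).add
        (.const 1)).eval P)).add (.const 1)
    · intro a pre suf h
      rw [hfold, List.nil_append]
      refine (encSize_flatMap_le pre (g a) (K := P.eval (encSize a + encSize (l a) + 1))
        fun b hb => (hP (a, b)).trans (eval_le_eval P ?_)).trans ?_
      · have := encSize_le_of_mem (show b ∈ l a by rw [h]; simp [hb])
        simp only [encSize_prod]
        omega
      · gcongr
        rw [h]; simp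
  simpa [hfold] using this

theorem PolyTime.map {l : α → List β} {g : α → β → γ} (hl : PolyTime l)
    (hg : PolyTime (fun y : α × β => g y.1 y.2)) : PolyTime (fun a => (l a).map (g a)) := by
  have : PolyTime (fun a => (l a).flatMap fun b => [g a b]) :=
    .flatMap hl (.cons hg (by fun_prop))
  simpa only [List.map_eq_flatMap] using this

theorem PolyTime.filter {l : α → List β} {g : α → β → Bool} (hl : PolyTime l)
    (hg : PolyTime (fun y : α × β => g y.1 y.2)) : PolyTime (fun a => (l a).filter (g a)) := by
  have : PolyTime (fun a => (l a).flatMap fun b => bif g a b then [b] else []) :=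
    .flatMap hl (.cond hg (by fun_prop) (by fun_prop))
  convert this using 2 with a
  induction l a with
  | nil => rfl
  | cons b l ih => cases h : g a b <;> simp [h, ih]

/-! ### Numbers and Booleans -/

instance : TreeEncodable Unit where
  enc _ := .leaf
  enc_injective _ _ _ := rfl

theorem enc_replicate_unit (n : ℕ) : enc (List.replicate n ()) = enc n := by
  induction n with
  | zero => rfl
  | succ n ih => rw [List.replicate_succ, enc_cons, ih]; rfl

theorem encSize_nat (n : ℕ) : encSize n = 2 * n + 1 := by
  induction n with
  | zero => rfl
  | succ n ih =>
    have : encSize (n + 1) = 1 + encSize n + 1 := rfl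
    omega

theorem PolyBounded.nat {f : α → ℕ} (hf : PolyTime f) : PolyBounded f :=
  hf.size_bound.mono fun a => by rw [encSize_nat]; omega

@[fun_prop]
theorem PolyTime.replicate_unit {f : α → ℕ} (hf : PolyTime f) :
    PolyTime (fun a => List.replicate (f a) ()) :=
  PolyTime.comp (g := fun n => List.replicate n ()) (.of_enc_eq enc_replicate_unit) hf

@[fun_prop]
theorem PolyTime.length {f : α → List β} (hf : PolyTime f) : PolyTime (fun a => (f a).length) := by
  have h1 : PolyTime (fun l : {l : List Unit // True} => l.1.length) :=
    .of_enc_eq fun l => by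
      rw [← enc_replicate_unit]
      exact congrArg enc (List.eq_replicate_iff.2 ⟨rfl, fun _ _ => rfl⟩).symm
  have h2 : PolyTime (fun a => (f a).map fun _ => ()) := .map hf (by fun_prop)
  obtain ⟨p, P, hp⟩ := h2
  have h3 := h1.comp (f := fun a => ⟨(f a).map fun _ => (), trivial⟩) ⟨p, P, hp⟩
  simpa using h3

/-- Iteration runs in polynomial time as long as the size of the values stays polynomially
bounded. -/
theorem PolyTime.iterate {n : α → ℕ} {init : α → β} {step : α → β → β} {B : α → ℕ}
    (hn : PolyTime n) (hi : PolyTime init) (hs : PolyTime (fun y : α × β => step y.1 y.2))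
    (hB : PolyBounded B) (hb : ∀ a, ∀ k ≤ n a, encSize ((step a)^[k] (init a)) ≤ B a) :
    PolyTime (fun a => (step a)^[n a] (init a)) := by
  have hfold : ∀ (f : β → β) (l : List Unit) (s : β), l.foldl (fun s _ => f s) s =
      f^[l.length] s := by
    intro f l
    induction l with
    | nil => intro s; rfl
    | cons b l ih => intro s; simp [ih]
  have : PolyTime (fun a => (List.replicate (n a) ()).foldl (fun s _ => step a s) (init a)) := by
    refine .foldl (by fun_prop) hi (step := fun a s _ => step a s) ?_ hB ?_
    · exact hs.comp (f := fun y : α × β × Unit => (y.1, y.2.1)) (by fun_prop)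
    · intro a pre suf h
      rw [hfold]
      refine hb a _ ?_
      have := congrArg List.length h
      simp at this
      omega
  simpa [hfold] using this

@[fun_prop]
theorem PolyTime.add {f g : α → ℕ} (hf : PolyTime f) (hg : PolyTime g) :
    PolyTime (fun a => f a + g a) := by
  have : PolyTime (fun a => (List.replicate (f a) () ++ List.replicate (g a) ()).length) := by
    fun_prop
  simpa using this

@[fun_prop]
theorem PolyTime.mul {f g : α → ℕ} (hf : PolyTime f) (hg : PolyTime g) :
    PolyTime (fun a => f a * g a) := by
  have : PolyTime (fun a => ((List.replicate (f a) ()).flatMap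
      fun _ => List.replicate (g a) ()).length) :=
    .length (.flatMap (by fun_prop) (by fun_prop))
  simpa [List.length_flatMap] using this

@[fun_prop]
theorem PolyTime.drop {n : α → ℕ} {f : α → List β} (hn : PolyTime n) (hf : PolyTime f) :
    PolyTime (fun a => (f a).drop (n a)) := by
  have h1 : ∀ k (l : List β), List.tail^[k] l = l.drop k := by
    intro k
    induction k with
    | zero => simp
    | succ k ih => intro l; rw [Function.iterate_succ_apply', ih, List.tail_drop]
  have : PolyTime (fun a => (fun l : List β => l.tail)^[n a] (f a)) := by
    refine .iterate hn hf (by fun_prop) hf.size_bound fun a k _ => ?_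
    have h2 := encSize_append ((f a).take k) ((f a).drop k)
    have h3 := one_le_encSize ((f a).take k)
    rw [List.take_append_drop] at h2
    rw [h1]
    omega
  simpa [h1] using this

@[fun_prop]
theorem PolyTime.sub {f g : α → ℕ} (hf : PolyTime f) (hg : PolyTime g) :
    PolyTime (fun a => f a - g a) := by
  have : PolyTime (fun a => ((List.replicate (f a) ()).drop (g a)).length) := by fun_prop
  simpa using this

/-- Only the empty list is represented by a leaf. -/
@[fun_prop]
theorem PolyTime.isEmpty {f : α → List β} (hf : PolyTime f) :
    PolyTime (fun a => (f a).isEmpty) := by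
  refine PolyTime.comp (g := fun l : List β => l.isEmpty) ?_ hf
  refine .of_bounded (.cond .id .leaf (.pair .leaf .leaf)) (fun a => 5 * encSize a)
    (.mul (.const 5) .encSize) fun l => ?_
  cases l with
  | nil =>
    exact ⟨_, by simp [encSize_nil, enc_nil, BinTree.size],
      .cond_leaf (.id _) (.pair (.leaf _) (.leaf _))⟩
  | cons b l =>
    refine ⟨_, ?_, .cond_node (.id _) (.leaf _)⟩
    simp only [encSize]
    omega

@[fun_prop]
theorem PolyTime.not {f : α → Bool} (hf : PolyTime f) : PolyTime (fun a => !(f a)) := by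
  have : PolyTime (fun a => bif f a then false else true) := by fun_prop
  convert this using 2 with a
  cases f a <;> rfl

@[fun_prop]
theorem PolyTime.and {f g : α → Bool} (hf : PolyTime f) (hg : PolyTime g) :
    PolyTime (fun a => f a && g a) := by
  have : PolyTime (fun a => bif f a then g a else false) := by fun_prop
  convert this using 2 with a
  cases f a <;> rfl

@[fun_prop]
theorem PolyTime.decide_le {f g : α → ℕ} (hf : PolyTime f) (hg : PolyTime g) :
    PolyTime (fun a => decide (f a ≤ g a)) := by
  have : PolyTime (fun a => (List.replicate (f a - g a) ()).isEmpty) := by fun_prop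
  convert this using 2 with a
  by_cases h : f a ≤ g a <;> simp [h, Nat.sub_eq_zero_iff_le]

@[fun_prop]
theorem PolyTime.decide_lt {f g : α → ℕ} (hf : PolyTime f) (hg : PolyTime g) :
    PolyTime (fun a => decide (f a < g a)) :=
  PolyTime.decide_le (f := fun a => f a + 1) (by fun_prop) hg

@[fun_prop]
theorem PolyTime.decide_eq {f g : α → ℕ} (hf : PolyTime f) (hg : PolyTime g) :
    PolyTime (fun a => decide (f a = g a)) := by
  have : PolyTime (fun a => decide (f a ≤ g a) && decide (g a ≤ f a)) := by fun_prop
  convert this using 2 with a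
  rw [← Bool.decide_and]
  exact decide_eq_decide.2 le_antisymm_iff

@[fun_prop]
theorem PolyTime.range {f : α → ℕ} (hf : PolyTime f) : PolyTime (fun a => List.range (f a)) := by
  have h1 : ∀ k, (fun l : List ℕ => l ++ [l.length])^[k] [] = List.range k := by
    intro k
    induction k with
    | zero => rfl
    | succ k ih => rw [Function.iterate_succ_apply', ih, List.range_succ, List.length_range]
  have : PolyTime (fun a => (fun l : List ℕ => l ++ [l.length])^[f a] []) := by
    refine .iterate hf (by fun_prop) (by fun_prop) (B := fun a => f a * (2 * f a + 3) + 1)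
      (((PolyBounded.nat hf).mul (((PolyBounded.const 2).mul (PolyBounded.nat hf)).add
        (.const 3))).add (.const 1)) fun a k hk => ?_
    rw [h1]
    have h2 := encSize_flatMap_le (List.range k) (fun i => [i]) (K := 2 * f a + 3) fun b hb => by
      have := List.mem_range.1 hb
      simp only [encSize_cons, encSize_nil, encSize_nat]
      omega
    rw [List.flatMap_singleton', List.length_range] at h2
    exact h2.trans (by gcongr)
  simpa [h1] using this

/-- Powers are computed in polynomial time if their value, which is written in unary, is
polynomially bounded. -/
theorem PolyTime.pow {f g : α → ℕ} (hf : PolyTime f) (hg : PolyTime g) {B : α → ℕ}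
    (hB : PolyBounded B) (hb : ∀ a, ∀ k ≤ g a, f a ^ k ≤ B a) : PolyTime (fun a => f a ^ g a) := by
  have h1 : ∀ a k, (fun m => m * f a)^[k] 1 = f a ^ k := by
    intro a k
    induction k with
    | zero => simp
    | succ k ih => rw [Function.iterate_succ_apply', ih, pow_succ]
  have : PolyTime (fun a => (fun m => m * f a)^[g a] 1) := by
    refine .iterate hg (by fun_prop) (step := fun a m => m * f a) ?_
      (((PolyBounded.const 2).mul hB).add (.const 1)) fun a k hk => ?_
    · exact .mul (by fun_prop) (hf.comp (by fun_prop))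
    · have := hb a k hk
      rw [h1, encSize_nat]
      omega
  simpa [h1] using this

theorem length_filter_range_lt {m n : ℕ} (h : m ≤ n) :
    ((List.range n).filter fun i => decide (i < m)).length = m := by
  induction n generalizing m with
  | zero => simp; omega
  | succ n ih =>
    rw [List.range_succ, List.filter_append, List.length_append]
    rcases Nat.lt_or_ge n m with h1 | h1
    · have h2 := ih (le_refl n)
      have h3 : ((List.range n).filter fun i => decide (i < m)) = List.range n := by
        rw [List.filter_eq_self]
        intro i hi
        have := List.mem_range.1 hi
        simp; omega
      simp only [h3, List.length_range]
      simp [h1]; omega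
    · rw [ih h1]
      simp [h1]

@[fun_prop]
theorem PolyTime.div {f g : α → ℕ} (hf : PolyTime f) (hg : PolyTime g) :
    PolyTime (fun a => f a / g a) := by
  have : PolyTime (fun a => ((List.range (f a)).filter
      fun i => decide (0 < g a) && decide ((i + 1) * g a ≤ f a)).length) :=
    .length (.filter (by fun_prop) (by fun_prop))
  convert this using 2 with a
  rw [← length_filter_range_lt (Nat.div_le_self (f a) (g a))]
  congr 2
  ext i
  rcases Nat.eq_zero_or_pos (g a) with h | h
  · simp [h]
  · rw [← Bool.decide_and, decide_eq_decide, ← Nat.succ_le_iff, Nat.le_div_iff_mul_le h]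
    exact ⟨fun h' => ⟨h, h'⟩, fun h' => h'.2⟩

@[fun_prop]
theorem PolyTime.pow_const {f : α → ℕ} (hf : PolyTime f) (k : ℕ) :
    PolyTime (fun a => f a ^ k) := by
  induction k with
  | zero => simpa using PolyTime.const (α := α) 1
  | succ k ih => simpa only [pow_succ] using ih.mul hf

@[fun_prop]
theorem PolyTime.headD {f : α → List β} (hf : PolyTime f) (b : β) :
    PolyTime (fun a => (f a).headD b) := by
  refine PolyTime.comp (g := fun l : List β => l.headD b) ?_ hf
  obtain ⟨p, P, hp⟩ := PolyTime.head (α := β)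
  refine .dite (c := fun l : List β => l.isEmpty) (by fun_prop) (f := fun _ => b) (by fun_prop)
    (g := fun l => l.headD b) ?_ ?_ ?_
  · refine ⟨p, P, fun l => ?_⟩
    obtain ⟨_ | ⟨c, l⟩, h⟩ := l
    · simp at h
    · exact hp ⟨c :: l, by simp⟩
  · intro a h; rw [List.isEmpty_iff.1 h]; rfl
  · intros; rfl

@[fun_prop]
theorem PolyTime.getD {f : α → List β} {i : α → ℕ} (hf : PolyTime f) (hi : PolyTime i) (b : β) :
    PolyTime (fun a => (f a).getD (i a) b) := by
  have : PolyTime (fun a => ((f a).drop (i a)).headD b) := by fun_prop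
  convert this using 2 with a
  rw [List.headD_eq_head?_getD, List.head?_drop, List.getD_eq_getElem?_getD]

theorem PolyTime.all {l : α → List β} {g : α → β → Bool} (hl : PolyTime l)
    (hg : PolyTime (fun y : α × β => g y.1 y.2)) : PolyTime (fun a => (l a).all (g a)) := by
  have : PolyTime (fun a => ((l a).filter fun b => !(g a b)).isEmpty) :=
    .isEmpty (.filter hl (by fun_prop))
  convert this using 2 with a
  induction l a with
  | nil => rfl
  | cons b l ih => cases h : g a b <;> simp [h, ih]

@[fun_prop]
theorem PolyTime.sum {f : α → List ℕ} (hf : PolyTime f) : PolyTime (fun a => (f a).sum) := by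
  have : PolyTime (fun a => ((f a).flatMap fun n => List.replicate n ()).length) :=
    .length (.flatMap hf (by fun_prop))
  simpa [List.length_flatMap] using this

end


/-! ### Families of words that avoid sparse constraints -/

/-- A word `e` avoids a constraint `c` if they differ at every position of `e`. Words have entries
below `D`; in a constraint the entry `D` stands for the absence of a condition. -/
def avoids (e c : List ℕ) : Bool :=
  (List.range e.length).all fun v => !(decide (e.getD v 0 = c.getD v 0))

/-- The number of positions at which a constraint forbids a letter. -/
def support (D : ℕ) (c : List ℕ) : ℕ := (c.filter fun a => decide (a < D)).length

/-- `c` is a constraint on words of length `s` with at most `t` conditions. -/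
structure IsConstraint (D s t : ℕ) (c : List ℕ) : Prop where
  length_eq : c.length = s
  le : ∀ a ∈ c, a ≤ D
  support_le : support D c ≤ t

/-- `L` consists of words of length `s` over the letters `0, …, D - 1`, and every constraint with
at most `t` conditions is avoided by one of them. -/
structure IsHitting (D s t : ℕ) (L : List (List ℕ)) : Prop where
  length_eq : ∀ e ∈ L, e.length = s
  lt : ∀ e ∈ L, ∀ a ∈ e, a < D
  exists_avoids : ∀ c, IsConstraint D s t c → ∃ e ∈ L, avoids e c = true

theorem avoids_iff {e c : List ℕ} :
    avoids e c = true ↔ ∀ v < e.length, e.getD v 0 ≠ c.getD v 0 := by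
  simp [avoids]

theorem avoids_append_singleton (e c : List ℕ) (d : ℕ) :
    avoids (e ++ [d]) c = (avoids e c && !(decide (d = c.getD e.length 0))) := by
  rw [Bool.eq_iff_iff, Bool.and_eq_true, avoids_iff, avoids_iff]
  simp only [List.length_append, List.length_singleton, Bool.not_eq_true', decide_eq_false_iff_not]
  constructor
  · intro h
    refine ⟨fun v hv => ?_, ?_⟩
    · have := h v (by omega)
      rwa [List.getD_append _ _ _ _ hv] at this
    · have := h e.length (by omega)
      rwa [List.getD_append_right _ _ _ _ le_rfl, Nat.sub_self] at this
  · rintro ⟨h1, h2⟩ v hv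
    rcases Nat.lt_or_ge v e.length with h | h
    · rw [List.getD_append _ _ _ _ h]; exact h1 v h
    · obtain rfl : v = e.length := by omega
      rw [List.getD_append_right _ _ _ _ le_rfl, Nat.sub_self]; exact h2

theorem support_cons (D a : ℕ) (c : List ℕ) :
    support D (a :: c) = support D c + if a < D then 1 else 0 := by
  unfold support
  by_cases h : a < D <;> simp [h]

theorem support_append (D : ℕ) (c c' : List ℕ) :
    support D (c ++ c') = support D c + support D c' := by
  simp [support]

theorem support_replicate (D n : ℕ) : support D (List.replicate n D) = 0 := by
  induction n with
  | zero => rfl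
  | succ n ih => rw [List.replicate_succ, support_cons, ih]; simp

/-! ### The list of all sparse constraints -/

/-- All ways to impose one more condition (or none, by means of the position `v = s`). -/
def addCondition (D s : ℕ) (C : List (List ℕ)) : List (List ℕ) :=
  C.flatMap fun c => (List.range (s + 1)).flatMap fun v => (List.range D).map fun d => c.set v d

/-- A list of all constraints with at most `t` conditions. -/
def constraints (D s t : ℕ) : List (List ℕ) := (addCondition D s)^[t] [List.replicate s D]

theorem length_addCondition (D s : ℕ) (C : List (List ℕ)) :
    (addCondition D s C).length = C.length * ((s + 1) * D) := by
  simp [addCondition, List.length_flatMap]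

theorem length_constraints (D s t : ℕ) : (constraints D s t).length = ((s + 1) * D) ^ t := by
  induction t with
  | zero => simp [constraints]
  | succ t ih =>
    rw [constraints, Function.iterate_succ_apply', length_addCondition, ← constraints, ih, pow_succ]

theorem support_set_le (D : ℕ) (c : List ℕ) (v d : ℕ) :
    support D (c.set v d) ≤ support D c + 1 := by
  induction c generalizing v with
  | nil => simp
  | cons a c ih =>
    cases v with
    | zero =>
      simp only [List.set_cons_zero, support_cons]
      split_ifs <;> omega
    | succ v =>
      simp only [List.set_cons_succ, support_cons]
      have := ih v
      omega

theorem isConstraint_of_mem_constraints {D s t : ℕ} {c : List ℕ} (h : c ∈ constraints D s t) :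
    IsConstraint D s t c := by
  induction t generalizing c with
  | zero =>
    simp only [constraints, Function.iterate_zero, id_eq, List.mem_singleton] at h
    subst h
    exact ⟨by simp, fun a ha => (List.eq_of_mem_replicate ha).le, (support_replicate D s).le⟩
  | succ t ih =>
    rw [constraints, Function.iterate_succ_apply', ← constraints] at h
    simp only [addCondition, List.mem_flatMap, List.mem_map, List.mem_range] at h
    obtain ⟨c', hc', v, _, d, hd, rfl⟩ := h
    obtain ⟨h1, h2, h3⟩ := ih hc'
    refine ⟨by simpa using h1, fun a ha => ?_, (support_set_le D c' v d).trans (by omega)⟩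
    rcases List.mem_or_eq_of_mem_set ha with h | rfl
    · exact h2 a h
    · omega

theorem exists_set_of_support_pos {D : ℕ} {c : List ℕ} (h : 0 < support D c) :
    ∃ v < c.length, ∃ d < D, support D (c.set v D) + 1 = support D c ∧ (c.set v D).set v d = c := by
  induction c with
  | nil => simp [support] at h
  | cons a c ih =>
    rw [support_cons] at h
    by_cases ha : a < D
    · exact ⟨0, by simp, a, ha, by simp [support_cons, ha], by simp⟩
    · rw [if_neg ha] at h
      obtain ⟨v, hv, d, hd, h1, h2⟩ := ih h
      refine ⟨v + 1, by simpa using hv, d, hd, ?_, by simpa using h2⟩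
      simp only [List.set_cons_succ, support_cons]
      omega

theorem mem_constraints {D s t : ℕ} (hD : 0 < D) {c : List ℕ} (h : IsConstraint D s t c) :
    c ∈ constraints D s t := by
  induction t generalizing c with
  | zero =>
    simp only [constraints, Function.iterate_zero, id_eq, List.mem_singleton]
    refine List.eq_replicate_iff.2 ⟨h.length_eq, fun a ha => ?_⟩
    have h1 := h.support_le
    have h2 := h.le a ha
    simp only [support, Nat.le_zero, List.length_eq_zero_iff, List.filter_eq_nil_iff] at h1
    have := h1 a ha
    simp only [decide_eq_true_eq, not_lt] at this
    omega
  | succ t ih =>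
    rw [constraints, Function.iterate_succ_apply', ← constraints]
    simp only [addCondition, List.mem_flatMap, List.mem_map, List.mem_range]
    rcases Nat.eq_zero_or_pos (support D c) with h0 | h0
    · refine ⟨c, ih ⟨h.length_eq, h.le, by omega⟩, s, by omega, 0, hD, ?_⟩
      exact List.set_eq_of_length_le h.length_eq.le
    · obtain ⟨v, hv, d, hd, h1, h2⟩ := exists_set_of_support_pos h0
      have h3 := h.support_le
      have h4 := h.length_eq
      refine ⟨c.set v D, ih ⟨by simpa using h.length_eq, fun a ha => ?_, by omega⟩, v, by omega,
        d, hd, h2⟩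
      rcases List.mem_or_eq_of_mem_set ha with h | rfl
      · exact IsConstraint.le ‹_› a h
      · exact le_rfl

/-! ### Conditional expectations -/

/-- Up to the factor `D ^ t`, the probability that a word with uniformly random letters avoids the
conditions of `c`, provided that there are at most `t` of them. -/
def weight (D t : ℕ) (c : List ℕ) : ℕ :=
  (D - 1) ^ (t - (t - support D c)) * D ^ (t - support D c)

/-- Up to the factor `D ^ t`, the probability that a random continuation of `e` avoids `c`. -/
def gain (D t : ℕ) (e c : List ℕ) : ℕ :=
  bif avoids e c then weight D t (c.drop e.length) else 0

/-- Up to the factor `D ^ t`, the expected number of constraints in `C` that are avoided by a random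
continuation of `e`. -/
def score (D t : ℕ) (C : List (List ℕ)) (e : List ℕ) : ℕ := (C.map (gain D t e)).sum

/-- A letter `d < D` that maximizes the score of `e ++ [d]`. -/
def bestLetter (D t : ℕ) (C : List (List ℕ)) (e : List ℕ) : ℕ :=
  (List.range D).foldl
    (fun b d => bif decide (score D t C (e ++ [b]) < score D t C (e ++ [d])) then d else b) 0

/-- A word of length `s` that avoids at least the expected number of constraints in `C`, found by
the method of conditional expectations. -/
def bestWord (D t : ℕ) (C : List (List ℕ)) (s : ℕ) : List ℕ :=
  (fun e => e ++ [bestLetter D t C e])^[s] []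

/-- On average over the next letter, the conditional probability does not change. -/
theorem sum_gain_append {D t : ℕ} {e c : List ℕ} (he : e.length < c.length)
    (hc : ∀ a ∈ c, a ≤ D) (ht : support D c ≤ t) :
    ((List.range D).map fun d => gain D t (e ++ [d]) c).sum = D * gain D t e c := by
  cases hav : avoids e c
  · simp [gain, avoids_append_singleton, hav]
  have hdrop : c.drop e.length = c.getD e.length 0 :: c.drop (e.length + 1) := by
    rw [List.drop_eq_getElem_cons he, List.getD_eq_getElem _ _ he]
  have hsup : support D (c.drop e.length) ≤ t := by
    refine le_trans ?_ ht
    conv_rhs => rw [← List.take_append_drop e.length c, support_append]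
    omega
  set a := c.getD e.length 0 with ha
  have haD : a ≤ D := hc a (by rw [ha, List.getD_eq_getElem _ _ he]; exact List.getElem_mem he)
  set c' := c.drop (e.length + 1) with hc'
  have hg : ∀ d, gain D t (e ++ [d]) c = if d = a then 0 else weight D t c' := by
    intro d
    rw [gain, avoids_append_singleton, hav, ← ha, List.length_append, List.length_singleton, ← hc']
    by_cases hd : d = a <;> simp [hd]
  have hge : gain D t e c = weight D t (a :: c') := by simp [gain, hav, hdrop]
  rw [hdrop, support_cons] at hsup
  have hsum : ((List.range D).map fun d => gain D t (e ++ [d]) c).sum =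
      ∑ d ∈ Finset.range D, if d = a then 0 else weight D t c' := by
    simp only [hg]
    rfl
  rw [hsum, hge]
  rcases Nat.lt_or_ge a D with h | h
  · rw [Finset.sum_ite, Finset.sum_const_zero, zero_add, Finset.sum_const, smul_eq_mul,
      Finset.filter_ne' , Finset.card_erase_of_mem (Finset.mem_range.2 h), Finset.card_range]
    rw [if_pos h] at hsup
    unfold weight
    rw [support_cons, if_pos h]
    obtain ⟨q, hq⟩ : ∃ q, t - support D c' = q + 1 := ⟨t - support D c' - 1, by omega⟩
    have h1 : t - (support D c' + 1) = q := by omega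
    have h2 : t - q = t - (q + 1) + 1 := by omega
    rw [h1, hq, h2, pow_succ, pow_succ]
    ring
  · obtain rfl : a = D := le_antisymm haD h
    rw [Finset.sum_congr rfl (g := fun _ => weight a t c') fun d hd => if_neg (by
      have := Finset.mem_range.1 hd; omega)]
    simp [weight, support_cons]

theorem sum_score_append {D t s : ℕ} {C : List (List ℕ)} {e : List ℕ} (he : e.length < s)
    (hC : ∀ c ∈ C, IsConstraint D s t c) :
    ((List.range D).map fun d => score D t C (e ++ [d])).sum = D * score D t C e := by
  induction C with
  | nil => simp [score]
  | cons c C ih =>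
    have h1 := ih fun c hc => hC c (List.mem_cons_of_mem _ hc)
    have h2 := hC c List.mem_cons_self
    have h3 := sum_gain_append (D := D) (t := t) (e := e) (by rw [h2.length_eq]; exact he)
      h2.le h2.support_le
    simp only [score, List.map_cons, List.sum_cons, List.sum_map_add] at h1 ⊢
    rw [h1, h3, mul_add]

theorem foldl_argmax {n : ℕ} (hn : 0 < n) (f : ℕ → ℕ) :
    (List.range n).foldl (fun b d => bif decide (f b < f d) then d else b) 0 < n ∧
      ∀ d < n, f d ≤ f ((List.range n).foldl (fun b d => bif decide (f b < f d) then d else b) 0) := by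
  induction n with
  | zero => omega
  | succ n ih =>
    rw [List.range_succ, List.foldl_append, List.foldl_cons, List.foldl_nil]
    rcases Nat.eq_zero_or_pos n with rfl | h0
    · simp
    obtain ⟨h1, h2⟩ := ih h0
    set b := (List.range n).foldl (fun b d => bif decide (f b < f d) then d else b) 0
    by_cases h : f b < f n
    · simp only [h, decide_true, cond_true]
      refine ⟨by omega, fun d hd => ?_⟩
      rcases Nat.lt_succ_iff_lt_or_eq.1 hd with h' | rfl
      · exact (h2 d h').trans h.le
      · exact le_rfl
    · simp only [h, decide_false, cond_false]
      refine ⟨by omega, fun d hd => ?_⟩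
      rcases Nat.lt_succ_iff_lt_or_eq.1 hd with h' | rfl
      · exact h2 d h'
      · omega

theorem bestLetter_lt {D : ℕ} (hD : 0 < D) (t : ℕ) (C : List (List ℕ)) (e : List ℕ) :
    bestLetter D t C e < D :=
  (foldl_argmax hD fun d => score D t C (e ++ [d])).1

theorem score_le_bestLetter {D t s : ℕ} (hD : 0 < D) {C : List (List ℕ)} {e : List ℕ}
    (he : e.length < s) (hC : ∀ c ∈ C, IsConstraint D s t c) :
    score D t C e ≤ score D t C (e ++ [bestLetter D t C e]) := by
  have h1 := (foldl_argmax hD fun d => score D t C (e ++ [d])).2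
  have h2 := sum_score_append he hC
  have h3 : ((List.range D).map fun d => score D t C (e ++ [d])).sum ≤
      D * score D t C (e ++ [bestLetter D t C e]) := by
    refine (List.sum_le_card_nsmul _ (score D t C (e ++ [bestLetter D t C e])) ?_).trans ?_
    · intro x hx
      obtain ⟨d, hd, rfl⟩ := List.mem_map.1 hx
      exact h1 d (List.mem_range.1 hd)
    · simp
  rw [h2] at h3
  exact Nat.le_of_mul_le_mul_left h3 hD

theorem iterate_bestLetter {D t s : ℕ} (hD : 0 < D) {C : List (List ℕ)}
    (hC : ∀ c ∈ C, IsConstraint D s t c) {k : ℕ} (hk : k ≤ s) :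
    ((fun e => e ++ [bestLetter D t C e])^[k] []).length = k ∧
      score D t C [] ≤ score D t C ((fun e => e ++ [bestLetter D t C e])^[k] []) := by
  induction k with
  | zero => simp
  | succ k ih =>
    obtain ⟨h1, h2⟩ := ih (by omega)
    rw [Function.iterate_succ_apply']
    exact ⟨by simp [h1], h2.trans (score_le_bestLetter hD (by omega) hC)⟩

theorem length_bestWord (D t : ℕ) (C : List (List ℕ)) (s : ℕ) :
    (bestWord D t C s).length = s := by
  unfold bestWord
  induction s with
  | zero => rfl
  | succ k ih => rw [Function.iterate_succ_apply']; simp [ih]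

theorem lt_of_mem_bestWord {D : ℕ} (hD : 0 < D) {t : ℕ} {C : List (List ℕ)} {s a : ℕ}
    (ha : a ∈ bestWord D t C s) : a < D := by
  unfold bestWord at ha
  induction s with
  | zero => simp at ha
  | succ k ih =>
    rw [Function.iterate_succ_apply', List.mem_append, List.mem_singleton] at ha
    rcases ha with h | rfl
    · exact ih h
    · exact bestLetter_lt hD _ _ _

/-- The chosen word avoids at least a fraction `((D - 1) / D) ^ t` of the constraints. -/
theorem le_card_avoids_bestWord {D t s : ℕ} (hD : 0 < D) {C : List (List ℕ)}
    (hC : ∀ c ∈ C, IsConstraint D s t c) :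
    (D - 1) ^ t * C.length ≤ D ^ t * (C.filter (avoids (bestWord D t C s))).length := by
  have h1 := (iterate_bestLetter hD hC le_rfl).2
  rw [← bestWord] at h1
  have h2 : (D - 1) ^ t * C.length ≤ score D t C [] := by
    unfold score
    have : ∀ c ∈ C, (D - 1) ^ t ≤ gain D t [] c := by
      intro c hc
      have h3 := (hC c hc).support_le
      have h4 : t = (t - (t - support D c)) + (t - support D c) := by omega
      calc (D - 1) ^ t = (D - 1) ^ (t - (t - support D c)) * (D - 1) ^ (t - support D c) := by
            rw [← pow_add, ← h4]
        _ ≤ (D - 1) ^ (t - (t - support D c)) * D ^ (t - support D c) := by gcongr; omega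
        _ = gain D t [] c := by simp [gain, avoids, weight]
    have := List.card_nsmul_le_sum (C.map (gain D t [])) ((D - 1) ^ t) (by simpa using this)
    simpa [mul_comm] using this
  have h3 : score D t C (bestWord D t C s) =
      D ^ t * (C.filter (avoids (bestWord D t C s))).length := by
    have hlen := length_bestWord D t C s
    generalize bestWord D t C s = e at hlen
    unfold score
    clear h1 h2
    induction C with
    | nil => simp
    | cons c C ih =>
      have h4 := ih fun c hc => hC c (List.mem_cons_of_mem _ hc)
      have h5 : c.drop e.length = [] :=
        List.drop_eq_nil_of_le (by rw [hlen, (hC c List.mem_cons_self).length_eq])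
      cases h : avoids e c
      · simp [gain, h, h4]
      · simp [gain, h, h4, h5, weight, support]; ring
  omega

/-! ### The greedy family -/

/-- One step of the greedy algorithm on a pair of a list of words and the list of the constraints
that none of them avoids. -/
def greedyStep (D s t : ℕ) (x : List (List ℕ) × List (List ℕ)) :
    List (List ℕ) × List (List ℕ) :=
  bif x.2.isEmpty then x else
    (bestWord D t x.2 s :: x.1, x.2.filter fun c => !(avoids (bestWord D t x.2 s) c))

/-- A short list of words such that every constraint with at most `t` conditions is avoided by one
of them. -/
def greedyFamily (D s t : ℕ) : List (List ℕ) :=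
  ((greedyStep D s t)^[(constraints D s t).length] ([], constraints D s t)).1

theorem length_filter_not_add (l : List (List ℕ)) (p : List ℕ → Bool) :
    (l.filter fun c => !(p c)).length + (l.filter p).length = l.length := by
  induction l with
  | nil => rfl
  | cons a l ih => cases h : p a <;> simp [h] <;> omega

/-- The invariants of the greedy algorithm, for the list `x.1` of words and the list `x.2` of the
remaining constraints. By the last two, `x.2` shrinks geometrically, and no further words are
added once it is empty. -/
theorem greedy_invariant {D s t : ℕ} (hD : 2 ≤ D) (k : ℕ) (x : List (List ℕ) × List (List ℕ))
    (hx : x = (greedyStep D s t)^[k] ([], constraints D s t)) :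
    (∀ c ∈ x.2, c ∈ constraints D s t) ∧ x.2.Sublist (constraints D s t) ∧
    (∀ e ∈ x.1, e.length = s ∧ ∀ a ∈ e, a < D) ∧
    (∀ c ∈ constraints D s t, c ∉ x.2 → ∃ e ∈ x.1, avoids e c = true) ∧
    x.2.length ≤ (constraints D s t).length - k ∧
    x.1.length ≤ k ∧
    x.2.length * (D ^ t) ^ k ≤ (D ^ t - (D - 1) ^ t) ^ k * (constraints D s t).length ∧
    (∀ R, (D ^ t - (D - 1) ^ t) ^ R * (constraints D s t).length < (D ^ t) ^ R →
      x.1.length ≤ R) := by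
  induction k generalizing x with
  | zero => subst hx; simp
  | succ k ih =>
    obtain ⟨h1, h1', h2, h3, h4, h5, h6, h7⟩ := ih _ rfl
    rw [Function.iterate_succ_apply'] at hx
    set y := (greedyStep D s t)^[k] ([], constraints D s t)
    have hDt : 0 < D ^ t := by positivity
    rcases hy : y.2.isEmpty with _ | _
    · rw [greedyStep, hy, cond_false] at hx
      have hne : y.2 ≠ [] := by rintro h; rw [h] at hy; simp at hy
      have hpos : 0 < y.2.length := List.length_pos_iff.2 hne
      have hcon : ∀ c ∈ y.2, IsConstraint D s t c :=
        fun c hc => isConstraint_of_mem_constraints (h1 c hc)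
      have hbest := le_card_avoids_bestWord (D := D) (by omega) hcon
      have hsum := length_filter_not_add y.2 (avoids (bestWord D t y.2 s))
      have hle : (D - 1) ^ t ≤ D ^ t := by gcongr; omega
      have hkey : (y.2.filter fun c => !(avoids (bestWord D t y.2 s) c)).length * D ^ t ≤
          (D ^ t - (D - 1) ^ t) * y.2.length := by
        rw [Nat.sub_mul]
        have : D ^ t * y.2.length = D ^ t * (y.2.filter (avoids (bestWord D t y.2 s))).length +
          (y.2.filter fun c => !(avoids (bestWord D t y.2 s) c)).length * D ^ t := by
          rw [← hsum]; ring
        omega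
      have hlt : 0 < (y.2.filter (avoids (bestWord D t y.2 s))).length := by
        have : 0 < (D - 1) ^ t * y.2.length := by
          have : 0 < D - 1 := by omega
          positivity
        exact Nat.pos_of_mul_pos_left (this.trans_le hbest)
      subst hx
      refine ⟨fun c hc => h1 c (List.mem_of_mem_filter hc), List.filter_sublist.trans h1',
        ?_, ?_, ?_, ?_, ?_, ?_⟩
      · intro e he
        rcases List.mem_cons.1 he with rfl | he
        · exact ⟨length_bestWord _ _ _ _, fun a ha => lt_of_mem_bestWord (by omega) ha⟩
        · exact h2 e he
      · intro c hc hc'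
        by_cases hcy : c ∈ y.2
        · refine ⟨_, List.mem_cons_self, ?_⟩
          by_contra hav
          exact hc' (List.mem_filter.2 ⟨hcy, by simpa using hav⟩)
        · obtain ⟨e, he, he'⟩ := h3 c hc hcy
          exact ⟨e, List.mem_cons_of_mem _ he, he'⟩
      · dsimp only; omega
      · simpa using h5
      · dsimp only
        rw [pow_succ, pow_succ]
        calc _ = ((y.2.filter fun c => !(avoids (bestWord D t y.2 s) c)).length * D ^ t) *
              (D ^ t) ^ k := by ring
          _ ≤ ((D ^ t - (D - 1) ^ t) * y.2.length) * (D ^ t) ^ k := by gcongr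
          _ = (D ^ t - (D - 1) ^ t) * (y.2.length * (D ^ t) ^ k) := by ring
          _ ≤ (D ^ t - (D - 1) ^ t) *
              ((D ^ t - (D - 1) ^ t) ^ k * (constraints D s t).length) := by gcongr
          _ = _ := by ring
      · intro R hR
        have h8 := h7 R hR
        simp only [List.length_cons]
        -- all constraints are avoided after `R` rounds, so this round is not the `R + 1`st
        by_contra hlen
        have hRk : R ≤ k := by omega
        obtain ⟨j, rfl⟩ := Nat.exists_eq_add_of_le hRk
        have h9 : y.2.length * (D ^ t) ^ (R + j) < (D ^ t) ^ (R + j) := by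
          refine h6.trans_lt ?_
          rw [pow_add, pow_add]
          calc _ = ((D ^ t - (D - 1) ^ t) ^ R * (constraints D s t).length) *
                (D ^ t - (D - 1) ^ t) ^ j := by ring
            _ ≤ ((D ^ t - (D - 1) ^ t) ^ R * (constraints D s t).length) * (D ^ t) ^ j := by
                gcongr; omega
            _ < _ := by gcongr
        have : 1 * (D ^ t) ^ (R + j) ≤ y.2.length * (D ^ t) ^ (R + j) := by gcongr; omega
        omega
    · rw [greedyStep, hy, cond_true] at hx
      have hnil : y.2 = [] := List.isEmpty_iff.1 hy
      subst hx
      refine ⟨h1, h1', h2, h3, by simp [hnil], by omega, by simp [hnil], h7⟩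

theorem isHitting_greedyFamily {D s t : ℕ} (hD : 2 ≤ D) :
    IsHitting D s t (greedyFamily D s t) := by
  obtain ⟨h1, -, h2, h3, h4, -⟩ := greedy_invariant (D := D) (s := s) (t := t) hD _ _ rfl
  refine ⟨fun e he => (h2 e he).1, fun e he => (h2 e he).2, fun c hc =>
    h3 c (mem_constraints (by omega) hc) ?_⟩
  rw [Nat.sub_self, Nat.le_zero, List.length_eq_zero_iff] at h4
  rw [h4]
  simp

theorem length_greedyFamily_le {D s t : ℕ} (hD : 2 ≤ D) :
    ((greedyFamily D s t).length : ℝ) ≤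
      ((D : ℝ) / (D - 1)) ^ t * Real.log (((s + 1) * D : ℝ) ^ t) + 1 := by
  obtain ⟨-, -, -, -, -, -, -, h⟩ :=
    greedy_invariant (D := D) (s := s) (t := t) hD (constraints D s t).length _ rfl
  rw [← greedyFamily] at h
  have hD1 : (0 : ℝ) < (D : ℝ) - 1 := by
    have : (2 : ℝ) ≤ D := by exact_mod_cast hD
    linarith
  have hDpos : (0 : ℝ) < D := by linarith
  set r : ℝ := ((D : ℝ) / (D - 1)) ^ t with hr
  have hrpos : 0 < r := by positivity
  set n : ℝ := ((s + 1) * D : ℝ) ^ t with hn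
  have hnpos : 0 < n := by positivity
  have hn1 : 1 ≤ n := by
    refine one_le_pow₀ ?_
    have : (2 : ℝ) ≤ D := by exact_mod_cast hD
    have : (0 : ℝ) ≤ s := by positivity
    nlinarith
  have hlog : 0 ≤ r * Real.log n := mul_nonneg hrpos.le (Real.log_nonneg hn1)
  have hlt := h (⌊r * Real.log n⌋₊ + 1) ?_
  · refine (Nat.cast_le.2 hlt).trans ?_
    push_cast
    gcongr
    exact Nat.floor_le hlog
  · have hle : (D - 1) ^ t ≤ D ^ t := by gcongr; omega
    rw [length_constraints]
    have hcast : (((D ^ t - (D - 1) ^ t : ℕ)) : ℝ) = (D : ℝ) ^ t * (1 - r⁻¹) := by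
      rw [Nat.cast_sub hle]
      push_cast [Nat.cast_sub (show 1 ≤ D by omega)]
      rw [hr, div_pow, inv_div]
      field_simp
    have hR : r * Real.log n < (⌊r * Real.log n⌋₊ + 1 : ℕ) := by
      push_cast; exact Nat.lt_floor_add_one _
    set R := ⌊r * Real.log n⌋₊ + 1
    have hinv : r⁻¹ ≤ 1 := by
      refine inv_le_one_of_one_le₀ (one_le_pow₀ ?_)
      rw [le_div_iff₀ hD1]; linarith
    have h1 : (1 - r⁻¹) ^ R * n < 1 := by
      have h2 : (1 - r⁻¹) ^ R ≤ Real.exp (-(R / r)) := by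
        calc (1 - r⁻¹) ^ R ≤ (Real.exp (-r⁻¹)) ^ R := by
              refine pow_le_pow_left₀ (by linarith) ?_ R
              linarith [Real.add_one_le_exp (-r⁻¹)]
          _ = Real.exp (-(R / r)) := by
              rw [← Real.exp_nat_mul, mul_neg, div_eq_mul_inv]
      have h3 : Real.log n < R / r := by rw [lt_div_iff₀ hrpos]; linarith
      calc (1 - r⁻¹) ^ R * n ≤ Real.exp (-(R / r)) * n := by gcongr
        _ < Real.exp (-Real.log n) * n := by gcongr
        _ = 1 := by rw [Real.exp_neg, Real.exp_log hnpos, inv_mul_cancel₀ hnpos.ne']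
    have h4 : ((D : ℝ) ^ t * (1 - r⁻¹)) ^ R * n < ((D : ℝ) ^ t) ^ R := by
      rw [mul_pow, mul_assoc]
      exact mul_lt_of_lt_one_right (by positivity) h1
    have h5 : (((D ^ t - (D - 1) ^ t) ^ R * ((s + 1) * D) ^ t : ℕ) : ℝ) < ((D ^ t) ^ R : ℕ) := by
      push_cast [hcast]
      exact h4
    exact_mod_cast h5

/-! ### Splicing -/

/-- All words that agree with a word of `F` before some position and with a word of `L` from that
position on. -/
def splice (s : ℕ) (F L : List (List ℕ)) : List (List ℕ) :=
  (List.range (s + 1)).flatMap fun x => F.flatMap fun e => L.map fun e' => e.take x ++ e'.drop x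

/-- Words of length `s` that avoid every constraint with at most `b * t` conditions: the positions
are cut into `b` intervals, and each interval is served by the greedy family. -/
def family (D s t b : ℕ) : List (List ℕ) :=
  (splice s (greedyFamily D s t))^[b] [List.replicate s 0]

theorem length_splice (s : ℕ) (F L : List (List ℕ)) :
    (splice s F L).length = (s + 1) * F.length * L.length := by
  simp [splice, List.length_flatMap, mul_assoc]

theorem length_family (D s t b : ℕ) :
    (family D s t b).length = ((s + 1) * (greedyFamily D s t).length) ^ b := by
  induction b with
  | zero => simp [family]
  | succ b ih =>
    rw [family, Function.iterate_succ_apply', length_splice, ← family, ih, pow_succ]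
    ring

/-- A position that leaves `t` conditions of `c` to its left, or all of them if there are fewer. -/
theorem exists_support_split (D : ℕ) (c : List ℕ) (t : ℕ) :
    ∃ x ≤ c.length, support D (c.take x) ≤ t ∧ support D (c.drop x) ≤ support D c - t := by
  induction c generalizing t with
  | nil => exact ⟨0, le_rfl, by simp [support]⟩
  | cons a c ih =>
    rcases Nat.eq_zero_or_pos t with rfl | ht
    · exact ⟨0, by simp, by simp [support]⟩
    by_cases ha : a < D
    · obtain ⟨x, hx, h1, h2⟩ := ih (t - 1)
      refine ⟨x + 1, by simpa using hx, ?_, ?_⟩ <;>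
        simp only [List.take_succ_cons, List.drop_succ_cons, support_cons, if_pos ha] <;> omega
    · obtain ⟨x, hx, h1, h2⟩ := ih t
      refine ⟨x + 1, by simpa using hx, ?_, ?_⟩ <;>
        simp only [List.take_succ_cons, List.drop_succ_cons, support_cons, if_neg ha] <;> omega

/-- To avoid `c`, cut it at a position that leaves at most `t` conditions to the left and at most `k`
to the right. -/
theorem IsHitting.splice {D s t k : ℕ} {F L : List (List ℕ)} (hF : IsHitting D s t F)
    (hL : IsHitting D s k L) : IsHitting D s (k + t) (splice s F L) := by
  constructor
  · intro e he
    simp only [SetCoverHardness.splice, List.mem_flatMap, List.mem_map, List.mem_range] at he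
    obtain ⟨x, hx, e1, h1, e2, h2, rfl⟩ := he
    simp only [List.length_append, List.length_take, List.length_drop, hF.length_eq e1 h1,
      hL.length_eq e2 h2]
    omega
  · intro e he a ha
    simp only [SetCoverHardness.splice, List.mem_flatMap, List.mem_map, List.mem_range] at he
    obtain ⟨x, hx, e1, h1, e2, h2, rfl⟩ := he
    rcases List.mem_append.1 ha with h | h
    · exact hF.lt e1 h1 a (List.mem_of_mem_take h)
    · exact hL.lt e2 h2 a (List.mem_of_mem_drop h)
  · intro c hc
    obtain ⟨x, hx, h1, h2⟩ := exists_support_split D c t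
    have hs := hc.length_eq
    have h3 := hc.support_le
    obtain ⟨e1, he1, ha1⟩ := hF.exists_avoids (c.take x ++ List.replicate (s - x) D) ⟨by
      simp; omega, fun a ha => by
        rcases List.mem_append.1 ha with h | h
        · exact hc.le a (List.mem_of_mem_take h)
        · exact (List.eq_of_mem_replicate h).le, by
        rw [support_append, support_replicate]; omega⟩
    obtain ⟨e2, he2, ha2⟩ := hL.exists_avoids (List.replicate x D ++ c.drop x) ⟨by
      simp; omega, fun a ha => by
        rcases List.mem_append.1 ha with h | h
        · exact (List.eq_of_mem_replicate h).le
        · exact hc.le a (List.mem_of_mem_drop h), by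
        rw [support_append, support_replicate]; omega⟩
    refine ⟨e1.take x ++ e2.drop x, ?_, ?_⟩
    · simp only [SetCoverHardness.splice, List.mem_flatMap, List.mem_map, List.mem_range]
      exact ⟨x, by omega, e1, he1, e2, he2, rfl⟩
    · have hl1 := hF.length_eq e1 he1
      have hl2 := hL.length_eq e2 he2
      rw [avoids_iff] at ha1 ha2 ⊢
      intro v hv
      simp only [List.length_append, List.length_take, List.length_drop, hl1, hl2] at hv
      rcases Nat.lt_or_ge v x with h | h
      · have := ha1 v (by omega)
        rw [List.getD_append _ _ _ _ (by simp; omega)] at this ⊢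
        simpa [List.getD_eq_getElem?_getD, List.getElem?_take, h] using this
      · have := ha2 v (by omega)
        rw [List.getD_append_right _ _ _ _ (by simp; omega)] at this
        rw [List.getD_append_right _ _ _ _ (by simp; omega)]
        simp only [List.length_replicate, List.length_take, hl1, List.getD_eq_getElem?_getD,
          List.getElem?_drop] at this ⊢
        rw [min_eq_left (by omega)]
        rwa [Nat.add_sub_cancel' h] at this ⊢

theorem isHitting_family {D s t b : ℕ} (hD : 2 ≤ D) : IsHitting D s (b * t) (family D s t b) := by
  induction b with
  | zero =>
    refine ⟨by simp [family], ?_, fun c hc => ?_⟩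
    · intro e he a ha
      simp only [family, Function.iterate_zero, id_eq, List.mem_singleton] at he
      subst he
      have := List.eq_of_mem_replicate ha
      omega
    · refine ⟨List.replicate s 0, by simp [family], avoids_iff.2 fun v hv => ?_⟩
      have hc0 : c ∈ constraints D s 0 := mem_constraints (by omega) (by simpa using hc)
      simp only [constraints, Function.iterate_zero, id_eq, List.mem_singleton] at hc0
      simp only [List.length_replicate] at hv
      rw [hc0, List.getD_replicate _ hv, List.getD_replicate _ hv]
      omega
  | succ b ih =>
    rw [family, Function.iterate_succ_apply', ← family, Nat.succ_mul]
    exact (isHitting_greedyFamily hD).splice ih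


/-! ### The greedy family is computable in polynomial time -/

section

variable {α β : Type} [TreeEncodable α] [TreeEncodable β]

@[fun_prop]
theorem PolyTime.take {n : α → ℕ} {f : α → List β} (hn : PolyTime n) (hf : PolyTime f) :
    PolyTime (fun a => (f a).take (n a)) := by
  have : PolyTime (fun a => ((f a).reverse.drop ((f a).length - n a)).reverse) := by fun_prop
  convert this using 2 with a
  rw [List.drop_reverse, List.reverse_reverse]
  rcases Nat.le_total (n a) (f a).length with h | h
  · rw [Nat.sub_sub_self h]
  · rw [Nat.sub_eq_zero_of_le h, Nat.sub_zero, List.take_length, List.take_of_length_le h]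

@[fun_prop]
theorem PolyTime.set {f : α → List β} {n : α → ℕ} {b : α → β} (hf : PolyTime f) (hn : PolyTime n)
    (hb : PolyTime b) : PolyTime (fun a => (f a).set (n a) (b a)) := by
  have : PolyTime (fun a => bif decide (n a < (f a).length) then
      (f a).take (n a) ++ b a :: (f a).drop (n a + 1) else f a) := by fun_prop
  convert this using 2 with a
  rw [List.set_eq_take_append_cons_drop]
  by_cases h : n a < (f a).length <;> simp [h]

theorem encSize_list_le {l : List β} {K : ℕ} (h : ∀ b ∈ l, encSize b ≤ K) :
    encSize l ≤ l.length * (K + 1) + 1 := by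
  induction l with
  | nil => simp [encSize_nil]
  | cons b l ih =>
    have h1 := ih fun b' hb' => h b' (List.mem_cons_of_mem _ hb')
    have h2 := h b List.mem_cons_self
    rw [encSize_cons, List.length_cons]
    have : (l.length + 1) * (K + 1) = l.length * (K + 1) + (K + 1) := by ring
    omega

/-- A bound for the size of a word of length `s` with entries at most `D`. -/
def wordBound (D s : ℕ) : ℕ := s * (2 * D + 2) + 1

theorem encSize_word_le {D s : ℕ} {e : List ℕ} (h1 : e.length ≤ s) (h2 : ∀ a ∈ e, a ≤ D) :
    encSize e ≤ wordBound D s := by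
  have := encSize_list_le (l := e) (K := 2 * D + 1) fun a ha => by
    rw [encSize_nat]; have := h2 a ha; omega
  refine this.trans ?_
  unfold wordBound
  gcongr

theorem encSize_words_le {D s n : ℕ} {L : List (List ℕ)} (hn : L.length ≤ n)
    (h1 : ∀ e ∈ L, e.length ≤ s) (h2 : ∀ e ∈ L, ∀ a ∈ e, a ≤ D) :
    encSize L ≤ n * (wordBound D s + 1) + 1 := by
  refine (encSize_list_le (K := wordBound D s) fun e he =>
    encSize_word_le (h1 e he) (h2 e he)).trans ?_
  gcongr

theorem PolyBounded.wordBound {s : α → ℕ} (D : ℕ) (hs : PolyBounded s) :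
    PolyBounded (fun a => wordBound D (s a)) :=
  (hs.mul (.const _)).add (.const _)

theorem PolyBounded.words {s n : α → ℕ} (D : ℕ) (hn : PolyBounded n) (hs : PolyBounded s) :
    PolyBounded (fun a => n a * (SetCoverHardness.wordBound D (s a) + 1) + 1) :=
  (hn.mul ((hs.wordBound D).add (.const _))).add (.const _)

@[fun_prop]
theorem PolyTime.avoids {e c : α → List ℕ} (he : PolyTime e) (hc : PolyTime c) :
    PolyTime (fun a => avoids (e a) (c a)) := by
  unfold SetCoverHardness.avoids
  exact .all (by fun_prop) (by fun_prop)

@[fun_prop]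
theorem PolyTime.support (D : ℕ) {c : α → List ℕ} (hc : PolyTime c) :
    PolyTime (fun a => support D (c a)) :=
  .length (.filter hc (by fun_prop))

@[fun_prop]
theorem PolyTime.replicate {n : α → ℕ} {b : α → β} (hn : PolyTime n) (hb : PolyTime b) :
    PolyTime (fun a => List.replicate (n a) (b a)) := by
  have : PolyTime (fun a => (List.replicate (n a) ()).map fun _ => b a) :=
    .map (by fun_prop) (by fun_prop)
  simpa using this

@[fun_prop]
theorem PolyTime.addCondition (D : ℕ) {s : α → ℕ} {C : α → List (List ℕ)} (hs : PolyTime s)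
    (hC : PolyTime C) : PolyTime (fun a => addCondition D (s a) (C a)) :=
  .flatMap hC (.flatMap (by fun_prop) (.map (by fun_prop) (by fun_prop)))

theorem PolyTime.constraints {D : ℕ} (hD : 0 < D) {s t B : α → ℕ} (hs : PolyTime s)
    (ht : PolyTime t) (hB : PolyBounded B) (hb : ∀ a, ((s a + 1) * D) ^ t a ≤ B a) :
    PolyTime (fun a => constraints D (s a) (t a)) := by
  refine .iterate ht (by fun_prop) (by fun_prop)
    (hB.words D (PolyBounded.nat hs)) fun a k hk => ?_
  rw [← SetCoverHardness.constraints]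
  refine encSize_words_le ?_ (fun e he => (isConstraint_of_mem_constraints he).length_eq.le)
    (fun e he => (isConstraint_of_mem_constraints he).le)
  rw [length_constraints]
  refine le_trans ?_ (hb a)
  gcongr
  nlinarith

theorem PolyTime.weight {D : ℕ} (hD : 0 < D) {t B : α → ℕ} {c : α → List ℕ} (ht : PolyTime t)
    (hc : PolyTime c) (hB : PolyBounded B) (hb : ∀ a, D ^ t a ≤ B a) :
    PolyTime (fun a => weight D (t a) (c a)) := by
  have hpow : ∀ a, ∀ k ≤ t a, D ^ k ≤ B a := fun a k hk =>
    (Nat.pow_le_pow_right hD hk).trans (hb a)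
  refine .mul (.pow (by fun_prop) (by fun_prop) hB fun a k hk => ?_)
    (.pow (by fun_prop) (by fun_prop) hB fun a k hk => ?_)
  · exact (Nat.pow_le_pow_left (Nat.sub_le _ _) k).trans (hpow a k (by omega))
  · exact hpow a k (by omega)

theorem PolyTime.score {D : ℕ} (hD : 0 < D) {t B : α → ℕ} {C : α → List (List ℕ)} {e : α → List ℕ}
    (ht : PolyTime t) (hC : PolyTime C) (he : PolyTime e) (hB : PolyBounded B)
    (hb : ∀ a, D ^ t a ≤ B a) : PolyTime (fun a => score D (t a) (C a) (e a)) := by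
  refine .sum (.map hC (.cond (by fun_prop) ?_ (by fun_prop)))
  exact .weight hD (by fun_prop) (by fun_prop) (hB.comp .fst') fun y => hb y.1

theorem foldl_select_mem {f : ℕ → ℕ → Bool} (l : List ℕ) (n : ℕ) :
    l.foldl (fun b d => bif f b d then d else b) n = n ∨
      l.foldl (fun b d => bif f b d then d else b) n ∈ l := by
  induction l generalizing n with
  | nil => simp
  | cons d l ih =>
    rw [List.foldl_cons]
    rcases ih (bif f n d then d else n) with h | h
    · rw [h]; cases f n d <;> simp
    · exact Or.inr (List.mem_cons_of_mem _ h)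

theorem PolyTime.bestLetter {D : ℕ} (hD : 0 < D) {t B : α → ℕ} {C : α → List (List ℕ)}
    {e : α → List ℕ} (ht : PolyTime t) (hC : PolyTime C) (he : PolyTime e) (hB : PolyBounded B)
    (hb : ∀ a, D ^ t a ≤ B a) : PolyTime (fun a => bestLetter D (t a) (C a) (e a)) := by
  refine .foldl (l := fun _ => List.range D) (init := fun _ => 0) (B := fun _ => 2 * D + 1)
    (step := fun a b d => bif decide (SetCoverHardness.score D (t a) (C a) (e a ++ [b]) <
      SetCoverHardness.score D (t a) (C a) (e a ++ [d])) then d else b) (by fun_prop)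
    (by fun_prop) (.cond (.decide_lt ?_ ?_) (by fun_prop) (by fun_prop)) (.const _) ?_
  · exact .score hD (by fun_prop) (by fun_prop) (by fun_prop) (hB.comp .fst') fun y => hb y.1
  · exact .score hD (by fun_prop) (by fun_prop) (by fun_prop) (hB.comp .fst') fun y => hb y.1
  · intro a pre suf h
    rw [encSize_nat]
    have hm : ∀ d ∈ pre, d < D := fun d hd => by
      rw [← List.mem_range, h]; exact List.mem_append_left _ hd
    rcases foldl_select_mem (f := fun b d => decide (SetCoverHardness.score D (t a) (C a)
      (e a ++ [b]) < SetCoverHardness.score D (t a) (C a) (e a ++ [d]))) pre 0 with h | h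
    · rw [h]; omega
    · have := hm _ h; omega

theorem PolyTime.bestWord {D : ℕ} (hD : 0 < D) {t s B : α → ℕ} {C : α → List (List ℕ)}
    (ht : PolyTime t) (hC : PolyTime C) (hs : PolyTime s) (hB : PolyBounded B)
    (hb : ∀ a, D ^ t a ≤ B a) : PolyTime (fun a => bestWord D (t a) (C a) (s a)) := by
  refine .iterate hs (by fun_prop)
    (step := fun a e => e ++ [SetCoverHardness.bestLetter D (t a) (C a) e])
    (.append (by fun_prop) (.cons ?_ (by fun_prop)))
    ((PolyBounded.nat hs).wordBound D) fun a k hk => ?_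
  · exact .bestLetter hD (by fun_prop) (by fun_prop) (by fun_prop) (hB.comp .fst') fun y => hb y.1
  · rw [← SetCoverHardness.bestWord]
    exact encSize_word_le (by rwa [length_bestWord]) fun a ha => (lt_of_mem_bestWord hD ha).le

theorem PolyTime.greedyFamily {D : ℕ} (hD : 2 ≤ D) {s t B : α → ℕ} (hs : PolyTime s)
    (ht : PolyTime t) (hB : PolyBounded B) (hb : ∀ a, ((s a + 1) * D) ^ t a ≤ B a) :
    PolyTime (fun a => greedyFamily D (s a) (t a)) := by
  have hD0 : 0 < D := by omega
  have hC := PolyTime.constraints hD0 hs ht hB hb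
  have hb' : ∀ a, D ^ t a ≤ B a := fun a =>
    (Nat.pow_le_pow_left (by nlinarith) _).trans (hb a)
  refine .fst (.iterate (init := fun a => (([] : List (List ℕ)),
    SetCoverHardness.constraints D (s a) (t a))) (.length hC) (.prodMk (by fun_prop) hC)
    (step := fun a x => greedyStep D (s a) (t a) x) ?_
    (((hB.words D (PolyBounded.nat hs)).add (hB.words D (PolyBounded.nat hs))).add (.const 1)) ?_)
  · have hw : PolyTime (fun y : α × List (List ℕ) × List (List ℕ) =>
        SetCoverHardness.bestWord D (t y.1) y.2.2 (s y.1)) :=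
      .bestWord hD0 (by fun_prop) (by fun_prop) (by fun_prop) (hB.comp .fst') fun y => hb' y.1
    refine .cond (by fun_prop) (by fun_prop) (.prodMk (.cons hw (by fun_prop))
      (.filter (by fun_prop) (.not (.avoids (hw.comp .fst') (by fun_prop)))))
  · intro a k hk
    obtain ⟨h1, h2, h3, -, -, h4, -⟩ := greedy_invariant (s := s a) (t := t a) hD k _ rfl
    have hlen : (SetCoverHardness.constraints D (s a) (t a)).length ≤ B a := by
      rw [length_constraints]; exact hb a
    generalize (greedyStep D (s a) (t a))^[k] ([], SetCoverHardness.constraints D (s a) (t a)) = x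
      at h1 h2 h3 h4
    obtain ⟨x1, x2⟩ := x
    rw [encSize_prod]
    refine Nat.add_le_add_right (Nat.add_le_add ?_ ?_) 1
    · exact encSize_words_le (h4.trans (hk.trans hlen)) (fun e he => (h3 e he).1.le)
        fun e he a ha => ((h3 e he).2 a ha).le
    · exact encSize_words_le (h2.length_le.trans hlen)
        (fun e he => (isConstraint_of_mem_constraints (h1 e he)).length_eq.le)
        fun e he => (isConstraint_of_mem_constraints (h1 e he)).le

theorem PolyTime.splice {s : α → ℕ} {F L : α → List (List ℕ)} (hs : PolyTime s) (hF : PolyTime F)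
    (hL : PolyTime L) : PolyTime (fun a => splice (s a) (F a) (L a)) :=
  .flatMap (by fun_prop) (.flatMap (by fun_prop) (.map (by fun_prop) (by fun_prop)))

theorem PolyTime.family {D : ℕ} (hD : 2 ≤ D) {s t b B B' : α → ℕ} (hs : PolyTime s)
    (ht : PolyTime t) (hbt : PolyTime b) (hB : PolyBounded B)
    (hb : ∀ a, ((s a + 1) * D) ^ t a ≤ B a) (hB' : PolyBounded B')
    (hb' : ∀ a, (family D (s a) (t a) (b a)).length ≤ B' a) :
    PolyTime (fun a => family D (s a) (t a) (b a)) := by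
  have hF := PolyTime.greedyFamily hD hs ht hB hb
  refine .iterate hbt (by fun_prop)
    (step := fun a L => SetCoverHardness.splice (s a) (SetCoverHardness.greedyFamily D (s a) (t a)) L) ?_
    ((hB'.add (.const 1)).words D (PolyBounded.nat hs)) fun a k hk => ?_
  · have hF' : PolyTime (fun y : α × List (List ℕ) =>
        SetCoverHardness.greedyFamily D (s y.1) (t y.1)) :=
      PolyTime.comp (f := fun y : α × List (List ℕ) => y.1) hF (by fun_prop)
    exact PolyTime.splice (by fun_prop) hF' (by fun_prop)
  · rw [← SetCoverHardness.family]
    have h := isHitting_family (D := D) (s := s a) (t := t a) (b := k) hD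
    refine encSize_words_le ?_ (fun e he => (h.length_eq e he).le) fun e he a ha =>
      (h.lt e he a ha).le
    have h1 := hb' a
    rw [length_family] at h1 ⊢
    rcases Nat.eq_zero_or_pos ((s a + 1) *
      (SetCoverHardness.greedyFamily D (s a) (t a)).length) with h0 | h0
    · rw [h0]
      exact (pow_le_one₀ (Nat.zero_le _) (Nat.zero_le _)).trans (by omega)
    · exact (Nat.pow_le_pow_right h0 hk).trans (by omega)

end

/-! ### An approximate logarithm -/

/-- Multiplication by `(D - 1) / D`, rounded down. -/
def shrink (D m : ℕ) : ℕ := m * (D - 1) / D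

/-- The number of times that `m` can be multiplied by `(D - 1) / D` and rounded down before it
vanishes: up to an additive constant, the logarithm of `m` to the base `D / (D - 1)`. -/
def decay (D m : ℕ) : ℕ :=
  ((List.range m).filter fun k => decide (0 < (shrink D)^[k] m)).length

theorem shrink_le (D m : ℕ) : shrink D m ≤ m := by
  unfold shrink
  rcases Nat.eq_zero_or_pos D with rfl | hD
  · simp
  · exact Nat.div_le_of_le_mul (by rw [mul_comm]; exact Nat.mul_le_mul_right _ (Nat.sub_le _ _))

theorem shrink_lt {D m : ℕ} (hD : 0 < D) (hm : 0 < m) : shrink D m < m := by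
  unfold shrink
  rw [Nat.div_lt_iff_lt_mul hD]
  exact Nat.mul_lt_mul_of_pos_left (by omega) hm

theorem iterate_shrink_antitone (D m : ℕ) : Antitone fun k => (shrink D)^[k] m :=
  antitone_nat_of_succ_le fun k => by
    rw [Function.iterate_succ_apply']; exact shrink_le _ _

theorem iterate_shrink_le {D : ℕ} (hD : 0 < D) (m k : ℕ) : (shrink D)^[k] m ≤ m - k := by
  induction k with
  | zero => simp
  | succ k ih =>
    rw [Function.iterate_succ_apply']
    rcases Nat.eq_zero_or_pos ((shrink D)^[k] m) with h | h
    · rw [h]; simp [shrink]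
    · have := shrink_lt hD h
      omega

theorem decay_spec {D : ℕ} (hD : 0 < D) (m : ℕ) :
    (shrink D)^[decay D m] m = 0 ∧ ∀ k < decay D m, 0 < (shrink D)^[k] m := by
  have hex : ∃ k, (shrink D)^[k] m = 0 := ⟨m, by have := iterate_shrink_le hD m m; omega⟩
  have hpos : ∀ k, 0 < (shrink D)^[k] m ↔ k < Nat.find hex := by
    intro k
    constructor
    · intro h
      by_contra hk
      have h1 := iterate_shrink_antitone D m (not_lt.1 hk)
      have h2 := Nat.find_spec hex
      simp only at h1
      omega
    · intro h
      exact Nat.pos_of_ne_zero (Nat.find_min hex h)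
  have hle : Nat.find hex ≤ m := Nat.find_min' hex (by have := iterate_shrink_le hD m m; omega)
  have h : decay D m = Nat.find hex := by
    rw [← length_filter_range_lt hle, decay]
    simp only [hpos]
  rw [h]
  exact ⟨Nat.find_spec hex, fun k hk => (hpos k).2 hk⟩

theorem PolyTime.decay {α : Type} [TreeEncodable α] (D : ℕ) {m : α → ℕ} (hm : PolyTime m) :
    PolyTime (fun a => decay D (m a)) := by
  refine .length (.filter (by fun_prop) (.decide_lt (by fun_prop) ?_))
  refine .iterate (step := fun _ m => shrink D m) (B := fun y => 2 * m y.1 + 1) (by fun_prop)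
    (by fun_prop) ?_ ?_ ?_
  · unfold shrink; fun_prop
  · exact ((PolyBounded.const 2).mul (PolyBounded.comp (PolyBounded.nat hm) .fst')).add (.const 1)
  · intro y k _
    have := iterate_shrink_antitone D (m y.1) (Nat.zero_le k)
    simp only [Function.iterate_zero, id_eq] at this
    change encSize ((shrink D)^[k] (m y.1)) ≤ _
    rw [encSize_nat]
    omega

section

variable {D : ℕ}

theorem ratio_decay_le (hD : 2 ≤ D) {m : ℕ} (hm : 0 < m) :
    ((D : ℝ) / (D - 1)) ^ decay D m ≤ 2 * m := by
  have hD2 : (2 : ℝ) ≤ D := by exact_mod_cast hD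
  have hD1 : (0 : ℝ) < (D : ℝ) - 1 := by linarith
  obtain ⟨h1, h2⟩ := decay_spec (D := D) (by omega) m
  have h3 : ∀ k, ((shrink D)^[k] m : ℝ) * ((D : ℝ) / (D - 1)) ^ k ≤ m := by
    intro k
    induction k with
    | zero => simp
    | succ k ih =>
      refine le_trans ?_ ih
      rw [Function.iterate_succ_apply', pow_succ']
      generalize (shrink D)^[k] m = a
      have : ((shrink D a : ℕ) : ℝ) ≤ a * (D - 1) / D := by
        refine Nat.cast_div_le.trans ?_
        rw [Nat.cast_mul, Nat.cast_sub (by omega), Nat.cast_one]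
      calc ((shrink D a : ℕ) : ℝ) * ((D : ℝ) / (D - 1) * ((D : ℝ) / (D - 1)) ^ k) ≤
            (a * (D - 1) / D) * ((D : ℝ) / (D - 1) * ((D : ℝ) / (D - 1)) ^ k) := by gcongr
        _ = a * ((D : ℝ) / (D - 1)) ^ k := by field_simp
  have h0 : decay D m ≠ 0 := by intro h; rw [h] at h1; simp at h1; omega
  obtain ⟨j, hj⟩ := Nat.exists_eq_succ_of_ne_zero h0
  have h4 := h2 j (by omega)
  have h5 := h3 j
  have h6 : (1 : ℝ) ≤ ((shrink D)^[j] m : ℕ) := by exact_mod_cast h4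
  have h7 : ((D : ℝ) / (D - 1)) ^ j ≤ m := by
    refine le_trans ?_ h5
    exact le_mul_of_one_le_left (by positivity) h6
  rw [hj, pow_succ, mul_comm]
  have h8 : (D : ℝ) / (D - 1) ≤ 2 := by rw [div_le_iff₀ hD1]; linarith
  gcongr

theorem lt_ratio_decay (hD : 2 ≤ D) (m : ℕ) :
    (m : ℝ) < D * ((D : ℝ) / (D - 1)) ^ decay D m := by
  have hD2 : (2 : ℝ) ≤ D := by exact_mod_cast hD
  have hD1 : (0 : ℝ) < (D : ℝ) - 1 := by linarith
  obtain ⟨h1, -⟩ := decay_spec (D := D) (by omega) m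
  have h3 : ∀ k, (m : ℝ) + D ≤ ((shrink D)^[k] m + D : ℝ) * ((D : ℝ) / (D - 1)) ^ k := by
    intro k
    induction k with
    | zero => simp
    | succ k ih =>
      refine ih.trans ?_
      rw [Function.iterate_succ_apply', pow_succ', ← mul_assoc]
      generalize (shrink D)^[k] m = a
      gcongr
      rw [mul_div_assoc', le_div_iff₀ hD1]
      have : a * (D - 1) < (shrink D a + 1) * D := by
        unfold shrink
        exact Nat.lt_mul_of_div_lt (Nat.lt_succ_self _) (by omega)
      have h4 : ((a * (D - 1) : ℕ) : ℝ) ≤ (((shrink D a + 1) * D : ℕ) : ℝ) := by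
        exact_mod_cast this.le
      push_cast [Nat.cast_sub (show 1 ≤ D by omega)] at h4
      nlinarith
  have h5 := h3 (decay D m)
  rw [h1] at h5
  simp only [Nat.cast_zero, zero_add] at h5
  linarith

end


/-! ### Counting tuples -/

section Tuples

variable {A : Type*} [DecidableEq A]

theorem card_tuples_eq_mul_le {n : ℕ} (N : Finset A) (i : Fin n) (x : A) :
    ((Fintype.piFinset fun _ : Fin n => N).filter fun t => t i = x).card * N.card ≤ N.card ^ n := by
  have h := Finset.card_le_card_of_injOn
    (s := ((Fintype.piFinset fun _ : Fin n => N).filter fun t => t i = x) ×ˢ N)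
    (t := Fintype.piFinset fun _ : Fin n => N) (fun p => Function.update p.1 i p.2) ?_ ?_
  · simpa [Finset.card_product] using h
  · rintro ⟨t, y⟩ h
    simp only [Finset.coe_product, Set.mem_prod, Finset.mem_coe, Finset.mem_filter,
      Fintype.mem_piFinset] at h ⊢
    intro j
    by_cases hj : j = i
    · subst hj; simpa using h.2
    · simpa [hj] using h.1.1 j
  · rintro ⟨t, y⟩ h ⟨t', y'⟩ h' heq
    simp only [Finset.coe_product, Set.mem_prod, Finset.mem_coe, Finset.mem_filter] at h h' heq
    have hy : y = y' := by simpa using congrFun heq i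
    refine Prod.ext (funext fun j => ?_) hy
    by_cases hj : j = i
    · subst hj; exact h.1.2.trans h'.1.2.symm
    · simpa [hj] using congrFun heq j

theorem card_tuples_pair_mul_le {n : ℕ} (N : Finset A) {i j : Fin n} (hij : i ≠ j)
    (Q : Finset (A × A)) :
    ((Fintype.piFinset fun _ : Fin n => N).filter fun t => (t i, t j) ∈ Q).card * N.card ^ 2 ≤
      Q.card * N.card ^ n := by
  have hone : ∀ q ∈ Q, ((Fintype.piFinset fun _ : Fin n => N).filter
      fun t => (t i, t j) = q).card * N.card ^ 2 ≤ N.card ^ n := by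
    rintro ⟨x, y⟩ -
    have h := Finset.card_le_card_of_injOn
      (s := ((Fintype.piFinset fun _ : Fin n => N).filter fun t => (t i, t j) = (x, y)) ×ˢ (N ×ˢ N))
      (t := Fintype.piFinset fun _ : Fin n => N)
      (fun p => Function.update (Function.update p.1 i p.2.1) j p.2.2) ?_ ?_
    · simpa [Finset.card_product, sq] using h
    · rintro ⟨t, z, w⟩ h
      simp only [Finset.coe_product, Set.mem_prod, Finset.mem_coe, Finset.mem_filter,
        Fintype.mem_piFinset] at h ⊢
      intro k
      by_cases hj : k = j
      · subst hj; simpa using h.2.2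
      by_cases hi : k = i
      · subst hi; simpa [hj] using h.2.1
      · simpa [hj, hi] using h.1.1 k
    · rintro ⟨t, z, w⟩ h ⟨t', z', w'⟩ h' heq
      simp only [Finset.coe_product, Set.mem_prod, Finset.mem_coe, Finset.mem_filter,
        Prod.mk.injEq] at h h' heq
      have hw : w = w' := by simpa using congrFun heq j
      have hz : z = z' := by simpa [hij] using congrFun heq i
      refine Prod.ext (funext fun k => ?_) (Prod.ext hz hw)
      by_cases hj : k = j
      · subst hj; exact h.1.2.2.trans h'.1.2.2.symm
      by_cases hi : k = i
      · subst hi; exact h.1.2.1.trans h'.1.2.1.symm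
      · simpa [hj, hi] using congrFun heq k
  calc _ = (∑ q ∈ Q, ((Fintype.piFinset fun _ : Fin n => N).filter
          fun t => (t i, t j) = q).card) * N.card ^ 2 := by
        congr 1
        rw [Finset.card_eq_sum_card_fiberwise (f := fun t => (t i, t j)) (t := Q)]
        · refine Finset.sum_congr rfl fun q hq => congrArg Finset.card ?_
          ext t
          simp only [Finset.mem_filter]
          constructor
          · rintro ⟨⟨h1, -⟩, h3⟩; exact ⟨h1, h3⟩
          · rintro ⟨h1, h3⟩; exact ⟨⟨h1, h3 ▸ hq⟩, h3⟩
        · intro t ht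
          exact (Finset.mem_filter.1 ht).2
    _ ≤ Q.card * N.card ^ n := by
        rw [Finset.sum_mul]
        exact (Finset.sum_le_sum hone).trans (by simp)

theorem sum_tuples_mul_le {n : ℕ} (N : Finset A) (i : Fin n) (f : A → ℕ) :
    (∑ t ∈ Fintype.piFinset fun _ : Fin n => N, f (t i)) * N.card ≤
      N.card ^ n * ∑ a ∈ N, f a := by
  have h : ∑ t ∈ Fintype.piFinset fun _ : Fin n => N, f (t i) =
      ∑ a ∈ N, ((Fintype.piFinset fun _ : Fin n => N).filter fun t => t i = a).card * f a := by
    rw [← Finset.sum_fiberwise_of_maps_to (t := N) (g := fun t : Fin n → A => t i)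
      fun t ht => Fintype.mem_piFinset.1 ht i]
    refine Finset.sum_congr rfl fun a _ => ?_
    rw [Finset.sum_congr rfl (g := fun _ => f a) fun t ht => by rw [(Finset.mem_filter.1 ht).2],
      Finset.sum_const, smul_eq_mul]
  rw [h, Finset.sum_mul, Finset.mul_sum]
  refine Finset.sum_le_sum fun a _ => ?_
  calc _ = (((Fintype.piFinset fun _ : Fin n => N).filter fun t => t i = a).card * N.card) * f a := by
        ring
    _ ≤ _ := by gcongr; exact card_tuples_eq_mul_le N i a

end Tuples

/-! ### Soundness of the reduction -/

section Soundness

variable {A B Λ : Type*} [Fintype B]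

/-- In a game whose labelings cover at most a fraction `1 / K` of the edges, two labelings of `A`
rarely give the same label at `b` from two random neighbors of `b`: otherwise, label `b` by the most
popular label that the second labeling suggests. -/
theorem sum_card_agree_mul_le (N : B → Finset A) {d : ℕ} (hN : ∀ b, (N b).card = d) (hd : 0 < d)
    (lab : A → B → Λ → ℕ) {K : ℝ} (hK : 0 ≤ K)
    (hsound : ∀ (σ : A → Λ) (τ : B → ℕ),
      (∑ b, ((N b).filter fun a => lab a b (σ a) = τ b).card : ℕ) * K ≤ Fintype.card B * d)
    (σ σ' : A → Λ) :
    (∑ b, ((N b ×ˢ N b).filter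
      fun q => lab q.1 b (σ q.1) = lab q.2 b (σ' q.2)).card : ℕ) * K ≤
        Fintype.card B * d ^ 2 := by
  have hmax : ∀ b, ∃ a' ∈ N b, ∀ a'' ∈ N b,
      ((N b).filter fun a => lab a b (σ a) = lab a'' b (σ' a'')).card ≤
        ((N b).filter fun a => lab a b (σ a) = lab a' b (σ' a')).card := fun b =>
    Finset.exists_max_image (N b) _ (Finset.card_pos.1 (by rw [hN]; exact hd))
  choose w hw hmax using hmax
  have h1 : ∑ b, ((N b ×ˢ N b).filter
      fun q => lab q.1 b (σ q.1) = lab q.2 b (σ' q.2)).card ≤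
      d * ∑ b, ((N b).filter fun a => lab a b (σ a) = lab (w b) b (σ' (w b))).card := by
    rw [Finset.mul_sum]
    refine Finset.sum_le_sum fun b _ => ?_
    rw [Finset.card_filter, Finset.sum_product_right]
    simp only [← Finset.card_filter]
    refine (Finset.sum_le_sum fun a' ha' => hmax b a' ha').trans ?_
    simp [hN]
  have h2 := hsound σ fun b => lab (w b) b (σ' (w b))
  calc _ ≤ ((d * ∑ b, ((N b).filter
        fun a => lab a b (σ a) = lab (w b) b (σ' (w b))).card : ℕ) : ℝ) * K := by gcongr
    _ = d * ((∑ b, ((N b).filter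
        fun a => lab a b (σ a) = lab (w b) b (σ' (w b))).card : ℕ) * K) := by push_cast; ring
    _ ≤ d * (Fintype.card B * d) := by gcongr
    _ = _ := by ring

theorem support_map_range (D s : ℕ) (f : ℕ → ℕ) :
    support D ((List.range s).map f) = ((Finset.range s).filter fun v => f v < D).card := by
  induction s with
  | zero => simp [support]
  | succ s ih =>
    rw [List.range_succ, List.map_append, support_append, ih, Finset.range_add_one,
      Finset.filter_insert]
    by_cases h : f s < D <;> simp [support, h]

/-- At a tuple of vertices whose lists of labels are short and never agree, the point selected by a
suitable word of a hitting family stays uncovered. -/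
theorem lt_sum_card_of_covered {D s T : ℕ} {L : List (List ℕ)} (hL : IsHitting D s T L)
    (lists : Fin D → Finset Λ) (lab : Fin D → Λ → ℕ) (hlab : ∀ i, ∀ σ ∈ lists i, lab i σ < s)
    (hdisj : (∑ i, (lists i).card ≤ T) → ∀ i j, i ≠ j → ∀ σ ∈ lists i, ∀ σ' ∈ lists j,
      lab i σ ≠ lab j σ')
    (hcover : ∀ e ∈ L, ∃ i, ∃ σ ∈ lists i, e.getD (lab i σ) 0 = i) :
    T < ∑ i, (lists i).card := by
  by_contra hT
  rw [not_lt] at hT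
  have hdisj := hdisj hT
  classical
  let c : ℕ → ℕ := fun v => if h : ∃ i, ∃ σ ∈ lists i, lab i σ = v then (h.choose : ℕ) else D
  have hc : ∀ i, ∀ σ ∈ lists i, c (lab i σ) = i := by
    intro i σ hσ
    have hex : ∃ i', ∃ σ' ∈ lists i', lab i' σ' = lab i σ := ⟨i, σ, hσ, rfl⟩
    obtain ⟨σ', hσ', heq⟩ := hex.choose_spec
    have : hex.choose = i := by
      by_contra hne
      exact hdisj _ _ hne σ' hσ' σ hσ heq
    simp only [c, dif_pos hex, this]
  have hcon : IsConstraint D s T ((List.range s).map c) := by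
    refine ⟨by simp, ?_, ?_⟩
    · intro a ha
      obtain ⟨v, -, rfl⟩ := List.mem_map.1 ha
      simp only [c]
      split_ifs with h
      · exact h.choose.2.le
      · exact le_rfl
    · rw [support_map_range]
      refine le_trans (Finset.card_le_card (t := Finset.univ.biUnion
        fun i => (lists i).image (lab i)) ?_) ((Finset.card_biUnion_le.trans
          (Finset.sum_le_sum fun i _ => Finset.card_image_le)).trans hT)
      intro v hv
      obtain ⟨-, hv⟩ := Finset.mem_filter.1 hv
      simp only [c] at hv
      split_ifs at hv with h
      · obtain ⟨i, σ, hσ, rfl⟩ := h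
        exact Finset.mem_biUnion.2 ⟨i, Finset.mem_univ _, Finset.mem_image_of_mem _ hσ⟩
      · omega
  obtain ⟨e, he, hav⟩ := hL.exists_avoids _ hcon
  obtain ⟨i, σ, hσ, heq⟩ := hcover e he
  have hv := hlab i σ hσ
  refine avoids_iff.1 hav (lab i σ) (by rwa [hL.length_eq e he]) ?_
  rw [heq, ← hc i σ hσ, List.getD_eq_getElem _ _ (by simpa using hv)]
  simp

theorem exists_enumeration [Nonempty Λ] {T : ℕ} (l : Finset Λ) (h : l.card ≤ T) :
    ∃ f : Fin T → Λ, ∀ σ ∈ l, ∃ i, f i = σ := by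
  classical
  refine ⟨fun i => l.toList.getD i (Classical.arbitrary Λ), fun σ hσ => ?_⟩
  obtain ⟨i, hi, rfl⟩ := List.mem_iff_getElem.1 (Finset.mem_toList.2 hσ)
  have hi' : i < T := by rw [Finset.length_toList] at hi; omega
  exact ⟨⟨i, hi'⟩, List.getD_eq_getElem _ _ hi⟩

/-- If every labeling covers at most a fraction `1 / K` of the edges, then every set cover is almost
as large as `|A| * (T + 1) / D`. -/
theorem card_cover_lower_bound [Fintype A] [DecidableEq A] [Nonempty Λ] {D s T : ℕ} {L : List (List ℕ)}
    (hL : IsHitting D s T L) (N : B → Finset A) {dA dB : ℕ} (hB : ∀ b, (N b).card = dB)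
    (hA : ∀ a, (Finset.univ.filter fun b => a ∈ N b).card = dA) (hdB : 0 < dB) [Nonempty B]
    (lab : A → B → Λ → ℕ) (hlab : ∀ b, ∀ a ∈ N b, ∀ σ, lab a b σ < s) {K : ℝ} (hK : 0 < K)
    (hsound : ∀ (σ : A → Λ) (τ : B → ℕ),
      (∑ b, ((N b).filter fun a => lab a b (σ a) = τ b).card : ℕ) * K ≤ Fintype.card B * dB)
    (S : Finset (A × Λ))
    (hS : ∀ (b : B) (t : Fin D → A), (∀ i, t i ∈ N b) → ∀ e ∈ L,
      ∃ i σ, (t i, σ) ∈ S ∧ e.getD (lab (t i) b σ) 0 = i) :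
    (T + 1) * (Fintype.card A * (1 - D ^ 2 * T ^ 2 / K)) ≤ D * S.card := by
  classical
  let l : A → Finset Λ := fun a => (S.filter fun p => p.1 = a).image Prod.snd
  have hl : ∀ a σ, σ ∈ l a ↔ (a, σ) ∈ S := by
    intro a σ
    simp only [l, Finset.mem_image, Finset.mem_filter]
    constructor
    · rintro ⟨⟨a', σ'⟩, ⟨h1, rfl⟩, rfl⟩; exact h1
    · intro h; exact ⟨(a, σ), ⟨h, rfl⟩, rfl⟩
  have hsumS : ∑ a, (l a).card ≤ S.card := by
    rw [Finset.card_eq_sum_card_fiberwise (f := Prod.fst) (t := Finset.univ) (s := S) (by simp)]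
    exact Finset.sum_le_sum fun a _ => Finset.card_image_le
  have henum : ∀ a, ∃ f : Fin T → Λ, (l a).card ≤ T → ∀ σ ∈ l a, ∃ i, f i = σ := by
    intro a
    by_cases h : (l a).card ≤ T
    · obtain ⟨f, hf⟩ := exists_enumeration (l a) h
      exact ⟨f, fun _ => hf⟩
    · exact ⟨fun _ => Classical.arbitrary Λ, fun h' => absurd h' h⟩
  choose enum henum using henum
  -- pairs of neighbors of `b` with short lists that agree on some label of `b`
  let Q : B → Finset (A × A) := fun b => (N b ×ˢ N b).filter fun q =>
    (l q.1).card ≤ T ∧ (l q.2).card ≤ T ∧ ∃ σ ∈ l q.1, ∃ σ' ∈ l q.2, lab q.1 b σ = lab q.2 b σ'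
  have hQ : (∑ b, (Q b).card : ℕ) * K ≤ T ^ 2 * (Fintype.card B * dB ^ 2) := by
    have h1 : ∑ b, (Q b).card ≤ ∑ ij : Fin T × Fin T, ∑ b, ((N b ×ˢ N b).filter
        fun q => lab q.1 b (enum q.1 ij.1) = lab q.2 b (enum q.2 ij.2)).card := by
      rw [Finset.sum_comm]
      refine Finset.sum_le_sum fun b _ => ?_
      refine le_trans (Finset.card_le_card ?_) Finset.card_biUnion_le
      intro q hq
      obtain ⟨hq1, h1, h2, σ, hσ, σ', hσ', heq⟩ := Finset.mem_filter.1 hq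
      obtain ⟨i, rfl⟩ := henum _ h1 σ hσ
      obtain ⟨j, rfl⟩ := henum _ h2 σ' hσ'
      exact Finset.mem_biUnion.2 ⟨(i, j), Finset.mem_univ _, Finset.mem_filter.2 ⟨hq1, heq⟩⟩
    calc _ ≤ ((∑ ij : Fin T × Fin T, ∑ b, ((N b ×ˢ N b).filter
          fun q => lab q.1 b (enum q.1 ij.1) = lab q.2 b (enum q.2 ij.2)).card : ℕ) : ℝ) * K := by
          gcongr
      _ = ∑ ij : Fin T × Fin T, ((∑ b, ((N b ×ˢ N b).filter
          fun q => lab q.1 b (enum q.1 ij.1) = lab q.2 b (enum q.2 ij.2)).card : ℕ) : ℝ) * K := by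
          rw [Nat.cast_sum, Finset.sum_mul]
      _ ≤ ∑ ij : Fin T × Fin T, (Fintype.card B * dB ^ 2 : ℝ) := by
          refine Finset.sum_le_sum fun ij _ => ?_
          exact sum_card_agree_mul_le N hB hdB lab hK.le hsound (fun a => enum a ij.1)
            fun a => enum a ij.2
      _ = _ := by simp [sq]
  let P : B → Finset (Fin D → A) := fun b => Fintype.piFinset fun _ => N b
  have hP : ∀ b, (P b).card = dB ^ D := fun b => by simp [P, hB]
  let bad : B → Finset (Fin D → A) := fun b =>
    (P b).filter fun t => ∃ i j, i ≠ j ∧ (t i, t j) ∈ Q b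
  have hbad : ∀ b, (bad b).card * dB ^ 2 ≤ D ^ 2 * ((Q b).card * dB ^ D) := by
    intro b
    have h1 : (bad b).card ≤ ∑ ij ∈ (Finset.univ : Finset (Fin D × Fin D)).filter
        (fun ij => ij.1 ≠ ij.2), ((P b).filter fun t => (t ij.1, t ij.2) ∈ Q b).card := by
      refine le_trans (Finset.card_le_card ?_) Finset.card_biUnion_le
      intro t ht
      obtain ⟨h1, i, j, hij, h2⟩ := Finset.mem_filter.1 ht
      exact Finset.mem_biUnion.2 ⟨(i, j), by simpa using hij, Finset.mem_filter.2 ⟨h1, h2⟩⟩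
    calc (bad b).card * dB ^ 2 ≤ (∑ ij ∈ (Finset.univ : Finset (Fin D × Fin D)).filter
          (fun ij => ij.1 ≠ ij.2), ((P b).filter fun t => (t ij.1, t ij.2) ∈ Q b).card) *
            dB ^ 2 := by gcongr
      _ ≤ ∑ ij ∈ (Finset.univ : Finset (Fin D × Fin D)).filter
          (fun ij => ij.1 ≠ ij.2), (Q b).card * dB ^ D := by
          rw [Finset.sum_mul]
          refine Finset.sum_le_sum fun ij hij => ?_
          have := card_tuples_pair_mul_le (N b) (Finset.mem_filter.1 hij).2 (Q b)
          rwa [hB] at this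
      _ ≤ ∑ ij : Fin D × Fin D, (Q b).card * dB ^ D :=
          Finset.sum_le_sum_of_subset (Finset.filter_subset _ _)
      _ = _ := by simp [sq]
  have hgood : ∀ b, ∀ t ∈ P b, t ∉ bad b → T + 1 ≤ ∑ i, (l (t i)).card := by
    intro b t ht htbad
    have htN : ∀ i, t i ∈ N b := fun i => Fintype.mem_piFinset.1 ht i
    refine lt_sum_card_of_covered hL (fun i => l (t i)) (fun i => lab (t i) b)
      (fun i σ _ => hlab b _ (htN i) σ) ?_ ?_
    · intro hT i j hij σ hσ σ' hσ' heq
      have hle : ∀ i, (l (t i)).card ≤ T := fun i =>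
        (Finset.single_le_sum (f := fun i => (l (t i)).card) (fun _ _ => Nat.zero_le _)
          (Finset.mem_univ i)).trans hT
      exact htbad (Finset.mem_filter.2 ⟨ht, i, j, hij, Finset.mem_filter.2
        ⟨Finset.mem_product.2 ⟨htN i, htN j⟩, hle i, hle j, σ, hσ, σ', hσ', heq⟩⟩)
    · intro e he
      obtain ⟨i, σ, h1, h2⟩ := hS b t htN e he
      exact ⟨i, σ, (hl _ _).2 h1, h2⟩
  have hupper : (∑ b, ∑ t ∈ P b, ∑ i, (l (t i)).card) * dB ≤ D * dB ^ D * (dA * S.card) := by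
    have h1 : ∀ b, (∑ t ∈ P b, ∑ i, (l (t i)).card) * dB ≤
        D * (dB ^ D * ∑ a ∈ N b, (l a).card) := by
      intro b
      rw [Finset.sum_comm, Finset.sum_mul]
      have h3 : ∀ i : Fin D, (∑ t ∈ P b, (l (t i)).card) * dB ≤
          dB ^ D * ∑ a ∈ N b, (l a).card := fun i => by
        have := sum_tuples_mul_le (N b) i fun a => (l a).card
        rwa [hB] at this
      exact (Finset.sum_le_sum fun i _ => h3 i).trans (by simp)
    have h2 : ∑ b, ∑ a ∈ N b, (l a).card = dA * ∑ a, (l a).card := by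
      rw [Finset.sum_comm' (t' := Finset.univ) (s' := fun a => Finset.univ.filter fun b => a ∈ N b)
        (by simp), Finset.mul_sum]
      refine Finset.sum_congr rfl fun a _ => ?_
      rw [Finset.sum_const, hA, smul_eq_mul]
    calc _ ≤ ∑ b, D * (dB ^ D * ∑ a ∈ N b, (l a).card) := by
          rw [Finset.sum_mul]; exact Finset.sum_le_sum fun b _ => h1 b
      _ = D * dB ^ D * (dA * ∑ a, (l a).card) := by
          rw [← h2, ← Finset.mul_sum, ← Finset.mul_sum]; ring
      _ ≤ _ := by gcongr
  have hlower : (T + 1) * (Fintype.card B * dB ^ D) ≤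
      (∑ b, ∑ t ∈ P b, ∑ i, (l (t i)).card) + (T + 1) * ∑ b, (bad b).card := by
    have h1 : ∀ b, (T + 1) * dB ^ D ≤
        (∑ t ∈ P b, ∑ i, (l (t i)).card) + (T + 1) * (bad b).card := by
      intro b
      have h2 : (P b).card = (bad b).card + ((P b).filter fun t => t ∉ bad b).card := by
        rw [← Finset.card_filter_add_card_filter_not (s := P b) (fun t => t ∈ bad b)]
        congr 2
        ext t
        simp only [Finset.mem_filter, bad]
        tauto
      have h3 : ((P b).filter fun t => t ∉ bad b).card * (T + 1) ≤
          ∑ t ∈ P b, ∑ i, (l (t i)).card := by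
        refine le_trans ?_ (Finset.sum_le_sum_of_subset (Finset.filter_subset
          (fun t => t ∉ bad b) (P b)))
        rw [← smul_eq_mul]
        refine Finset.card_nsmul_le_sum _ _ _ fun t ht => ?_
        obtain ⟨h3, h4⟩ := Finset.mem_filter.1 ht
        exact hgood b t h3 h4
      rw [← hP b, h2]
      linarith
    calc _ = ∑ b : B, (T + 1) * dB ^ D := by simp; ring
      _ ≤ _ := (Finset.sum_le_sum fun b _ => h1 b).trans (by
        rw [Finset.sum_add_distrib, Finset.mul_sum])
  have hcount : Fintype.card A * dA = Fintype.card B * dB := by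
    have h1 : ∑ a : A, (Finset.univ.filter fun b => a ∈ N b).card = ∑ b, (N b).card := by
      have := Finset.sum_card_bipartiteAbove_eq_sum_card_bipartiteBelow (s := Finset.univ)
        (t := Finset.univ) (fun (a : A) (b : B) => a ∈ N b)
      simpa [Finset.bipartiteAbove, Finset.bipartiteBelow] using this
    simpa [hA, hB] using h1
  have hBpos : 0 < Fintype.card B := Fintype.card_pos
  have hdA : 0 < dA := Nat.pos_of_mul_pos_left (hcount ▸ Nat.mul_pos hBpos hdB)
  -- the rest is arithmetic with the quantities just estimated
  have hbadsum : (∑ b, (bad b).card : ℕ) * K ≤ D ^ 2 * T ^ 2 * (Fintype.card B * dB ^ D) := by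
    have h1 : (∑ b, (bad b).card) * dB ^ 2 ≤ D ^ 2 * dB ^ D * ∑ b, (Q b).card := by
      rw [Finset.sum_mul, Finset.mul_sum]
      exact Finset.sum_le_sum fun b _ => (hbad b).trans (by ring_nf; rfl)
    have h2 : ((∑ b, (bad b).card : ℕ) : ℝ) * dB ^ 2 ≤ D ^ 2 * dB ^ D * (∑ b, (Q b).card : ℕ) := by
      exact_mod_cast h1
    have hdB' : (0 : ℝ) < dB ^ 2 := by positivity
    refine le_of_mul_le_mul_right ?_ hdB'
    calc _ = (((∑ b, (bad b).card : ℕ) : ℝ) * dB ^ 2) * K := by ring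
      _ ≤ (D ^ 2 * dB ^ D * (∑ b, (Q b).card : ℕ)) * K := by gcongr
      _ = D ^ 2 * dB ^ D * ((∑ b, (Q b).card : ℕ) * K) := by ring
      _ ≤ D ^ 2 * dB ^ D * (T ^ 2 * (Fintype.card B * dB ^ 2)) := by gcongr
      _ = _ := by ring
  have hbad' : ((∑ b, (bad b).card : ℕ) : ℝ) ≤
      D ^ 2 * T ^ 2 / K * (Fintype.card B * dB ^ D) := by
    rw [div_mul_eq_mul_div, le_div_iff₀ hK]; exact hbadsum
  have hlower' : ((T : ℝ) + 1) * (Fintype.card B * dB ^ D) ≤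
      ((∑ b, ∑ t ∈ P b, ∑ i, (l (t i)).card : ℕ) : ℝ) + (T + 1) * (∑ b, (bad b).card : ℕ) := by
    exact_mod_cast hlower
  have hupper' : ((∑ b, ∑ t ∈ P b, ∑ i, (l (t i)).card : ℕ) : ℝ) * dB ≤
      D * dB ^ D * (dA * S.card) := by exact_mod_cast hupper
  have hcount' : (Fintype.card A : ℝ) * dA = Fintype.card B * dB := by exact_mod_cast hcount
  set β : ℝ := D ^ 2 * T ^ 2 / K
  have hpos : (0 : ℝ) < dB ^ D * dA := by positivity
  refine le_of_mul_le_mul_right ?_ hpos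
  calc (T + 1) * (Fintype.card A * (1 - β)) * (dB ^ D * dA : ℝ) =
        (T + 1) * ((Fintype.card A * dA) * dB ^ D) * (1 - β) := by ring
    _ = ((T + 1) * (Fintype.card B * dB ^ D) -
          (T + 1) * (β * (Fintype.card B * dB ^ D))) * dB := by rw [hcount']; ring
    _ ≤ ((T + 1) * (Fintype.card B * dB ^ D) - (T + 1) * (∑ b, (bad b).card : ℕ)) * dB := by
        gcongr
    _ ≤ ((∑ b, ∑ t ∈ P b, ∑ i, (l (t i)).card : ℕ) : ℝ) * dB := by
        gcongr; linarith
    _ ≤ D * dB ^ D * (dA * S.card) := hupper'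
    _ = _ := by ring

end Soundness


/-! ### The representation of formulas, games and set systems -/

section

variable {α β γ : Type} [TreeEncodable α] [TreeEncodable β] [TreeEncodable γ]

theorem PolyTime.congr_enc {f : α → β} {g : α → γ} (hg : PolyTime g)
    (h : ∀ a, enc (f a) = enc (g a)) : PolyTime f :=
  let ⟨p, P, hp⟩ := hg
  ⟨p, P, fun a => by rw [h]; exact hp a⟩

theorem enc_map_eq {l : List α} {f : α → β} (h : ∀ a, enc (f a) = enc a) :
    enc (l.map f) = enc l := by
  induction l with
  | nil => rfl
  | cons a l ih => rw [List.map_cons, enc_cons, enc_cons, ih, h]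

theorem Prog.exists_decide_eq (c : BinTree) : ∃ p : Prog, ∃ k : ℕ, ∀ x, ∃ b : Bool,
    (b = true ↔ x = c) ∧ ∃ t ≤ k * x.size, p.Runs x (enc b) t := by
  induction c with
  | leaf =>
    refine ⟨.cond .id .leaf (.pair .leaf .leaf), 5, fun x => ?_⟩
    cases x with
    | leaf =>
      exact ⟨true, by simp, _, by simp [BinTree.size],
        .cond_leaf (.id _) (.pair (.leaf _) (.leaf _))⟩
    | node l r =>
      exact ⟨false, by simp, _, by omega, .cond_node (.id _) (.leaf _)⟩
  | node l r hl hr =>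
    obtain ⟨p, k, hp⟩ := hl
    obtain ⟨q, m, hq⟩ := hr
    refine ⟨.cond .id (.cond (.seq .left p) (.seq .right q) .leaf) .leaf, k + m + 6, fun x => ?_⟩
    cases x with
    | leaf =>
      exact ⟨false, by simp, _, by simp [BinTree.size], .cond_leaf (.id _) (.leaf _)⟩
    | node y z =>
      obtain ⟨b, hb, s, hs, hs'⟩ := hp y
      obtain ⟨b', hb', t, ht, ht'⟩ := hq z
      have h1 : k * y.size ≤ k * (BinTree.node y z).size := by
        gcongr; simp only [BinTree.size]; omega
      have h2 : m * z.size ≤ m * (BinTree.node y z).size := by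
        gcongr; simp only [BinTree.size]; omega
      have h3 : (k + m + 6) * (BinTree.node y z).size = k * (BinTree.node y z).size +
        m * (BinTree.node y z).size + 6 * (BinTree.node y z).size := by ring
      cases b with
      | false =>
        exact ⟨false, by simp only [BinTree.node.injEq, ← hb, ← hb']; simp, _, by omega,
          .cond_node (.id _) (.cond_leaf (.seq (.left _) hs') (.leaf _))⟩
      | true =>
        exact ⟨b', by simp only [BinTree.node.injEq, ← hb, ← hb']; simp, _, by omega,
          .cond_node (.id _) (.cond_node (.seq (.left _) hs') (.seq (.right _) ht'))⟩

/-- Membership in a finite set is decided by comparison with its elements. -/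
theorem PolyTime.exists_decide_mem {s : Set α} (hs : s.Finite) :
    ∃ m : α → Bool, PolyTime m ∧ ∀ a, m a = true ↔ a ∈ s := by
  classical
  induction s, hs using Set.Finite.induction_on with
  | empty => exact ⟨fun _ => false, .const _, by simp⟩
  | @insert c s _ _ ih =>
    obtain ⟨m, hm, hms⟩ := ih
    have hc : PolyTime (fun a => decide (a = c)) := by
      obtain ⟨p, k, hp⟩ := Prog.exists_decide_eq (enc c)
      refine .of_bounded p (fun a => k * encSize a) (.mul (.const k) .encSize) fun a => ?_
      obtain ⟨b, hb, h⟩ := hp (enc a)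
      have : b = decide (a = c) := by
        rw [Bool.eq_iff_iff, hb, decide_eq_true_iff, enc_injective.eq_iff]
      rwa [this] at h
    refine ⟨fun a => bif decide (a = c) then true else m a, .cond hc (.const _) hm, fun a => ?_⟩
    by_cases h : a = c <;> simp [h, hms]

@[fun_prop]
theorem PolyTime.option_isSome {f : α → Option β} (hf : PolyTime f) :
    PolyTime (fun a => (f a).isSome) := by
  refine PolyTime.comp (g := fun o : Option β => o.isSome) ?_ hf
  refine .of_bounded (.cond .id (.pair .leaf .leaf) .leaf) (fun a => 5 * encSize a)
    (.mul (.const 5) .encSize) fun o => ?_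
  cases o with
  | none => exact ⟨_, by simp only [encSize]; omega, .cond_leaf (.id _) (.leaf _)⟩
  | some b =>
    refine ⟨_, ?_, .cond_node (.id _) (.pair (.leaf _) (.leaf _))⟩
    simp only [encSize]
    omega

@[fun_prop]
theorem PolyTime.option_getD {f : α → Option β} (hf : PolyTime f) (b : β) :
    PolyTime (fun a => (f a).getD b) := by
  refine PolyTime.comp (g := fun o : Option β => o.getD b) ?_ hf
  obtain ⟨p, k, hp⟩ := Prog.exists_const (enc b)
  refine .of_bounded (.cond .id .right p) (fun a => (k + 3) * encSize a)
    (.mul (.const _) .encSize) fun o => ?_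
  have hk : (k + 3) * encSize o = k * encSize o + 3 * encSize o := by ring
  cases o with
  | none =>
    obtain ⟨t, ht, hr⟩ := hp (enc (none : Option β))
    refine ⟨_, ?_, .cond_leaf (.id _) hr⟩
    simp only [encSize] at *
    omega
  | some c =>
    refine ⟨_, ?_, .cond_node (.id _) (.right _)⟩
    simp only [encSize] at *
    omega

end

theorem PolyTime.cnf_vars : PolyTime (fun φ : CNF3 => φ.vars) :=
  .of_bounded .left encSize .encSize fun _ => ⟨_, le_rfl, .left _⟩

theorem PolyTime.cnf_size : PolyTime (fun φ : CNF3 => φ.size) := by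
  have h : PolyTime (fun φ : CNF3 => φ.clauses.map fun c =>
      List.ofFn fun j => ((c j).1.val, (c j).2)) := by
    refine .of_bounded .right encSize .encSize fun φ => ⟨_, le_rfl, ?_⟩
    have h1 : enc (φ.clauses.map fun c => List.ofFn fun j => ((c j).1.val, (c j).2)) =
        enc φ.clauses := by
      refine enc_map_eq fun c => ?_
      have h2 := enc_map_eq (l := List.ofFn c) (f := fun x => (x.1.val, x.2)) fun _ => rfl
      rw [List.map_ofFn] at h2
      exact h2
    rw [h1]
    exact .right _
  have := PolyTime.cnf_vars.add h.length
  simpa [CNF3.size] using this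

theorem finite_cnf_size_lt (n : ℕ) : {φ : CNF3 | φ.size < n}.Finite := by
  have h : {φ : CNF3 | φ.size < n} ⊆ ⋃ v ∈ Set.Iio n, (fun l => (⟨v, l⟩ : CNF3)) ''
      {l | l.length < n} := by
    rintro ⟨v, l⟩ hφ
    simp only [CNF3.size, Set.mem_ofPred_eq] at hφ
    simp only [Set.mem_iUnion]
    exact ⟨v, by simp; omega, l, by simp; omega, rfl⟩
  exact ((Set.finite_Iio n).biUnion fun v _ => (List.finite_length_lt _ n).image _).subset h

namespace ProjectionGame

/-- The projections of a game as a table: the entry at position `b` of row `a` belongs to the pair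
`(a, b)`. -/
def table (G : ProjectionGame) : List (List (Option (List ℕ))) :=
  List.ofFn fun a => List.ofFn fun b => (G.proj a b).map fun π => List.ofFn fun σ => (π σ).val

/-- Whether `(a, b)` is an edge. -/
def isEdge (G : ProjectionGame) (a b : ℕ) : Bool := ((G.table.getD a []).getD b none).isSome

/-- The label of `b` that corresponds to the label `σ` of `a` (zero outside of the ranges of these
parameters). -/
def label (G : ProjectionGame) (a b σ : ℕ) : ℕ :=
  (((G.table.getD a []).getD b none).getD []).getD σ 0

theorem table_getD (G : ProjectionGame) (a : Fin G.nA) (b : Fin G.nB) :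
    (G.table.getD a []).getD b none =
      (G.proj a b).map fun π => List.ofFn fun σ => (π σ).val := by
  simp [table, List.getD_eq_getElem?_getD]

theorem isEdge_eq (G : ProjectionGame) (a : Fin G.nA) (b : Fin G.nB) :
    G.isEdge a b = (G.proj a b).isSome := by
  rw [isEdge, table_getD, Option.isSome_map]

theorem label_eq (G : ProjectionGame) {a : Fin G.nA} {b : Fin G.nB} {π : Fin G.sA → Fin G.sB}
    (h : G.proj a b = some π) (σ : Fin G.sA) : G.label a b σ = π σ := by
  rw [label, table_getD, h]
  simp [List.getD_eq_getElem?_getD]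

end ProjectionGame

section

variable {α : Type} [TreeEncodable α]

theorem PolyTime.game_nums : PolyTime (fun G : ProjectionGame => ((G.nA, G.nB), (G.sA, G.sB))) :=
  .of_bounded .left encSize .encSize fun _ => ⟨_, le_rfl, .left _⟩

@[fun_prop]
theorem PolyTime.game_nA : PolyTime (fun G : ProjectionGame => G.nA) := game_nums.fst.fst

@[fun_prop]
theorem PolyTime.game_nB : PolyTime (fun G : ProjectionGame => G.nB) := game_nums.fst.snd

@[fun_prop]
theorem PolyTime.game_sA : PolyTime (fun G : ProjectionGame => G.sA) := game_nums.snd.fst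

@[fun_prop]
theorem PolyTime.game_sB : PolyTime (fun G : ProjectionGame => G.sB) := game_nums.snd.snd

@[fun_prop]
theorem PolyTime.game_table : PolyTime ProjectionGame.table := by
  refine .of_bounded .right encSize .encSize fun G => ⟨_, le_rfl, ?_⟩
  have h1 : ∀ {n m : ℕ} (π : Fin n → Fin m), enc (List.ofFn fun σ => (π σ).val) = enc π := by
    intro n m π
    have := enc_map_eq (l := List.ofFn π) (f := fun i => i.val) fun _ => rfl
    rw [List.map_ofFn] at this
    exact this
  have h2 : ∀ {n m : ℕ} (o : Option (Fin n → Fin m)),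
      enc (o.map fun π => List.ofFn fun σ => (π σ).val) = enc o := by
    intro n m o
    cases o with
    | none => rfl
    | some π => exact congrArg (BinTree.node .leaf) (h1 π)
  have h3 : ∀ {k n m : ℕ} (g : Fin k → Option (Fin n → Fin m)),
      enc (List.ofFn fun b => (g b).map fun π => List.ofFn fun σ => (π σ).val) = enc g := by
    intro k n m g
    have := enc_map_eq (l := List.ofFn g) (f := fun o => o.map fun π => List.ofFn fun σ =>
      (π σ).val) h2
    rw [List.map_ofFn] at this
    exact this
  have h4 : enc G.table = enc G.proj := by
    have := enc_map_eq (l := List.ofFn G.proj) (f := fun g => List.ofFn fun b =>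
      (g b).map fun π => List.ofFn fun σ => (π σ).val) h3
    rw [List.map_ofFn] at this
    exact this
  rw [h4]
  exact .right _

@[fun_prop]
theorem PolyTime.game_isEdge {G : α → ProjectionGame} {a b : α → ℕ} (hG : PolyTime G)
    (ha : PolyTime a) (hb : PolyTime b) : PolyTime (fun x => (G x).isEdge (a x) (b x)) := by
  unfold ProjectionGame.isEdge
  fun_prop

@[fun_prop]
theorem PolyTime.game_label {G : α → ProjectionGame} {a b σ : α → ℕ} (hG : PolyTime G)
    (ha : PolyTime a) (hb : PolyTime b) (hσ : PolyTime σ) :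
    PolyTime (fun x => (G x).label (a x) (b x) (σ x)) := by
  unfold ProjectionGame.label
  fun_prop

end

/-- The set system with the given lists of sets and elements and the given incidence relation. -/
def SetCover.ofLists {ι κ : Type} (sets : List ι) (elems : List κ) (R : ι → κ → Bool) :
    SetCover where
  N := elems.length
  m := sets.length
  mem i j := R (sets.get i) (elems.get j)

theorem ofFn_comp_get {α β : Type} (l : List α) (f : α → β) :
    (List.ofFn fun i => f (l.get i)) = l.map f := by
  conv_rhs => rw [← List.ofFn_get l, List.map_ofFn]
  rfl

theorem PolyTime.setCover_ofLists {α ι κ : Type} [TreeEncodable α] [TreeEncodable ι]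
    [TreeEncodable κ] {sets : α → List ι} {elems : α → List κ} {R : α → ι → κ → Bool}
    (hs : PolyTime sets) (he : PolyTime elems)
    (hR : PolyTime (fun y : (α × ι) × κ => R y.1.1 y.1.2 y.2)) :
    PolyTime (fun a => SetCover.ofLists (sets a) (elems a) (R a)) := by
  have hraw : PolyTime (fun a => (((elems a).length, (sets a).length),
      (sets a).map fun i => (elems a).map fun j => R a i j)) :=
    .prodMk (by fun_prop) (.map hs (.map (by fun_prop) hR))
  refine hraw.congr_enc fun a => ?_
  have h1 : ∀ i, (List.ofFn fun j => R a i ((elems a).get j)) =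
      (elems a).map fun j => R a i j := fun i => ofFn_comp_get _ _
  have h2 : enc (fun i j => R a ((sets a).get i) ((elems a).get j)) =
      enc ((sets a).map fun i => (elems a).map fun j => R a i j) := by
    have h3 := enc_map_eq (l := List.ofFn fun i : Fin (sets a).length =>
      fun j : Fin (elems a).length => R a ((sets a).get i) ((elems a).get j))
      (f := fun g => List.ofFn g) fun _ => rfl
    rw [List.map_ofFn] at h3
    refine Eq.trans h3.symm (congrArg enc ?_)
    rw [← ofFn_comp_get (sets a)]
    exact congrArg List.ofFn (funext fun i => h1 _)
  exact congrArg (BinTree.node _) h2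

/-! ### The reduction -/

/-- All lists of length `k` with entries in `l`. -/
def tuples {α : Type} (l : List α) : ℕ → List (List α)
  | 0 => [[]]
  | k + 1 => (tuples l k).flatMap fun t => l.map fun a => a :: t

theorem length_tuples {α : Type} (l : List α) (k : ℕ) : (tuples l k).length = l.length ^ k := by
  induction k with
  | zero => rfl
  | succ k ih => simp [tuples, List.length_flatMap, ih, pow_succ]

theorem mem_tuples {α : Type} {l : List α} {k : ℕ} {t : List α} :
    t ∈ tuples l k ↔ t.length = k ∧ ∀ a ∈ t, a ∈ l := by
  induction k generalizing t with
  | zero => simp only [tuples, List.mem_singleton, List.length_eq_zero_iff]; aesop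
  | succ k ih =>
    simp only [tuples, List.mem_flatMap, List.mem_map, ih]
    constructor
    · rintro ⟨t, ⟨rfl, h⟩, a, ha, rfl⟩
      simpa using ⟨ha, h⟩
    · rintro ⟨h1, h2⟩
      cases t with
      | nil => simp at h1
      | cons a t =>
        exact ⟨t, ⟨by simpa using h1, fun b hb => h2 b (List.mem_cons_of_mem _ hb)⟩, a,
          h2 a List.mem_cons_self, rfl⟩

namespace ProjectionGame

/-- The neighbors of the vertex `b`. -/
def neighbors (G : ProjectionGame) (b : ℕ) : List ℕ :=
  (List.range G.nA).filter fun a => G.isEdge a b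

/-- The elements of the universe: a vertex `b`, a `D`-tuple of neighbors of `b`, and a word. -/
def elements (G : ProjectionGame) (D : ℕ) (L : List (List ℕ)) : List (ℕ × List ℕ × List ℕ) :=
  (List.range G.nB).flatMap fun b => (tuples (G.neighbors b) D).flatMap fun t =>
    L.map fun e => (b, t, e)

/-- The sets are indexed by a vertex of `A` and a label for it. -/
def setIndices (G : ProjectionGame) : List (ℕ × ℕ) :=
  (List.range G.nA).flatMap fun a => (List.range G.sA).map fun σ => (a, σ)

/-- The set `(a, σ)` contains `(b, t, e)` if the word `e`, read at the label of `b` that corresponds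
to the label `σ` of `a`, selects the vertex `a` from the tuple `t`. -/
def incident (G : ProjectionGame) (x : ℕ × ℕ) (y : ℕ × List ℕ × List ℕ) : Bool :=
  decide (y.2.1.getD (y.2.2.getD (G.label x.1 y.1 x.2) 0) G.nA = x.1)

/-- The set cover instance built from a game and a family of words. -/
def toSetCover (G : ProjectionGame) (D : ℕ) (L : List (List ℕ)) : SetCover :=
  .ofLists G.setIndices (G.elements D L) G.incident

end ProjectionGame

section

variable {α β : Type} [TreeEncodable α] [TreeEncodable β]

theorem PolyTime.tuples {l : α → List β} (hl : PolyTime l) (k : ℕ) :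
    PolyTime (fun a => tuples (l a) k) := by
  induction k with
  | zero => exact .const _
  | succ k ih => exact .flatMap ih (.map (by fun_prop) (by fun_prop))

theorem PolyTime.neighbors {G : α → ProjectionGame} {b : α → ℕ} (hG : PolyTime G)
    (hb : PolyTime b) : PolyTime (fun a => (G a).neighbors (b a)) :=
  .filter (by fun_prop) (by fun_prop)

theorem PolyTime.elements {G : α → ProjectionGame} {L : α → List (List ℕ)} (hG : PolyTime G)
    (D : ℕ) (hL : PolyTime L) : PolyTime (fun a => (G a).elements D (L a)) := by
  have h : PolyTime (fun y : α × ℕ => SetCoverHardness.tuples ((G y.1).neighbors y.2) D) :=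
    .tuples (.neighbors (by fun_prop) (by fun_prop)) D
  exact .flatMap (by fun_prop) (.flatMap h (.map (by fun_prop) (by fun_prop)))

theorem PolyTime.setIndices {G : α → ProjectionGame} (hG : PolyTime G) :
    PolyTime (fun a => (G a).setIndices) :=
  .flatMap (by fun_prop) (.map (by fun_prop) (by fun_prop))

theorem PolyTime.toSetCover {G : α → ProjectionGame} {L : α → List (List ℕ)} (hG : PolyTime G)
    (D : ℕ) (hL : PolyTime L) : PolyTime (fun a => (G a).toSetCover D (L a)) := by
  refine .setCover_ofLists (.setIndices hG) (.elements hG D hL) ?_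
  have h1 : PolyTime (fun y : (α × (ℕ × ℕ)) × (ℕ × List ℕ × List ℕ) =>
      (G y.1.1).label y.1.2.1 y.2.1 y.1.2.2) := by fun_prop
  have h2 : PolyTime (fun y : (α × (ℕ × ℕ)) × (ℕ × List ℕ × List ℕ) =>
      bif decide (y.2.2.2.getD ((G y.1.1).label y.1.2.1 y.2.1 y.1.2.2) 0 < y.2.2.1.length) then
        y.2.2.1.getD (y.2.2.2.getD ((G y.1.1).label y.1.2.1 y.2.1 y.1.2.2) 0) 0
      else (G y.1.1).nA) := by
    fun_prop
  refine .decide_eq ?_ (by fun_prop)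
  convert h2 using 2 with y
  by_cases h : y.2.2.2.getD ((G y.1.1).label y.1.2.1 y.2.1 y.1.2.2) 0 < y.2.2.1.length
  · rw [decide_eq_true h, cond_true, List.getD_eq_getElem _ _ h, List.getD_eq_getElem _ _ h]
  · rw [decide_eq_false h, cond_false, List.getD_eq_default _ _ (not_lt.1 h)]

end


/-! ### Correctness of the reduction -/

namespace ProjectionGame

variable {G : ProjectionGame} {D T dA dB : ℕ} {L : List (List ℕ)}

/-- The neighbors of the vertex `b`, as a finite set. -/
def neighborFinset (G : ProjectionGame) (b : Fin G.nB) : Finset (Fin G.nA) :=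
  Finset.univ.filter fun a => (G.proj a b).isSome

theorem mem_neighborFinset {a : Fin G.nA} {b : Fin G.nB} :
    a ∈ G.neighborFinset b ↔ (G.proj a b).isSome := by
  simp [neighborFinset]

theorem card_filter_edges_snd (b : Fin G.nB) :
    (G.edges.filter fun e => e.2 = b).card = (G.neighborFinset b).card := by
  refine Finset.card_nbij' (fun e => e.1) (fun a => (a, b)) ?_ ?_ ?_ ?_
  · rintro ⟨a, b'⟩ h
    simp only [edges, Finset.coe_filter, Finset.mem_filter, Finset.mem_univ, true_and,
      Set.mem_ofPred_eq] at h
    rw [Finset.mem_coe, mem_neighborFinset, ← h.2]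
    exact h.1
  · intro a h
    rw [Finset.mem_coe, mem_neighborFinset] at h
    simpa [edges] using h
  · rintro ⟨a, b'⟩ h
    simp only [edges, Finset.coe_filter, Finset.mem_filter, Finset.mem_univ, true_and,
      Set.mem_ofPred_eq] at h
    rw [← h.2]
  · intro a _
    rfl

theorem card_filter_edges_fst (a : Fin G.nA) :
    (G.edges.filter fun e => e.1 = a).card =
      (Finset.univ.filter fun b => a ∈ G.neighborFinset b).card := by
  refine Finset.card_nbij' (fun e => e.2) (fun b => (a, b)) ?_ ?_ ?_ ?_
  · rintro ⟨a', b⟩ h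
    simp only [edges, Finset.coe_filter, Finset.mem_filter, Finset.mem_univ, true_and,
      Set.mem_ofPred_eq] at h
    obtain ⟨h1, rfl⟩ := h
    simpa [mem_neighborFinset] using h1
  · intro b h
    simp only [Finset.coe_filter, Finset.mem_univ, true_and, Set.mem_ofPred_eq,
      mem_neighborFinset] at h
    simpa [edges] using h
  · rintro ⟨a', b⟩ h
    simp only [edges, Finset.coe_filter, Finset.mem_filter, Finset.mem_univ, true_and,
      Set.mem_ofPred_eq] at h
    rw [← h.2]
  · intro b _
    rfl

theorem BiRegular.card_neighborFinset (h : G.BiRegular dA dB) (b : Fin G.nB) :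
    (G.neighborFinset b).card = dB := by
  rw [← card_filter_edges_snd, h.2]

theorem BiRegular.card_edges (h : G.BiRegular dA dB) : G.edges.card = G.nB * dB := by
  rw [Finset.card_eq_sum_card_fiberwise (f := Prod.snd) (t := Finset.univ) (by simp),
    Finset.sum_congr rfl fun b _ => h.2 b]
  simp

theorem mem_neighbors {a : ℕ} {b : Fin G.nB} :
    a ∈ G.neighbors b ↔ ∃ a' ∈ G.neighborFinset b, (a' : ℕ) = a := by
  simp only [neighbors, List.mem_filter, List.mem_range, mem_neighborFinset]
  constructor
  · rintro ⟨h1, h2⟩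
    exact ⟨⟨a, h1⟩, by rwa [← isEdge_eq], rfl⟩
  · rintro ⟨a', h, rfl⟩
    exact ⟨a'.2, by rwa [isEdge_eq]⟩

theorem length_neighbors (b : Fin G.nB) :
    (G.neighbors b).length = (G.neighborFinset b).card := by
  have hnd : (G.neighbors b).Nodup := List.nodup_range.filter _
  rw [← List.toFinset_card_of_nodup hnd, ← Finset.card_map Fin.valEmbedding]
  congr 1
  ext a
  rw [List.mem_toFinset, mem_neighbors]
  simp

/-- The size of the universe. -/
theorem toSetCover_N (h : G.BiRegular dA dB) :
    (G.toSetCover D L).N = G.nB * dB ^ D * L.length := by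
  have h1 : ∀ b ∈ List.range G.nB, ((tuples (G.neighbors b) D).flatMap fun t =>
      L.map fun e => (b, t, e)).length = dB ^ D * L.length := by
    intro b hb
    have h2 := length_neighbors (G := G) ⟨b, List.mem_range.1 hb⟩
    rw [h.card_neighborFinset] at h2
    simp only at h2
    simp [List.length_flatMap, length_tuples, h2]
  change (G.elements D L).length = _
  rw [elements, List.length_flatMap, List.map_congr_left h1]
  simp [mul_assoc]

theorem mem_elements {b : ℕ} {t e : List ℕ} :
    (b, t, e) ∈ G.elements D L ↔
      b < G.nB ∧ (t.length = D ∧ ∀ a ∈ t, a ∈ G.neighbors b) ∧ e ∈ L := by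
  simp only [elements, List.mem_flatMap, List.mem_range, List.mem_map, Prod.mk.injEq, mem_tuples]
  constructor
  · rintro ⟨b, hb, t, ht, e, he, rfl, rfl, rfl⟩; exact ⟨hb, ht, he⟩
  · rintro ⟨hb, ht, he⟩; exact ⟨b, hb, t, ht, e, he, rfl, rfl, rfl⟩

theorem mem_setIndices {a σ : ℕ} : (a, σ) ∈ G.setIndices ↔ a < G.nA ∧ σ < G.sA := by
  simp only [setIndices, List.mem_flatMap, List.mem_range, List.mem_map, Prod.mk.injEq]
  constructor
  · rintro ⟨a, ha, σ, hσ, rfl, rfl⟩; exact ⟨ha, hσ⟩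
  · rintro ⟨ha, hσ⟩; exact ⟨a, ha, σ, hσ, rfl, rfl⟩

/-- The labels of `A` in a labeling that covers all edges form a set cover. -/
theorem exists_isCover (hL : ∀ e ∈ L, e.length = G.sB ∧ ∀ a ∈ e, a < D)
    {σA : Fin G.nA → Fin G.sA} {σB : Fin G.nB → Fin G.sB} (h : G.covered σA σB = G.edges) :
    ∃ S, (G.toSetCover D L).IsCover S ∧ S.card = G.nA := by
  have hidx : ∀ a : Fin G.nA, ∃ i : Fin G.setIndices.length,
      G.setIndices.get i = ((a : ℕ), (σA a : ℕ)) := fun a =>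
    List.mem_iff_get.1 (mem_setIndices.2 ⟨a.2, (σA a).2⟩)
  choose idx hidx using hidx
  have hinj : Function.Injective idx := fun a a' haa => by
    have h1 := hidx a
    rw [haa, hidx a', Prod.mk.injEq] at h1
    exact Fin.ext h1.1.symm
  refine ⟨Finset.univ.image idx, fun j => ?_, ?_⟩
  · change Fin (G.elements D L).length at j
    rcases hx : (G.elements D L).get j with ⟨b, t, e⟩
    have hmem : (b, t, e) ∈ G.elements D L := hx ▸ List.get_mem _ _
    obtain ⟨hb, ⟨ht1, ht2⟩, he⟩ := mem_elements.1 hmem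
    obtain ⟨he1, he2⟩ := hL e he
    have hv : (σB ⟨b, hb⟩ : ℕ) < e.length := by rw [he1]; exact (σB ⟨b, hb⟩).2
    have hi : e.getD (σB ⟨b, hb⟩) 0 < t.length := by
      rw [List.getD_eq_getElem _ _ hv, ht1]
      exact he2 _ (List.getElem_mem hv)
    obtain ⟨a, ha, hat⟩ := (mem_neighbors (b := ⟨b, hb⟩)).1 (ht2 _ (List.getElem_mem hi))
    rw [mem_neighborFinset, Option.isSome_iff_exists] at ha
    obtain ⟨π, hπ⟩ := ha
    have hcov : (a, (⟨b, hb⟩ : Fin G.nB)) ∈ G.covered σA σB := by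
      rw [h]; simp [edges, hπ]
    have hlab : π (σA a) = σB ⟨b, hb⟩ := by
      simpa [covered, hπ] using (Finset.mem_filter.1 hcov).2
    refine ⟨idx a, Finset.mem_image_of_mem _ (Finset.mem_univ _), ?_⟩
    change G.incident (G.setIndices.get (idx a)) ((G.elements D L).get j) = true
    rw [hidx, hx]
    have hlabel := G.label_eq hπ (σA a)
    simp only at hlabel
    simp only [incident, hlabel, hlab, decide_eq_true_eq]
    rw [List.getD_eq_getElem _ _ hi, hat]
  · exact (Finset.card_image_of_injective Finset.univ hinj).trans (by simp)

/-- If every labeling covers at most a fraction `1 / K` of the edges, then every set cover is almost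
as large as `|A| * (T + 1) / D`. -/
theorem card_isCover_lower_bound (hreg : G.BiRegular dA dB) (hne : G.edges.Nonempty)
    (hL : IsHitting D G.sB T L) {K : ℝ} (hK : 0 < K)
    (hsound : ∀ σA σB, ((G.covered σA σB).card : ℝ) * K ≤ G.edges.card)
    {S : Finset (Fin (G.toSetCover D L).m)} (hS : (G.toSetCover D L).IsCover S) :
    (T + 1) * (G.nA * (1 - D ^ 2 * T ^ 2 / K)) ≤ D * (S.card : ℝ) := by
  classical
  obtain ⟨⟨a₀, b₀⟩, he₀⟩ := hne
  have hedge₀ : (G.proj a₀ b₀).isSome := by simpa [edges] using he₀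
  obtain ⟨π₀, hπ₀⟩ := Option.isSome_iff_exists.1 hedge₀
  have hdB : 0 < dB := by
    rw [← hreg.card_neighborFinset b₀]
    exact Finset.card_pos.2 ⟨a₀, mem_neighborFinset.2 hedge₀⟩
  -- the covering property in terms of the vertices of the game
  have hcov : ∀ (b : Fin G.nB) (t : Fin D → Fin G.nA), (∀ i, t i ∈ G.neighborFinset b) →
      ∀ e ∈ L, ∃ (i : Fin G.setIndices.length) (a : Fin G.nA) (σ : Fin G.sA), i ∈ S ∧
        G.setIndices.get i = ((a : ℕ), (σ : ℕ)) ∧ ∃ k : Fin D, t k = a ∧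
          e.getD (G.label a b σ) 0 = k := by
    intro b t ht e he
    have hmem : ((b : ℕ), List.ofFn (fun i => (t i : ℕ)), e) ∈ G.elements D L := by
      refine mem_elements.2 ⟨b.2, ⟨by simp, fun a ha => ?_⟩, he⟩
      obtain ⟨i, rfl⟩ := (List.mem_ofFn' _ _).1 ha
      exact mem_neighbors.2 ⟨t i, ht i, rfl⟩
    obtain ⟨j, hj⟩ := List.mem_iff_get.1 hmem
    obtain ⟨i, hiS, hi⟩ := hS j
    change G.incident (G.setIndices.get i) ((G.elements D L).get j) = true at hi
    rw [hj] at hi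
    have hget := List.get_mem G.setIndices i
    rcases hx : G.setIndices.get i with ⟨a, σ⟩
    rw [hx] at hget hi
    obtain ⟨ha, hσ⟩ := mem_setIndices.1 hget
    refine ⟨i, ⟨a, ha⟩, ⟨σ, hσ⟩, hiS, hx, ?_⟩
    simp only [incident, decide_eq_true_eq] at hi
    have hlt : e.getD (G.label a b σ) 0 < D := by
      by_contra hge
      rw [List.getD_eq_default _ _ (by simpa using hge)] at hi
      omega
    refine ⟨⟨_, hlt⟩, Fin.ext ?_, rfl⟩
    rw [List.getD_eq_getElem _ _ (by simpa using hlt)] at hi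
    simpa using hi
  obtain ⟨e₀, he₀', -⟩ := hL.exists_avoids (List.replicate G.sB D)
    ⟨by simp, fun a ha => (List.eq_of_mem_replicate ha).le, by simp [support_replicate]⟩
  obtain ⟨-, -, σ₀, -⟩ := hcov b₀ (fun _ => a₀) (fun _ => mem_neighborFinset.2 hedge₀) e₀ he₀'
  have : Nonempty (Fin G.nB) := ⟨b₀⟩
  have : Nonempty (Fin G.sA) := ⟨σ₀⟩
  let S' : Finset (Fin G.nA × Fin G.sA) := Finset.univ.filter fun p =>
    ∃ i : Fin G.setIndices.length, i ∈ S ∧ G.setIndices.get i = ((p.1 : ℕ), (p.2 : ℕ))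
  have hS' : S'.card ≤ S.card := by
    refine le_trans ?_ (Finset.card_image_le (s := S)
      (f := fun i : Fin G.setIndices.length => G.setIndices.get i))
    rw [← Finset.card_map (Fin.valEmbedding.prodMap Fin.valEmbedding)]
    refine Finset.card_le_card fun x hx => ?_
    obtain ⟨p, hp, rfl⟩ := Finset.mem_map.1 hx
    obtain ⟨i, hi, hi'⟩ := (Finset.mem_filter.1 hp).2
    exact Finset.mem_image.2 ⟨i, hi, hi'⟩
  have hmain := card_cover_lower_bound hL G.neighborFinset hreg.card_neighborFinset
    (fun a => by rw [← card_filter_edges_fst, hreg.1]) hdB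
    (fun a b (σ : Fin G.sA) => G.label a b σ) ?_ hK ?_ S' ?_
  · refine le_trans (by simpa using hmain) ?_
    gcongr
  · intro b a ha σ
    obtain ⟨π, hπ⟩ := Option.isSome_iff_exists.1 (mem_neighborFinset.1 ha)
    rw [G.label_eq hπ]
    exact (π σ).2
  · intro σ τ
    let σB : Fin G.nB → Fin G.sB := fun b => if h : τ b < G.sB then ⟨τ b, h⟩ else π₀ σ₀
    refine le_trans ?_ ((hsound σ σB).trans (by rw [hreg.card_edges]; simp))
    refine mul_le_mul_of_nonneg_right (Nat.cast_le.2 ?_) hK.le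
    rw [Finset.card_eq_sum_card_fiberwise (f := Prod.snd) (t := Finset.univ)
      (s := G.covered σ σB) (by simp)]
    refine Finset.sum_le_sum fun b _ => ?_
    refine Finset.card_le_card_of_injOn (fun a => (a, b)) ?_ (by intro a _ a' _ h; simpa using h)
    intro a ha
    obtain ⟨h1, h2⟩ := Finset.mem_filter.1 ha
    rw [mem_neighborFinset] at h1
    obtain ⟨π, hπ⟩ := Option.isSome_iff_exists.1 h1
    rw [G.label_eq hπ] at h2
    have h3 : σB b = π (σ a) := by
      have : τ b < G.sB := h2 ▸ (π (σ a)).2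
      simp only [σB, dif_pos this]
      exact Fin.ext h2.symm
    simp [covered, edges, hπ, h3]
  · intro b t ht e he
    obtain ⟨i, a, σ, h1, h2, k, h3, h4⟩ := hcov b t ht e he
    refine ⟨k, σ, Finset.mem_filter.2 ⟨Finset.mem_univ _, i, h1, ?_⟩, ?_⟩
    · rw [h2, h3]
    · rw [h3, h4]

end ProjectionGame


/-! ### The choice of parameters -/

/-- The number of conditions that words for the parameter `u` have to avoid: about
`(D - 1) * log u`. -/
def threshold (D u : ℕ) : ℕ := decay D (D * u)

/-- An approximation of `log n`. -/
def approxLog (D n : ℕ) : ℕ := decay D (D * n)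

/-- The number of intervals into which the positions are cut: about `log (log n)`. -/
def numBlocks (D n : ℕ) : ℕ := approxLog D (approxLog D n)

/-- The number of conditions that are handled in each interval. -/
def blockThreshold (D n u : ℕ) : ℕ := threshold D u / numBlocks D n + 1

/-- The words used for formulas of size `n`, the parameter `u` and an alphabet of size `s`. -/
def wordFamily (D s n u : ℕ) : List (List ℕ) := family D s (blockThreshold D n u) (numBlocks D n)

theorem decay_le (D m : ℕ) : decay D m ≤ m := by
  unfold decay
  exact (List.length_filter_le _ _).trans (by simp)

theorem IsHitting.mono {D s t t' : ℕ} {L : List (List ℕ)} (h : IsHitting D s t' L) (ht : t ≤ t') :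
    IsHitting D s t L :=
  ⟨h.length_eq, h.lt, fun c hc =>
    h.exists_avoids c ⟨hc.length_eq, hc.le, hc.support_le.trans ht⟩⟩

section

variable {D : ℕ}

theorem one_lt_ratio (hD : 2 ≤ D) : (1 : ℝ) < (D : ℝ) / (D - 1) := by
  have hD2 : (2 : ℝ) ≤ D := by exact_mod_cast hD
  rw [lt_div_iff₀ (by linarith)]
  linarith

theorem log_ratio_le (hD : 2 ≤ D) : Real.log ((D : ℝ) / (D - 1)) ≤ 1 / (D - 1) := by
  have hD2 : (2 : ℝ) ≤ D := by exact_mod_cast hD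
  have hD1 : (0 : ℝ) < (D : ℝ) - 1 := by linarith
  refine (Real.log_le_sub_one_of_pos (by positivity)).trans (le_of_eq ?_)
  field_simp
  ring

theorem lt_ratio_approxLog (hD : 2 ≤ D) (n : ℕ) :
    (n : ℝ) < ((D : ℝ) / (D - 1)) ^ approxLog D n := by
  have h := lt_ratio_decay hD (D * n)
  push_cast at h
  exact lt_of_mul_lt_mul_left h (by positivity)

theorem ratio_approxLog_le (hD : 2 ≤ D) {n : ℕ} (hn : 0 < n) :
    ((D : ℝ) / (D - 1)) ^ approxLog D n ≤ 2 * D * n := by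
  have h := ratio_decay_le hD (m := D * n) (by positivity)
  push_cast at h
  rwa [mul_assoc]

theorem log_le_approxLog_mul (hD : 2 ≤ D) {n : ℕ} (hn : 0 < n) :
    Real.log n ≤ approxLog D n * Real.log ((D : ℝ) / (D - 1)) := by
  rw [← Real.log_pow]
  exact Real.log_le_log (by exact_mod_cast hn) (lt_ratio_approxLog hD n).le

theorem approxLog_mul_le_log (hD : 2 ≤ D) {n : ℕ} (hn : 0 < n) :
    approxLog D n * Real.log ((D : ℝ) / (D - 1)) ≤ Real.log (2 * D * n) := by
  rw [← Real.log_pow]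
  exact Real.log_le_log (pow_pos (one_pos.trans (one_lt_ratio hD)) _) (ratio_approxLog_le hD hn)

theorem mul_log_le_approxLog (hD : 2 ≤ D) {n : ℕ} (hn : 0 < n) :
    ((D : ℝ) - 1) * Real.log n ≤ approxLog D n := by
  have hD2 : (2 : ℝ) ≤ D := by exact_mod_cast hD
  have hD1 : (0 : ℝ) < (D : ℝ) - 1 := by linarith
  have h1 := log_le_approxLog_mul hD hn
  have h2 : (approxLog D n : ℝ) * Real.log ((D : ℝ) / (D - 1)) ≤ approxLog D n * (1 / (D - 1)) := by
    gcongr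
    exact log_ratio_le hD
  calc ((D : ℝ) - 1) * Real.log n ≤ (D - 1) * (approxLog D n * (1 / (D - 1))) := by
        gcongr; exact h1.trans h2
    _ = _ := by field_simp

theorem log_le_approxLog (hD : 2 ≤ D) {n : ℕ} (hn : 0 < n) : Real.log n ≤ approxLog D n := by
  have hD2 : (2 : ℝ) ≤ D := by exact_mod_cast hD
  have h := mul_log_le_approxLog hD hn
  have : 0 ≤ Real.log n := Real.log_natCast_nonneg n
  nlinarith

theorem numBlocks_mul_blockThreshold_le (D n u : ℕ) :
    numBlocks D n * blockThreshold D n u ≤ threshold D u + numBlocks D n := by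
  have := Nat.mul_div_le (threshold D u) (numBlocks D n)
  unfold blockThreshold
  rw [mul_add, mul_one]
  omega

/-- The relations between the parameters on which the estimates rest: `u` is polynomial and the
alphabet size `s` polylogarithmic in `n`, and `n` is large. The quantity
`(D / (D - 1)) ^ numBlocks D n`, which is about `log n`, serves as a unit in these estimates. -/
structure Regime (D g c n u s : ℕ) : Prop where
  two_le : 2 ≤ D
  u_pos : 0 < u
  u_le : u ≤ n ^ g
  two_mul_le : 2 * D ≤ approxLog D n
  add_le : g + D + 1 ≤ approxLog D n
  s_le : s ≤ approxLog D n ^ c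

namespace Regime

variable {g c n u s : ℕ}

theorem approxLog_pos (h : Regime D g c n u s) : 0 < approxLog D n := by
  have := h.add_le; omega

theorem approxLog_lt (h : Regime D g c n u s) :
    (approxLog D n : ℝ) < ((D : ℝ) / (D - 1)) ^ numBlocks D n :=
  lt_ratio_approxLog h.two_le _

theorem two_mul_le_ratio (h : Regime D g c n u s) :
    (2 * D : ℝ) ≤ ((D : ℝ) / (D - 1)) ^ numBlocks D n := by
  refine le_trans ?_ h.approxLog_lt.le
  exact_mod_cast h.two_mul_le

theorem numBlocks_pos (h : Regime D g c n u s) : 0 < numBlocks D n := by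
  by_contra h0
  have h1 := h.approxLog_lt
  rw [Nat.eq_zero_of_not_pos h0, pow_zero] at h1
  have := h.approxLog_pos
  have h2 : (1 : ℝ) ≤ approxLog D n := by exact_mod_cast this
  linarith

theorem isHitting (h : Regime D g c n u s) :
    IsHitting D s (threshold D u) (wordFamily D s n u) := by
  refine (isHitting_family h.two_le).mono ?_
  exact (Nat.lt_mul_div_succ _ h.numBlocks_pos).le

theorem ratio_threshold_le (h : Regime D g c n u s) :
    ((D : ℝ) / (D - 1)) ^ threshold D u ≤ 2 * D * u :=
  ratio_approxLog_le h.two_le h.u_pos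

theorem mul_log_le_threshold (h : Regime D g c n u s) :
    ((D : ℝ) - 1) * Real.log u ≤ threshold D u :=
  mul_log_le_approxLog h.two_le h.u_pos

theorem succ_mul_le (h : Regime D g c n u s) :
    ((s : ℝ) + 1) * D ≤ (((D : ℝ) / (D - 1)) ^ numBlocks D n) ^ (c + 1) := by
  have h1 := h.approxLog_lt.le
  have h2 := h.two_mul_le_ratio
  have h3 : (1 : ℝ) ≤ ((D : ℝ) / (D - 1)) ^ numBlocks D n := one_le_pow₀ (one_lt_ratio h.two_le).le
  generalize ((D : ℝ) / (D - 1)) ^ numBlocks D n = r at h1 h2 h3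
  have h4 : (s : ℝ) ≤ r ^ c := by
    refine le_trans ?_ (pow_le_pow_left₀ (by positivity) h1 c)
    exact_mod_cast h.s_le
  have h5 : (1 : ℝ) ≤ r ^ c := one_le_pow₀ h3
  calc ((s : ℝ) + 1) * D ≤ (r ^ c + r ^ c) * D := by gcongr
    _ = r ^ c * (2 * D) := by ring
    _ ≤ r ^ c * r := by gcongr
    _ = r ^ (c + 1) := (pow_succ r c).symm

theorem threshold_le (h : Regime D g c n u s) :
    threshold D u ≤ approxLog D n * (g + D) := by
  have hρ := one_lt_ratio h.two_le
  have h1 : ((D : ℝ) / (D - 1)) ^ threshold D u ≤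
      ((D : ℝ) / (D - 1)) ^ (numBlocks D n + approxLog D n * g) := by
    calc _ ≤ (2 * D * u : ℝ) := h.ratio_threshold_le
      _ ≤ 2 * D * (n : ℝ) ^ g := by
          gcongr
          exact_mod_cast h.u_le
      _ ≤ ((D : ℝ) / (D - 1)) ^ numBlocks D n *
          (((D : ℝ) / (D - 1)) ^ approxLog D n) ^ g := by
          gcongr
          · exact h.two_mul_le_ratio
          · exact (lt_ratio_approxLog h.two_le n).le
      _ = _ := by rw [← pow_mul, ← pow_add]
  have h2 := (pow_le_pow_iff_right₀ hρ).1 h1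
  have h3 : numBlocks D n ≤ D * approxLog D n := decay_le _ _
  calc _ ≤ D * approxLog D n + approxLog D n * g := h2.trans (by omega)
    _ = _ := by ring

/-- The list of the constraints that are relevant in one interval has polynomial length. -/
theorem constraints_le (h : Regime D g c n u s) :
    ((s + 1) * D) ^ blockThreshold D n u ≤ (2 * D * u * (2 * D * approxLog D n)) ^ (c + 1) := by
  have hρ := (one_lt_ratio h.two_le).le
  have h1 : (((s : ℝ) + 1) * D) ^ blockThreshold D n u ≤
      (2 * D * u * (2 * D * approxLog D n)) ^ (c + 1) := by
    calc _ ≤ ((((D : ℝ) / (D - 1)) ^ numBlocks D n) ^ (c + 1)) ^ blockThreshold D n u := by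
          gcongr; exact h.succ_mul_le
      _ = (((D : ℝ) / (D - 1)) ^ (numBlocks D n * blockThreshold D n u)) ^ (c + 1) := by
          rw [← pow_mul, ← pow_mul, ← pow_mul]; congr 1; ring
      _ ≤ (((D : ℝ) / (D - 1)) ^ (threshold D u + numBlocks D n)) ^ (c + 1) := by
          refine pow_le_pow_left₀ (by positivity) ?_ _
          exact pow_le_pow_right₀ hρ (numBlocks_mul_blockThreshold_le D n u)
      _ ≤ _ := by
          rw [pow_add _ (threshold D u)]
          gcongr
          · exact h.ratio_threshold_le
          · exact ratio_approxLog_le h.two_le h.approxLog_pos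
  exact_mod_cast h1

/-- The family of words has size `u * n ^ o(1)`. -/
theorem length_wordFamily_le (h : Regime D g c n u s) :
    ((wordFamily D s n u).length : ℝ) ≤
      u * ((D : ℝ) / (D - 1)) ^ ((2 * c + 7) * numBlocks D n ^ 2) := by
  have hρ := (one_lt_ratio h.two_le).le
  have hD0 : (0 : ℝ) < D := by have := h.two_le; positivity
  have hb := h.numBlocks_pos
  have h1 := h.approxLog_lt.le
  have h2 := h.two_mul_le_ratio
  have h3 : (1 : ℝ) ≤ ((D : ℝ) / (D - 1)) ^ numBlocks D n := one_le_pow₀ hρ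
  have h4 := h.succ_mul_le
  have hF := length_greedyFamily_le (D := D) (s := s) (t := blockThreshold D n u) h.two_le
  have hT : ((threshold D u : ℝ) + 1) ≤ (((D : ℝ) / (D - 1)) ^ numBlocks D n) ^ 2 := by
    have h5 : threshold D u + 1 ≤ approxLog D n * approxLog D n := by
      calc _ ≤ approxLog D n * (g + D) + approxLog D n := by
            have := h.threshold_le
            have := h.approxLog_pos
            omega
        _ = approxLog D n * (g + D + 1) := by ring
        _ ≤ _ := Nat.mul_le_mul_left _ h.add_le
    have h6 : ((threshold D u : ℝ) + 1) ≤ approxLog D n * approxLog D n := by exact_mod_cast h5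
    refine h6.trans ?_
    rw [sq]
    gcongr
  have hrb : ((D : ℝ) / (D - 1)) ^ ((2 * c + 7) * numBlocks D n ^ 2) =
      ((((D : ℝ) / (D - 1)) ^ numBlocks D n) ^ (2 * c + 7)) ^ numBlocks D n := by
    rw [← pow_mul, ← pow_mul]; congr 1; ring
  have hbT : (((D : ℝ) / (D - 1)) ^ blockThreshold D n u) ^ numBlocks D n ≤
      u * (((D : ℝ) / (D - 1)) ^ numBlocks D n) ^ 2 := by
    calc _ = ((D : ℝ) / (D - 1)) ^ (numBlocks D n * blockThreshold D n u) := by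
          rw [← pow_mul]; congr 1; ring
      _ ≤ ((D : ℝ) / (D - 1)) ^ (threshold D u + numBlocks D n) :=
          pow_le_pow_right₀ hρ (numBlocks_mul_blockThreshold_le D n u)
      _ = ((D : ℝ) / (D - 1)) ^ threshold D u * ((D : ℝ) / (D - 1)) ^ numBlocks D n :=
          pow_add _ _ _
      _ ≤ (2 * D * u) * ((D : ℝ) / (D - 1)) ^ numBlocks D n := by
          gcongr; exact h.ratio_threshold_le
      _ ≤ (((D : ℝ) / (D - 1)) ^ numBlocks D n * u) * ((D : ℝ) / (D - 1)) ^ numBlocks D n := by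
          gcongr
      _ = _ := by ring
  have hbt : blockThreshold D n u ≤ threshold D u + 1 :=
    Nat.add_le_add_right (Nat.div_le_self _ _) 1
  have hbt' : (blockThreshold D n u : ℝ) ≤ threshold D u + 1 := by exact_mod_cast hbt
  have hρ0 : (0 : ℝ) ≤ (D : ℝ) / (D - 1) := zero_le_one.trans hρ
  have hρt : (0 : ℝ) ≤ ((D : ℝ) / (D - 1)) ^ blockThreshold D n u := pow_nonneg hρ0 _
  have hρt1 : (1 : ℝ) ≤ ((D : ℝ) / (D - 1)) ^ blockThreshold D n u := one_le_pow₀ hρ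
  rw [wordFamily, length_family, hrb]
  push_cast
  generalize ((D : ℝ) / (D - 1)) ^ numBlocks D n = r at h1 h2 h3 h4 hT hbT ⊢
  generalize ((D : ℝ) / (D - 1)) ^ blockThreshold D n u = p at hF hbT hρt hρt1 ⊢
  have hr2 : 2 ≤ r := by
    have : (2 : ℝ) ≤ D := by exact_mod_cast h.two_le
    linarith
  have hlog : Real.log (((s + 1) * D : ℝ) ^ blockThreshold D n u) ≤ r ^ (c + 3) := by
    rw [Real.log_pow]
    calc (blockThreshold D n u : ℝ) * Real.log ((s + 1) * D) ≤
          (threshold D u + 1) * ((s + 1) * D) := by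
          refine mul_le_mul hbt' (Real.log_le_self (by positivity)) ?_ (by positivity)
          have hD1 : (1 : ℝ) ≤ D := by have := h.two_le; exact_mod_cast (by omega : 1 ≤ D)
          exact Real.log_nonneg (one_le_mul_of_one_le_of_one_le (by simp) hD1)
      _ ≤ r ^ 2 * r ^ (c + 1) := by gcongr
      _ = r ^ (c + 3) := by ring
  have hF2 : ((greedyFamily D s (blockThreshold D n u)).length : ℝ) ≤ p * r ^ (c + 4) := by
    have h5 : (1 : ℝ) ≤ r ^ (c + 3) := one_le_pow₀ h3
    calc _ ≤ p * r ^ (c + 3) + 1 := hF.trans (by gcongr)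
      _ ≤ p * r ^ (c + 3) + p * r ^ (c + 3) := by
          gcongr; exact one_le_mul_of_one_le_of_one_le hρt1 h5
      _ = p * (r ^ (c + 3) * 2) := by ring
      _ ≤ p * (r ^ (c + 3) * r) := by gcongr
      _ = _ := by ring
  have hs1 : ((s : ℝ) + 1) ≤ r ^ (c + 1) := by
    refine le_trans ?_ h4
    have : (1 : ℝ) ≤ D := by have := h.two_le; exact_mod_cast (by omega : 1 ≤ D)
    exact le_mul_of_one_le_right (by positivity) this
  calc (((s : ℝ) + 1) * (greedyFamily D s (blockThreshold D n u)).length) ^ numBlocks D n ≤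
        (r ^ (c + 1) * (p * r ^ (c + 4))) ^ numBlocks D n := by gcongr
    _ = p ^ numBlocks D n * (r ^ (2 * c + 5)) ^ numBlocks D n := by
        rw [← mul_pow]; congr 1; ring
    _ ≤ (u * r ^ 2) * (r ^ (2 * c + 5)) ^ numBlocks D n := by gcongr
    _ ≤ (u * (r ^ 2) ^ numBlocks D n) * (r ^ (2 * c + 5)) ^ numBlocks D n := by
        gcongr
        exact le_self_pow₀ (one_le_pow₀ h3) hb.ne'
    _ = u * (r ^ (2 * c + 7)) ^ numBlocks D n := by
        rw [mul_assoc, ← mul_pow]; congr 2; ring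

end Regime

open Filter Topology

theorem tendsto_log_natCast : Tendsto (fun n : ℕ => Real.log n) atTop atTop :=
  Real.tendsto_log_atTop.comp tendsto_natCast_atTop_atTop

theorem tendsto_approxLog (hD : 2 ≤ D) : Tendsto (approxLog D) atTop atTop := by
  rw [← tendsto_natCast_atTop_iff (R := ℝ)]
  refine tendsto_atTop_mono' _ ?_ tendsto_log_natCast
  filter_upwards [eventually_gt_atTop 0] with n hn
  exact log_le_approxLog hD hn

theorem eventually_approxLog_le (hD : 2 ≤ D) : ∀ᶠ n : ℕ in atTop,
    approxLog D n * Real.log ((D : ℝ) / (D - 1)) ≤ 2 * Real.log n := by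
  filter_upwards [eventually_ge_atTop (2 * D), eventually_gt_atTop 0] with n hn hn0
  refine (approxLog_mul_le_log hD hn0).trans ?_
  have h1 : (2 * D : ℝ) ≤ n := by exact_mod_cast hn
  have h2 : (0 : ℝ) < n := by exact_mod_cast hn0
  have h3 : (2 : ℝ) ≤ D := by exact_mod_cast hD
  calc Real.log (2 * D * n) ≤ Real.log (n * n) :=
        Real.log_le_log (by positivity) (by gcongr)
    _ = 2 * Real.log n := by rw [Real.log_mul h2.ne' h2.ne']; ring

/-- Since the number of blocks is `O(log (log n))`, the powers that occur in the size of the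
reduction are `n ^ o(1)`. -/
theorem eventually_ratio_pow_le (hD : 2 ≤ D) (C : ℕ) {η : ℝ} (hη : 0 < η) : ∀ᶠ n : ℕ in atTop,
    ((D : ℝ) / (D - 1)) ^ (C * numBlocks D n ^ 2) ≤ (n : ℝ) ^ η := by
  have hρ := one_lt_ratio hD
  have hD0 : (0 : ℝ) < D := by positivity
  set a := Real.log ((D : ℝ) / (D - 1)) with ha
  have ha0 : 0 < a := Real.log_pos hρ
  set κ : ℝ := η * a ^ 2 / (4 * D * (C + 1)) with hκ
  have hκ0 : 0 < κ := by positivity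
  have h1 : ∀ᶠ x : ℝ in atTop, Real.log x ^ 2 ≤ κ * x := by
    filter_upwards [(Real.isLittleO_pow_log_id_atTop (n := 2)).bound hκ0, eventually_ge_atTop 0]
      with x hx hx0
    simpa [abs_of_nonneg hx0] using hx
  have h2 : Tendsto (fun n : ℕ => (2 * D * approxLog D n : ℝ)) atTop atTop :=
    (tendsto_natCast_atTop_atTop.comp (tendsto_approxLog hD)).const_mul_atTop (by positivity)
  filter_upwards [h2.eventually h1, eventually_approxLog_le hD,
    (tendsto_approxLog hD).eventually_gt_atTop 0, eventually_gt_atTop 0] with n hn hn1 hn2 hn0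
  have h3 : numBlocks D n * a ≤ Real.log (2 * D * approxLog D n) := approxLog_mul_le_log hD hn2
  have h4 : (numBlocks D n * a) ^ 2 ≤ κ * (2 * D * approxLog D n) :=
    (pow_le_pow_left₀ (by positivity) h3 2).trans hn
  have hlog : 0 ≤ Real.log n := Real.log_natCast_nonneg n
  have hn0' : (0 : ℝ) < n := by exact_mod_cast hn0
  have hρ0 : (0 : ℝ) < (D : ℝ) / (D - 1) := one_pos.trans hρ
  rw [← Real.log_le_log_iff (pow_pos hρ0 _) (Real.rpow_pos_of_pos hn0' _), Real.log_pow,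
    Real.log_rpow hn0']
  push_cast
  rw [← ha]
  have h5 : (C * (numBlocks D n : ℝ) ^ 2 * a) * a ≤ (η * Real.log n) * a := by
    calc (C * (numBlocks D n : ℝ) ^ 2 * a) * a = C * (numBlocks D n * a) ^ 2 := by ring
      _ ≤ (C + 1) * (κ * (2 * D * approxLog D n)) := by gcongr; linarith
      _ = η * a * (approxLog D n * a) / 2 := by rw [hκ]; field_simp; ring
      _ ≤ η * a * (2 * Real.log n) / 2 := by gcongr
      _ = _ := by ring
  exact le_of_mul_le_mul_right h5 ha0

end


/-! ### The reduction on formulas -/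

/-- The reduction for large formulas: set cover instance and size of the intended cover. -/
def reduction (F : CNF3 → ProjectionGame) (D : ℕ) (x : CNF3 × ℕ) : SetCover × ℕ :=
  ((F x.1).toSetCover D (wordFamily D (F x.1).sB x.1.size x.2), (F x.1).nA)

/-- A set cover instance with a single element and a single set, which contains it. -/
def trivialYes : SetCover := ⟨1, 1, fun _ _ => true⟩

/-- A set cover instance with a single element and no sets. -/
def trivialNo : SetCover := ⟨1, 0, fun i _ => i.elim0⟩

theorem exists_isCover_trivialYes : ∃ S, trivialYes.IsCover S ∧ S.card = 1 :=
  ⟨{(0 : Fin 1)}, fun _ => ⟨(0 : Fin 1), Finset.mem_singleton_self _, rfl⟩, rfl⟩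

theorem not_isCover_trivialNo (S : Finset (Fin trivialNo.m)) : ¬ trivialNo.IsCover S := fun h =>
  let ⟨i, _⟩ := h (0 : Fin 1)
  i.elim0

/-- The reduction runs in polynomial time on every set `p` of inputs on which the family of words is
polynomially bounded. -/
theorem polyTime_reduction {F : CNF3 → ProjectionGame} (hF : PolyTime F) {D g c : ℕ}
    {p : CNF3 × ℕ → Prop} (hp : ∀ x, p x → Regime D g c x.1.size x.2 (F x.1).sB)
    (hlen : ∀ x, p x → (wordFamily D (F x.1).sB x.1.size x.2).length ≤ x.2 * x.1.size) :
    PolyTime (fun x : {x // p x} => reduction F D x.1) := by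
  by_cases hne : ∃ x, p x
  swap
  · refine ⟨.id, 0, fun x => absurd ⟨x.1, x.2⟩ hne⟩
  have hD : 2 ≤ D := let ⟨x, hx⟩ := hne; (hp x hx).two_le
  have hG : PolyTime (fun x : {x // p x} => F x.1.1) := by fun_prop
  have hs : PolyTime (fun x : {x // p x} => (F x.1.1).sB) := by fun_prop
  have hA : PolyTime (fun x : {x // p x} => (F x.1.1).nA) := by fun_prop
  have hn : PolyTime (fun x : {x // p x} => x.1.1.size) :=
    PolyTime.comp (f := fun x : {x // p x} => x.1.1) PolyTime.cnf_size (by fun_prop)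
  have hu : PolyTime (fun x : {x // p x} => x.1.2) := by fun_prop
  have happrox : ∀ {f : {x // p x} → ℕ}, PolyTime f → PolyTime (fun x => approxLog D (f x)) :=
    fun hf => .decay D (.mul (.const D) hf)
  have hb : PolyTime (fun x : {x // p x} => numBlocks D x.1.1.size) := happrox (happrox hn)
  have ht : PolyTime (fun x : {x // p x} => blockThreshold D x.1.1.size x.1.2) :=
    .add (.div (happrox hu) hb) (.const 1)
  have hL : PolyTime (fun x : {x // p x} => wordFamily D (F x.1.1).sB x.1.1.size x.1.2) := by
    refine .family hD hs ht hb
      (B := fun x => (2 * D * x.1.2 * (2 * D * (D * x.1.1.size))) ^ (c + 1))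
      (B' := fun x => x.1.2 * x.1.1.size) ?_ ?_ ?_ ?_
    · exact ((((PolyBounded.const _).mul (.nat hu))).mul ((PolyBounded.const _).mul
        ((PolyBounded.const _).mul (.nat hn)))).pow _
    · intro x
      refine (hp x.1 x.2).constraints_le.trans ?_
      gcongr
      exact decay_le _ _
    · exact (PolyBounded.nat hu).mul (.nat hn)
    · exact fun x => hlen x.1 x.2
  exact .prodMk (.toSetCover hG D hL) hA

open Filter

/-- If no labeling covers more than a fraction `1 / (log n) ^ 3` of the edges, then every set cover
has more than `|A| * log u * (1 - ε)` members. -/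
theorem reduction_gap {F : CNF3 → ProjectionGame} {D g c n u : ℕ} {φ : CNF3} {ε : ℝ}
    (hreg : Regime D g c n u (F φ).sB) (hn : φ.size = n)
    (hε : 0 < ε) (hε1 : ε ≤ 1) (hD : 2 / ε ≤ D)
    (hedges : (F φ).edges.Nonempty) (hbi : ∃ dA dB, (F φ).BiRegular dA dB)
    (hlog : 0 < Real.log n)
    (hsound : ∀ σA σB, (((F φ).covered σA σB).card : ℝ) * Real.log n ^ 3 ≤ (F φ).edges.card)
    (hsmall : D ^ 2 * threshold D u ^ 2 / Real.log n ^ 3 ≤ ε / 2)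
    {S : Finset _} (hS : (reduction F D (φ, u)).1.IsCover S) :
    ((reduction F D (φ, u)).2 : ℝ) * Real.log u * (1 - ε) < S.card := by
  obtain ⟨dA, dB, hbi⟩ := hbi
  subst hn
  have hmain := ProjectionGame.card_isCover_lower_bound hbi hedges hreg.isHitting
    (pow_pos hlog 3) hsound hS
  have hnA : 0 < (F φ).nA := by
    obtain ⟨⟨a, -⟩, -⟩ := hedges
    exact a.pos
  have hT := hreg.mul_log_le_threshold
  have hlogu : 0 ≤ Real.log u := Real.log_natCast_nonneg u
  have hD2 : (2 : ℝ) ≤ D := by exact_mod_cast hreg.two_le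
  have hA : (1 : ℝ) ≤ (F φ).nA := by exact_mod_cast hnA
  change ((F φ).nA : ℝ) * _ * _ < _
  generalize ((F φ).nA : ℝ) = A at hmain hA ⊢
  generalize (D : ℝ) ^ 2 * (threshold D u : ℝ) ^ 2 / Real.log φ.size ^ 3 = β at hmain hsmall
  have hDε : 2 ≤ D * ε := by rwa [div_le_iff₀ hε] at hD
  have hβ : 1 - ε / 2 ≤ 1 - β := by linarith
  have hβ0 : 0 < 1 - ε / 2 := by linarith
  have hA0 : 0 < A := by linarith
  have h1 : A * ((D - 1) * Real.log u + 1) * (1 - ε / 2) ≤ D * S.card := by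
    refine le_trans ?_ hmain
    calc A * ((D - 1) * Real.log u + 1) * (1 - ε / 2) ≤
          A * (threshold D u + 1) * (1 - ε / 2) := by gcongr
      _ ≤ A * (threshold D u + 1) * (1 - β) := by gcongr
      _ = _ := by ring
  have h2 : D * (A * Real.log u * (1 - ε)) < A * ((D - 1) * Real.log u + 1) * (1 - ε / 2) := by
    have h3 : D * (1 - ε) ≤ (D - 1) * (1 - ε / 2) := by nlinarith
    have h4 : D * (1 - ε) * (A * Real.log u) ≤ (D - 1) * (1 - ε / 2) * (A * Real.log u) := by
      gcongr
    have h5 : 0 < A * (1 - ε / 2) := by positivity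
    nlinarith
  exact lt_of_mul_lt_mul_left (h2.trans_le h1) (by positivity)

/-- Conditions on the size `n` of a formula under which the reduction works. -/
structure Large (F : CNF3 → ProjectionGame) (D g c : ℕ) (ε : ℝ) (n : ℕ) : Prop where
  n_pos : 0 < n
  log_pos : 0 < Real.log n
  regime : ∀ φ : CNF3, φ.size = n → ∀ u, 0 < u → u ≤ n ^ g → Regime D g c n u (F φ).sB
  degree_le : ∀ φ : CNF3, φ.size = n → ∀ dA dB, (F φ).BiRegular dA dB →
    dB ≤ approxLog D n ^ c
  pow_le : ((D : ℝ) / (D - 1)) ^ ((2 * c + 7) * numBlocks D n ^ 2) ≤ n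
  small : ∀ T : ℕ, T ≤ approxLog D n * (g + D) → D ^ 2 * T ^ 2 / Real.log n ^ 3 ≤ ε / 2

theorem eventually_large {F : CNF3 → ProjectionGame} {D c : ℕ} (hD : 2 ≤ D) (g : ℕ) {ε : ℝ}
    (hε : 0 < ε)
    (hF : ∀ᶠ n : ℕ in atTop, ∀ φ : CNF3, φ.size = n →
      (∀ dA dB, (F φ).BiRegular dA dB →
        (dA : ℝ) ≤ Real.log n ^ c ∧ (dB : ℝ) ≤ Real.log n ^ c) ∧
      ((F φ).sA : ℝ) ≤ Real.log n ^ c ∧ ((F φ).sB : ℝ) ≤ Real.log n ^ c) :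
    ∀ᶠ n : ℕ in atTop, Large F D g c ε n := by
  have hρ := one_lt_ratio hD
  set a := Real.log ((D : ℝ) / (D - 1)) with ha
  have ha0 : 0 < a := Real.log_pos hρ
  set M : ℝ := D ^ 2 * (g + D) ^ 2 * 4 / a ^ 2 with hM
  filter_upwards [hF, eventually_gt_atTop 0, eventually_ratio_pow_le hD (2 * c + 7) one_pos,
    (tendsto_approxLog hD).eventually_ge_atTop (2 * D),
    (tendsto_approxLog hD).eventually_ge_atTop (g + D + 1), eventually_approxLog_le hD,
    tendsto_log_natCast.eventually_gt_atTop 0,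
    tendsto_log_natCast.eventually_ge_atTop (2 * M / ε)] with n h1 hn h2 h3 h4 h5 h6 h7
  have hpoly : ∀ m : ℕ, (m : ℝ) ≤ Real.log n ^ c → m ≤ approxLog D n ^ c := by
    intro m hm
    have : (m : ℝ) ≤ approxLog D n ^ c :=
      hm.trans (pow_le_pow_left₀ h6.le (log_le_approxLog hD hn) c)
    exact_mod_cast this
  refine ⟨hn, h6, fun φ hφ u hu hug => ⟨hD, hu, hug, h3, h4, hpoly _ (h1 φ hφ).2.2⟩,
    fun φ hφ dA dB h => hpoly _ ((h1 φ hφ).1 dA dB h).2, by simpa using h2, fun T hT => ?_⟩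
  have hT' : (T : ℝ) * a ≤ 2 * Real.log n * (g + D) := by
    calc (T : ℝ) * a ≤ (approxLog D n * (g + D)) * a := by
          gcongr; exact_mod_cast hT
      _ = (approxLog D n * a) * (g + D) := by ring
      _ ≤ _ := by gcongr
  have hT2 : (D : ℝ) ^ 2 * T ^ 2 ≤ M * Real.log n ^ 2 := by
    have h8 : ((T : ℝ) * a) ^ 2 ≤ (2 * Real.log n * (g + D)) ^ 2 :=
      pow_le_pow_left₀ (by positivity) hT' 2
    rw [hM, div_mul_eq_mul_div, le_div_iff₀ (by positivity)]
    calc _ = (D : ℝ) ^ 2 * (T * a) ^ 2 := by ring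
      _ ≤ D ^ 2 * (2 * Real.log n * (g + D)) ^ 2 := by gcongr
      _ = _ := by ring
  rw [div_le_iff₀ (by positivity)]
  rw [div_le_iff₀ hε] at h7
  calc _ ≤ M * Real.log n ^ 2 := hT2
    _ = 2 * M * Real.log n ^ 2 / 2 := by ring
    _ ≤ (Real.log n * ε) * Real.log n ^ 2 / 2 := by gcongr
    _ = _ := by ring

/-- The size of the universe: `n ^ (1 + o(1))` vertices `b`, `n ^ o(1)` tuples and `u * n ^ o(1)`
words. -/
theorem reduction_universe_le {F : CNF3 → ProjectionGame} {D g c u : ℕ} {ε : ℝ} {φ : CNF3}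
    (hlarge : Large F D g c ε φ.size) (hu : 0 < u) (hug : u ≤ φ.size ^ g)
    (hbi : ∃ dA dB, (F φ).BiRegular dA dB) {δ : ℝ}
    (hsize : ((F φ).size : ℝ) ≤ (φ.size : ℝ) ^ (1 + δ / 2))
    (hpow : ((D : ℝ) / (D - 1)) ^ ((c * D + 2 * c + 7) * numBlocks D φ.size ^ 2) ≤
      (φ.size : ℝ) ^ (δ / 2)) :
    ((reduction F D (φ, u)).1.N : ℝ) ≤ (φ.size : ℝ) ^ (1 + δ) * u := by
  obtain ⟨dA, dB, hbi⟩ := hbi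
  have hr := hlarge.regime φ rfl u hu hug
  have hn : (0 : ℝ) < φ.size := by exact_mod_cast hlarge.n_pos
  have hρ := one_lt_ratio hr.two_le
  have hb := hr.numBlocks_pos
  have hdeg : (dB : ℝ) ^ D ≤ ((D : ℝ) / (D - 1)) ^ (c * D * numBlocks D φ.size ^ 2) := by
    have h1 : (dB : ℝ) ≤ (approxLog D φ.size : ℝ) ^ c := by
      exact_mod_cast hlarge.degree_le φ rfl dA dB hbi
    calc (dB : ℝ) ^ D ≤ ((((D : ℝ) / (D - 1)) ^ numBlocks D φ.size) ^ c) ^ D := by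
          gcongr
          refine h1.trans ?_
          gcongr
          exact hr.approxLog_lt.le
      _ = ((D : ℝ) / (D - 1)) ^ (c * D * numBlocks D φ.size) := by
          rw [← pow_mul, ← pow_mul]; congr 1; ring
      _ ≤ _ := by
          refine pow_le_pow_right₀ hρ.le ?_
          gcongr
          exact Nat.le_self_pow two_ne_zero _
  have hnB : ((F φ).nB : ℝ) ≤ (F φ).size := by
    have : (F φ).nB ≤ (F φ).size := by unfold ProjectionGame.size; omega
    exact_mod_cast this
  have hN : (reduction F D (φ, u)).1.N =
      (F φ).nB * dB ^ D * (wordFamily D (F φ).sB φ.size u).length :=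
    ProjectionGame.toSetCover_N hbi
  rw [hN]
  push_cast
  have hρ0 : (0 : ℝ) ≤ (D : ℝ) / (D - 1) := zero_le_one.trans hρ.le
  have hlen := hr.length_wordFamily_le
  calc ((F φ).nB : ℝ) * dB ^ D * (wordFamily D (F φ).sB φ.size u).length ≤
        (φ.size : ℝ) ^ (1 + δ / 2) * ((D : ℝ) / (D - 1)) ^ (c * D * numBlocks D φ.size ^ 2) *
          (u * ((D : ℝ) / (D - 1)) ^ ((2 * c + 7) * numBlocks D φ.size ^ 2)) := by
        gcongr
        exact hnB.trans hsize
    _ = (φ.size : ℝ) ^ (1 + δ / 2) *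
          ((D : ℝ) / (D - 1)) ^ ((c * D + 2 * c + 7) * numBlocks D φ.size ^ 2) * u := by
        have : (c * D + 2 * c + 7) * numBlocks D φ.size ^ 2 =
          c * D * numBlocks D φ.size ^ 2 + (2 * c + 7) * numBlocks D φ.size ^ 2 := by ring
        rw [this, pow_add]
        ring
    _ ≤ (φ.size : ℝ) ^ (1 + δ / 2) * (φ.size : ℝ) ^ (δ / 2) * u := by gcongr
    _ = _ := by rw [← Real.rpow_add hn]; congr 2; ring

end SetCoverHardness

open SetCoverHardness Filter in
theorem mainTheorem1 (hPGC : ProjectionGamesConjecture)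
    (γ ε : ℝ) (hγ : 0 < γ) (hε : 0 < ε) :
    ∃ f : CNF3 × ℕ → SetCover × ℕ, PolyTime f ∧
      (∀ (φ : CNF3) (u : ℕ), 1 ≤ u → (u : ℝ) ≤ (φ.size : ℝ) ^ γ →
        (φ.Satisfiable →
          ∃ S, (f (φ, u)).1.IsCover S ∧ S.card = (f (φ, u)).2) ∧
        (¬ φ.Satisfiable →
          ∀ S, (f (φ, u)).1.IsCover S →
            ((f (φ, u)).2 : ℝ) * Real.log u * (1 - ε) < S.card)) ∧
      (∀ δ : ℝ, 0 < δ → ∀ᶠ n : ℕ in atTop, ∀ (φ : CNF3) (u : ℕ), φ.size = n →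
        1 ≤ u → (u : ℝ) ≤ (n : ℝ) ^ γ →
        ((f (φ, u)).1.N : ℝ) ≤ (n : ℝ) ^ (1 + δ) * u) := by
  obtain ⟨F, hF, hgraph, hcompl, hsound, hsize, c, hdeg⟩ := hPGC 3
  -- it suffices to treat `ε ≤ 1`
  set ε' := min ε 1 with hε'
  have hε'0 : 0 < ε' := lt_min hε one_pos
  obtain ⟨D, hD⟩ : ∃ D : ℕ, 2 / ε' ≤ D := exists_nat_ge _
  have hD2 : 2 ≤ D := by
    have h1 : (2 : ℝ) ≤ 2 / ε' := by
      rw [le_div_iff₀ hε'0]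
      have : ε' ≤ 1 := min_le_right _ _
      linarith
    exact_mod_cast h1.trans hD
  set g := ⌈γ⌉₊
  obtain ⟨n₀, hn₀⟩ := eventually_atTop.1 (eventually_large hD2 g hε'0 hdeg)
  have hug : ∀ (φ : CNF3) (u : ℕ), 1 ≤ u → (u : ℝ) ≤ (φ.size : ℝ) ^ γ → u ≤ φ.size ^ g := by
    intro φ u hu huγ
    rcases Nat.eq_zero_or_pos φ.size with h0 | h0
    · rw [h0, Nat.cast_zero, Real.zero_rpow hγ.ne'] at huγ
      have : (1 : ℝ) ≤ u := by exact_mod_cast hu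
      linarith
    · have h1 : (φ.size : ℝ) ^ γ ≤ (φ.size : ℝ) ^ (g : ℝ) :=
        Real.rpow_le_rpow_of_exponent_le (by exact_mod_cast h0) (Nat.le_ceil γ)
      rw [Real.rpow_natCast] at h1
      exact_mod_cast huγ.trans h1
  -- formulas of size less than `n₀` are looked up in a table
  obtain ⟨m, hm, hmem⟩ := PolyTime.exists_decide_mem
    (s := {φ : CNF3 | φ.size < n₀ ∧ φ.Satisfiable})
    ((finite_cnf_size_lt n₀).subset fun φ h => h.1)
  let ok : CNF3 × ℕ → Bool := fun x =>
    decide (n₀ ≤ x.1.size) && (decide (1 ≤ x.2) && decide (x.2 ≤ x.1.size ^ g))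
  let small : CNF3 × ℕ → SetCover × ℕ := fun x =>
    bif m x.1 then (trivialYes, 1) else (trivialNo, 1)
  have hokiff : ∀ x, ok x = true ↔ n₀ ≤ x.1.size ∧ 1 ≤ x.2 ∧ x.2 ≤ x.1.size ^ g := by
    intro x; simp [ok]
  have hlarge : ∀ x, ok x = true → Large F D g c ε' x.1.size := fun x hx =>
    hn₀ _ ((hokiff x).1 hx).1
  have hregime : ∀ x, ok x = true → Regime D g c x.1.size x.2 (F x.1).sB := fun x hx =>
    (hlarge x hx).regime _ rfl _ ((hokiff x).1 hx).2.1 ((hokiff x).1 hx).2.2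
  have hlen : ∀ x, ok x = true →
      (wordFamily D (F x.1).sB x.1.size x.2).length ≤ x.2 * x.1.size := by
    intro x hx
    have h1 := (hregime x hx).length_wordFamily_le
    have h2 : ((wordFamily D (F x.1).sB x.1.size x.2).length : ℝ) ≤ x.2 * x.1.size :=
      h1.trans (by gcongr; exact (hlarge x hx).pow_le)
    exact_mod_cast h2
  have hf1 : ∀ (φ : CNF3) (u : ℕ), 1 ≤ u → (u : ℝ) ≤ (φ.size : ℝ) ^ γ → n₀ ≤ φ.size → ok (φ, u) = true :=
    fun φ u hu huγ hn => (hokiff _).2 ⟨hn, hu, hug φ u hu huγ⟩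
  have hf2 : ∀ (φ : CNF3) (u : ℕ), ¬ n₀ ≤ φ.size → ok (φ, u) = false := by
    intro φ u hn
    rw [← Bool.not_eq_true, hokiff]
    exact fun h => hn h.1
  obtain ⟨f, hf, hfok, hfsmall⟩ : ∃ f : CNF3 × ℕ → SetCover × ℕ, PolyTime f ∧
      (∀ x, ok x = true → f x = reduction F D x) ∧ ∀ x, ok x = false → f x = small x := by
    have hok : PolyTime ok := by
      have hn : PolyTime (fun x : CNF3 × ℕ => x.1.size) := PolyTime.cnf_size.comp .fst'
      exact .and (.decide_le (.const _) hn) (.and (.decide_le (.const _) .snd')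
        (.decide_le .snd' (.pow_const hn g)))
    have hsmall : PolyTime small := .cond (hm.comp .fst') (.const _) (.const _)
    refine ⟨fun x => bif ok x then reduction F D x else small x,
      .dite hok (polyTime_reduction hF hregime hlen) (g := small)
        (hsmall.comp (.of_enc_eq fun _ => rfl)) ?_ ?_, ?_, ?_⟩ <;>
    · intro x hx; simp only [hx, cond_true, cond_false]
  refine ⟨f, hf, ?_, ?_⟩
  · intro φ u hu huγ
    by_cases hn : n₀ ≤ φ.size
    · have hok := hf1 φ u hu huγ hn
      have hr := hregime _ hok
      rw [hfok _ hok]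
      constructor
      · intro hsat
        obtain ⟨σA, σB, hcov⟩ := hcompl φ hsat
        exact ProjectionGame.exists_isCover
          (fun e he => ⟨hr.isHitting.length_eq e he, hr.isHitting.lt e he⟩) hcov
      · intro hunsat S hS
        have hgap := reduction_gap hr rfl hε'0 (min_le_right _ _) hD (hgraph φ).1 (hgraph φ).2
          (hlarge _ hok).log_pos (hsound φ hunsat)
          ((hlarge _ hok).small _ hr.threshold_le) hS
        refine lt_of_le_of_lt ?_ hgap
        have hlogu : 0 ≤ Real.log u := Real.log_natCast_nonneg u
        gcongr
        exact min_le_left _ _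
    · rw [hfsmall _ (hf2 φ u hn)]
      constructor
      · intro hsat
        have h1 : m φ = true := (hmem φ).2 ⟨not_le.1 hn, hsat⟩
        have h2 : small (φ, u) = (trivialYes, 1) := by simp only [small, h1, cond_true]
        rw [h2]
        exact exists_isCover_trivialYes
      · intro hunsat
        have h1 : m φ = false := by
          rw [← Bool.not_eq_true, hmem]
          exact fun h => hunsat h.2
        have h2 : small (φ, u) = (trivialNo, 1) := by simp only [small, h1, cond_false]
        rw [h2]
        exact fun S hS => absurd hS (not_isCover_trivialNo S)
  · intro δ hδ
    filter_upwards [eventually_ge_atTop n₀, hsize (δ / 2) (by positivity),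
      eventually_ratio_pow_le hD2 (c * D + 2 * c + 7) (η := δ / 2) (by positivity)]
      with n hn h1 h2 φ u hφ hu huγ
    subst hφ
    have hok := hf1 φ u hu huγ hn
    rw [hfok _ hok]
    exact reduction_universe_le (hlarge _ hok) hu (hug φ u hu huγ) (hgraph φ).2 (h1 φ rfl) h2
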